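/- **Setting.** Let $\Pi_0=(\Sigma_0,{\sf Pred})$ be a (one-sorted, countable, effectively presented) signature, and let $\Sigma_P$ (parameters: constants or functions), $\Sigma_N$ (other function symbols) and $V$ (system variables, regarded as constants) be disjoint, effectively presented sets of extension symbols; put $\Pi_P=\Pi_0\cup\Sigma_P$ and $\Pi_S=\Pi_0\cup\Sigma_P\cup\Sigma_N\cup V$. Let $\mathcal T_0$ be a $\Pi_0$-theory, $\mathcal K$ a finite set of (universally read) $\Pi_S$-clauses and $\mathcal T_S=\mathcal T_0\cup\mathcal K$. A system in which only variables are updated is given by formulae ${\sf Init}$ over $\Pi_S$ and ${\sf Update}$ over $\Pi_S\cup V'$, where $V'$ is a primed copy of $V$. For a $\Pi_S$-formula $\Phi$ let $\Phi'$ be $\Phi$ with every $x\in V$ replaced by $x'$. Given constraints $\Gamma$ over $\Pi_P$, $\Phi$ is an *inductive invariant under $\Gamma$* if $\mathcal T_S\wedge\Gamma\wedge{\sf Init}\wedge\neg\Phi\models\perp$ and $\mathcal T_S\wedge\Gamma\wedge\Phi\wedge{\sf Update}\wedge\neg\Phi'\models\perp$. A $\Pi_P$-sentence $\overline\Gamma$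 is a *weakest condition under which $\Phi$ is an inductive invariant* if for every $\Pi_P$-sentence $\Gamma$: $\Phi$ is an inductive invariant under $\Gamma$ iff $\mathcal T_S\cup\Gamma\models\overline\Gamma$. An extension $\mathcal T_0\subseteq\mathcal T_0\cup\mathcal K$ satisfies $({\sf Loc})$ if for every finite set $G$ of ground clauses (with fresh constants) $\mathcal T_0\cup\mathcal K\cup G\models\perp$ iff $\mathcal T_0\cup\mathcal K[G]\cup G\models\perp$, where $\mathcal K[G]$ is the set of instances of $\mathcal K$ in which all terms starting with an extension symbol are ground terms occurring in $\mathcal K$ or $G$ (variables not below an extension function are not instantiated). It satisfies $({\sf Comp}_f)$ if every weak partial model of $\mathcal T_0\cup\mathcal K$ with total $\Pi_0$-part that is a model of $\mathcal T_0$, with extension functions defined at finitely many arguments (constants always being defined), and in which the ground extension terms of $\mathcal K$ are defined, can be extended to a total model of $\mathcal T_0\cup\mathcal K$ with the same support. A non-ground clause is *flat* if only variables occur below extension functions, and *linear* if a variable occurs in at most one term starting with an extension function, and at most once in it; for ground clauses the same is required with constants in place of variables. **Theorem.** Assume that ${\sf Init}$, $\Phi$ and ${\sf Update}$ are quantifier-free.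 (a) Let $\Gamma=\Gamma_0\cup\Gamma_\Sigma$, where $\Gamma_0$ is a quantifier-free $\Pi_P$-sentence and $\Gamma_\Sigma$ is a finite set of $\Pi_P$-clauses, such that $\mathcal K\cup\Gamma_\Sigma$ consists of flat and linear clauses in which all variables occur below extension functions and $\mathcal T_0\subseteq\mathcal T_0\cup\mathcal K\cup\Gamma_\Sigma$ satisfies $({\sf Loc})$. Then the question whether $\Phi$ is an inductive invariant under $\Gamma$ is reduced, by a computable function of $(\mathcal K,\Gamma_\Sigma,\Gamma_0,{\sf Init},{\sf Update},\Phi)$ that does not depend on $\mathcal T_0$, to the unsatisfiability w.r.t. $\mathcal T_0$ of two ground $\Pi_0$-formulae with fresh constants. Consequently, if satisfiability of ground formulae w.r.t. $\mathcal T_0$ is decidable, then it is decidable, for such inputs, whether $\Phi$ is an inductive invariant under $\Gamma$. (b) There is an effective procedure, which uses a quantifier elimination method for $\mathcal T_0$ as an oracle and otherwise does not depend on $\mathcal T_0$, with the following property. If $\mathcal T_0$ allows quantifier elimination then, for all $\mathcal K$, ${\sf Init}$, ${\sf Update}$, $\Phi$, it constructs a universal $\Pi_P$-sentence $\overline\Gamma$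 such that $\Phi$ is an inductive invariant under $\overline\Gamma$. If in addition $\mathcal K$ consists of flat and linear clauses in which all variables occur below extension functions, $\mathcal T_0\subseteq\mathcal T_0\cup\mathcal K$ satisfies $({\sf Comp}_f)$, and no clause of $\mathcal K$ contains both a parameter that is a function of positive arity and an extension symbol outside $\Sigma_P$, then this $\overline\Gamma$ is a weakest condition under which $\Phi$ is an inductive invariant. -/

import Mathlib

open FirstOrder

namespace ParamSys

/-! ## Clauses

`L₀` is the base signature and `L₁` the signature of the extension symbols.  Predicate symbols
all belong to `L₀`.  `α` is a set of free symbols: variables (`α = ℕ`), fresh constants, or both. -/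

section Clauses

variable {L₀ L₁ : FirstOrder.Language.{0, 0}} {α β : Type}

inductive Atom (L₀ L₁ : FirstOrder.Language.{0, 0}) (α : Type) : Type
  | eq (t u : (L₀.sum L₁).Term α) : Atom L₀ L₁ α
  | rel {n : ℕ} (R : L₀.Relations n) (ts : Fin n → (L₀.sum L₁).Term α) : Atom L₀ L₁ α

/-- An atom (`pos = true`) or a negated atom (`pos = false`). -/
structure Literal (L₀ L₁ : FirstOrder.Language.{0, 0}) (α : Type) : Type where
  pos : Bool
  atom : Atom L₀ L₁ α

/-- A finite disjunction of literals. -/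
abbrev Clause (L₀ L₁ : FirstOrder.Language.{0, 0}) (α : Type) : Type := List (Literal L₀ L₁ α)

/-- The set of terms occurring in a term. -/
def subterms {L : FirstOrder.Language.{0, 0}} : L.Term α → Set (L.Term α)
  | .var a => {.var a}
  | .func f ts => insert (.func f ts) (⋃ i, subterms (ts i))

/-- The free symbols occurring in a term, listed with repetitions. -/
def varList {L : FirstOrder.Language.{0, 0}} : L.Term α → List α
  | .var a => [a]
  | .func _ ts => (List.ofFn fun i => varList (ts i)).flatten

/-- The constant symbols occurring in a term, listed with repetitions. -/
def constList {L : FirstOrder.Language.{0, 0}} : L.Term α → List (L.Functions 0)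
  | .var _ => []
  | @FirstOrder.Language.Term.func _ _ 0 f _ => [f]
  | @FirstOrder.Language.Term.func _ _ (_ + 1) _ ts => (List.ofFn fun i => constList (ts i)).flatten

/-- The extension term `f(ts)`, with `f` a symbol of `L₁`. -/
def extTerm {n : ℕ} (f : L₁.Functions n) (ts : Fin n → (L₀.sum L₁).Term α) :
    (L₀.sum L₁).Term α :=
  .func (FirstOrder.Language.LHom.sumInr.onFunction f) ts

def IsExt (t : (L₀.sum L₁).Term α) : Prop :=
  ∃ (n : ℕ) (f : L₁.Functions n) (ts : Fin n → (L₀.sum L₁).Term α), t = extTerm f ts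

namespace Atom

/-- The terms occurring in an atom. -/
def subterms : Atom L₀ L₁ α → Set ((L₀.sum L₁).Term α)
  | eq t u => ParamSys.subterms t ∪ ParamSys.subterms u
  | rel _ ts => ⋃ i, ParamSys.subterms (ts i)

def subst (σ : α → (L₀.sum L₁).Term β) : Atom L₀ L₁ α → Atom L₀ L₁ β
  | eq t u => eq (t.subst σ) (u.subst σ)
  | rel R ts => rel R fun i => (ts i).subst σ

/-- Rename the extension symbols along `φ`. -/
def mapExt {L₁' : FirstOrder.Language.{0, 0}} (φ : L₁ →ᴸ L₁') : Atom L₀ L₁ α → Atom L₀ L₁' α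
  | eq t u => eq ((FirstOrder.Language.LHom.sumMap (FirstOrder.Language.LHom.id L₀) φ).onTerm t)
      ((FirstOrder.Language.LHom.sumMap (FirstOrder.Language.LHom.id L₀) φ).onTerm u)
  | rel R ts => rel R fun i => (FirstOrder.Language.LHom.sumMap (FirstOrder.Language.LHom.id L₀) φ).onTerm (ts i)

def Realize {M : Type} [L₀.Structure M] [L₁.Structure M] (v : α → M) : Atom L₀ L₁ α → Prop
  | eq t u => t.realize v = u.realize v
  | rel R ts => FirstOrder.Language.Structure.RelMap R fun i => (ts i).realize v

end Atom

def Literal.Realize {M : Type} [L₀.Structure M] [L₁.Structure M] (l : Literal L₀ L₁ α)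
    (v : α → M) : Prop :=
  if l.pos then l.atom.Realize v else ¬ l.atom.Realize v

namespace Clause

def subterms (D : Clause L₀ L₁ α) : Set ((L₀.sum L₁).Term α) := ⋃ l ∈ D, l.atom.subterms

def subst (σ : α → (L₀.sum L₁).Term β) (D : Clause L₀ L₁ α) : Clause L₀ L₁ β :=
  D.map fun l => ⟨l.pos, l.atom.subst σ⟩

def mapExt {L₁' : FirstOrder.Language.{0, 0}} (φ : L₁ →ᴸ L₁') (D : Clause L₀ L₁ α) : Clause L₀ L₁' α :=
  D.map fun l => ⟨l.pos, l.atom.mapExt φ⟩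

def Realize {M : Type} [L₀.Structure M] [L₁.Structure M] (D : Clause L₀ L₁ α)
    (v : α → M) : Prop :=
  ∃ l ∈ D, l.Realize v

/-- The symbol `f` of `L₁` occurs in the clause. -/
def HasSymbol (D : Clause L₀ L₁ α) {n : ℕ} (f : L₁.Functions n) : Prop :=
  ∃ ts, extTerm f ts ∈ D.subterms

/-- The variable `x` occurs in the clause. -/
def HasVar (D : Clause L₀ L₁ α) (x : α) : Prop := FirstOrder.Language.Term.var x ∈ D.subterms

/-- The variable `x` occurs in the clause below an extension function. -/
def VarBelowExt (D : Clause L₀ L₁ α) (x : α) : Prop :=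
  ∃ (n : ℕ) (f : L₁.Functions n) (ts : Fin n → (L₀.sum L₁).Term α),
    extTerm f ts ∈ D.subterms ∧ ∃ i, x ∈ varList (ts i)

def IsGround (D : Clause L₀ L₁ α) : Prop := ∀ x, ¬ D.HasVar x

/-- Flatness: below an extension function there are only variables if the clause is not ground,
and only constants if it is ground. -/
def Flat (D : Clause L₀ L₁ α) : Prop :=
  ∀ (n : ℕ) (f : L₁.Functions n) (ts : Fin n → (L₀.sum L₁).Term α),
    extTerm f ts ∈ D.subterms → ∀ i,
      (¬ D.IsGround → ∃ x, ts i = .var x) ∧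
      (D.IsGround → ∃ (c : (L₀.sum L₁).Functions 0) (us : _), ts i = .func c us)

/-- Linearity, for terms that start with an extension function of positive arity: in a clause
that is not ground, a variable occurs in at most one such term, and at most once in it; in a
ground clause the same holds for the constants. -/
def Linear (D : Clause L₀ L₁ α) : Prop :=
  ∀ (n : ℕ) (f : L₁.Functions (n + 1)) (ts : Fin (n + 1) → (L₀.sum L₁).Term α),
    extTerm f ts ∈ D.subterms →
      (¬ D.IsGround → (varList (extTerm f ts)).Nodup ∧
        ∀ (m : ℕ) (g : L₁.Functions (m + 1)) (us : Fin (m + 1) → (L₀.sum L₁).Term α),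
          extTerm g us ∈ D.subterms →
          (∃ x, x ∈ varList (extTerm f ts) ∧ x ∈ varList (extTerm g us)) →
          extTerm f ts = extTerm g us) ∧
      (D.IsGround → (constList (extTerm f ts)).Nodup ∧
        ∀ (m : ℕ) (g : L₁.Functions (m + 1)) (us : Fin (m + 1) → (L₀.sum L₁).Term α),
          extTerm g us ∈ D.subterms →
          (∃ c, c ∈ constList (extTerm f ts) ∧ c ∈ constList (extTerm g us)) →
          extTerm f ts = extTerm g us)

end Clause

end Clauses

/-! ## Local theory extensions

A set `K` of clauses over variables `ℕ` is read universally.  The countable set `C` of fresh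
constants is `ℕ` too: a ground term over the signature with constants `C` is a term whose free
symbols are elements of `C`, and a structure for that signature is a structure together with a
valuation `c : ℕ → M`. -/

section Locality

variable {L₀ L₁ : FirstOrder.Language.{0, 0}}

/-- `M` is a model of `T₀ ∪ K`. -/
def IsModel (T₀ : L₀.Theory) (K : List (Clause L₀ L₁ ℕ)) (M : Type) [L₀.Structure M]
    [L₁.Structure M] : Prop :=
  M ⊨ T₀ ∧ ∀ D ∈ K, ∀ v : ℕ → M, D.Realize v

/-- `est(K, G)`: the ground extension terms that occur in `G` or in `K`. -/
def est (K G : List (Clause L₀ L₁ ℕ)) : Set ((L₀.sum L₁).Term ℕ) :=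
  {t | IsExt t ∧ ((∃ D ∈ G, t ∈ D.subterms) ∨ (∃ D ∈ K, t ∈ D.subterms ∧ varList t = []))}

/-- `K[T]`, over fresh constants (`Sum.inl`) and variables (`Sum.inr`): the instances in which
all extension terms belong to `T` and the variables that do not occur below an extension
function are left unchanged. -/
def instances (K : List (Clause L₀ L₁ ℕ)) (T : Set ((L₀.sum L₁).Term ℕ)) :
    Set (Clause L₀ L₁ (ℕ ⊕ ℕ)) :=
  {D' | ∃ D ∈ K, ∃ σ : ℕ → (L₀.sum L₁).Term (ℕ ⊕ ℕ),
    D' = D.subst σ ∧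
    (∀ t ∈ D'.subterms, IsExt t → ∃ u ∈ T, t = u.relabel Sum.inl) ∧
    (∀ x, ¬ D.VarBelowExt x → σ x = .var (Sum.inr x))}

/-- Condition (Loc): for every finite set `G` of ground clauses, `T₀ ∪ K ∪ G` is satisfiable iff
`T₀ ∪ K[G] ∪ G` is. -/
def Loc (T₀ : L₀.Theory) (K : List (Clause L₀ L₁ ℕ)) : Prop :=
  ∀ G : List (Clause L₀ L₁ ℕ),
    (¬ ∃ (M : Type) (_ : Nonempty M) (_ : L₀.Structure M) (_ : L₁.Structure M) (c : ℕ → M),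
      IsModel T₀ K M ∧ ∀ D ∈ G, D.Realize c) ↔
    (¬ ∃ (M : Type) (_ : Nonempty M) (_ : L₀.Structure M) (_ : L₁.Structure M) (c : ℕ → M),
      M ⊨ T₀ ∧ (∀ D ∈ instances K (est K G), ∀ v : ℕ → M, D.Realize (Sum.elim c v)) ∧
      ∀ D ∈ G, D.Realize c)

/-- Interpretation of the symbols of `L₁` by partial functions on `M`; constants are always
defined. -/
structure PartialInterp (L₁ : FirstOrder.Language.{0, 0}) (M : Type) where
  fn : ∀ {n : ℕ}, L₁.Functions n → (Fin n → M) → Option M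
  const_defined : ∀ (c : L₁.Functions 0) (a : Fin 0 → M), (fn c a).isSome

namespace PartialInterp

variable {M : Type} [L₀.Structure M] {α : Type}

/-- Evaluation of a term; `none` means that the term is undefined. -/
def eval (P : PartialInterp L₁ M) (v : α → M) : (L₀.sum L₁).Term α → Option M
  | .var a => some (v a)
  | @FirstOrder.Language.Term.func _ _ n f ts =>
    if h : ∀ i, (eval P v (ts i)).isSome then
      Sum.elim
        (fun f₀ : L₀.Functions n =>
          some (FirstOrder.Language.Structure.funMap f₀ fun i => (eval P v (ts i)).get (h i)))
        (fun f₁ : L₁.Functions n => P.fn f₁ fun i => (eval P v (ts i)).get (h i)) f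
    else none

/-- All terms of the atom are defined. -/
def AtomDefined (P : PartialInterp L₁ M) (v : α → M) : Atom L₀ L₁ α → Prop
  | .eq t u => (P.eval v t).isSome ∧ (P.eval v u).isSome
  | .rel _ ts => ∀ i, (P.eval v (ts i)).isSome

/-- All terms of the atom are defined, and the atom is true. -/
def AtomTrue (P : PartialInterp L₁ M) (v : α → M) : Atom L₀ L₁ α → Prop
  | .eq t u => ∃ a, P.eval v t = some a ∧ P.eval v u = some a
  | .rel R ts => ∃ a, (∀ i, P.eval v (ts i) = some (a i)) ∧ FirstOrder.Language.Structure.RelMap R a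

/-- Weak validity of a clause: some literal is undefined, or some literal is true. -/
def WeaklySat (P : PartialInterp L₁ M) (D : Clause L₀ L₁ α) (v : α → M) : Prop :=
  (∃ l ∈ D, ¬ P.AtomDefined v l.atom) ∨
  (∀ l ∈ D, P.AtomDefined v l.atom) ∧
    ∃ l ∈ D, if l.pos then P.AtomTrue v l.atom else ¬ P.AtomTrue v l.atom

end PartialInterp

/-- The partial structure `(M, P)`, whose `L₀`-part is total, is a weak partial model of `T₀ ∪ K`;
the extension functions (of positive arity) are defined at finitely many arguments only, and the
ground extension terms of `K` are defined. -/
def IsFiniteWeakPartialModel (T₀ : L₀.Theory) (K : List (Clause L₀ L₁ ℕ)) {M : Type}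
    [L₀.Structure M] (P : PartialInterp L₁ M) : Prop :=
  M ⊨ T₀ ∧
  (∀ D ∈ K, ∀ v : ℕ → M, P.WeaklySat D v) ∧
  {x : Σ n, L₁.Functions (n + 1) × (Fin (n + 1) → M) | (P.fn x.2.1 x.2.2).isSome}.Finite ∧
  (∀ t ∈ est K [], ∀ v : ℕ → M, (P.eval v t).isSome)

/-- Condition (Comp_f): every finite weak partial model can be completed, on the same support,
to a total model of `T₀ ∪ K`. -/
def CompF (T₀ : L₀.Theory) (K : List (Clause L₀ L₁ ℕ)) : Prop :=
  ∀ (M : Type) (_ : Nonempty M) (_ : L₀.Structure M) (P : PartialInterp L₁ M),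
    IsFiniteWeakPartialModel T₀ K P →
    ∃ _ : L₁.Structure M,
      (∀ (n : ℕ) (f : L₁.Functions n) (a : Fin n → M) (b : M),
        P.fn f a = some b → FirstOrder.Language.Structure.funMap f a = b) ∧
      IsModel T₀ K M

/-- Flat, linear, and every variable of a clause occurs in it below an extension function. -/
def FlatLinearBelow (K : List (Clause L₀ L₁ ℕ)) : Prop :=
  ∀ D ∈ K, D.Flat ∧ D.Linear ∧ ∀ x, D.HasVar x → D.VarBelowExt x

end Locality

/-! ## Systems in which only variables are updated -/

section Systems

/-- The extension symbols of a system: the parameters `LP`, the other extension symbols `LN`, and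
one constant for every element of `X`, the set `V` of system variables or its doubling `V ⊕ V`
(unprimed variables on the left, primed variables on the right). -/
abbrev ExtL (LP LN : FirstOrder.Language.{0, 0}) (X : Type) : FirstOrder.Language.{0, 0} :=
  LP.sum (LN.sum (FirstOrder.Language.constantsOn X))

variable {L₀ LP LN : FirstOrder.Language.{0, 0}} {V : Type}

/-- The sentence `φ` holds in `M` when the constants in `X` take the values `s`. -/
def HoldsAt {X : Type} (M : Type) [L₀.Structure M] [LP.Structure M] [LN.Structure M] (s : X → M)
    (φ : (L₀.sum (ExtL LP LN X)).Sentence) : Prop :=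
  letI : (FirstOrder.Language.constantsOn X).Structure M := FirstOrder.Language.constantsOn.structure s
  M ⊨ φ

/-- `M`, with the values `s` of the system variables, is a model of `T_S = T₀ ∪ K`. -/
def IsSysModel (T₀ : L₀.Theory) (K : List (Clause L₀ (ExtL LP LN V) ℕ)) (M : Type)
    [L₀.Structure M] [LP.Structure M] [LN.Structure M] (s : V → M) : Prop :=
  letI : (FirstOrder.Language.constantsOn V).Structure M := FirstOrder.Language.constantsOn.structure s
  IsModel T₀ K M

/-- `Φ` is an inductive invariant under the constraint `Γ` on the parameters:
`T_S ∧ Γ ∧ Init ∧ ¬Φ` and `T_S ∧ Γ ∧ Φ ∧ Update ∧ ¬Φ'` are unsatisfiable.  Since only variables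
are updated, `Φ'` says that `Φ` holds for the values `s'` of the primed variables. -/
def IsInvariantUnder (T₀ : L₀.Theory) (K : List (Clause L₀ (ExtL LP LN V) ℕ))
    (Γ : (L₀.sum LP).Sentence) (Init : (L₀.sum (ExtL LP LN V)).Sentence)
    (Update : (L₀.sum (ExtL LP LN (V ⊕ V))).Sentence)
    (Φ : (L₀.sum (ExtL LP LN V)).Sentence) : Prop :=
  (¬ ∃ (M : Type) (_ : Nonempty M) (_ : L₀.Structure M) (_ : LP.Structure M)
      (_ : LN.Structure M) (s : V → M),
      IsSysModel T₀ K M s ∧ M ⊨ Γ ∧ HoldsAt M s Init ∧ ¬ HoldsAt M s Φ) ∧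
  (¬ ∃ (M : Type) (_ : Nonempty M) (_ : L₀.Structure M) (_ : LP.Structure M)
      (_ : LN.Structure M) (s s' : V → M),
      IsSysModel T₀ K M s ∧ M ⊨ Γ ∧ HoldsAt M s Φ ∧ HoldsAt M (Sum.elim s s') Update ∧
      ¬ HoldsAt M s' Φ)

/-- `Γ'` is a weakest condition under which `Φ` is an inductive invariant: for every sentence `Γ`
over the parameters, `Φ` is an inductive invariant under `Γ` iff `T_S ∪ Γ ⊨ Γ'`. -/
def IsWeakestCondition (T₀ : L₀.Theory) (K : List (Clause L₀ (ExtL LP LN V) ℕ))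
    (Γ' : (L₀.sum LP).Sentence) (Init : (L₀.sum (ExtL LP LN V)).Sentence)
    (Update : (L₀.sum (ExtL LP LN (V ⊕ V))).Sentence)
    (Φ : (L₀.sum (ExtL LP LN V)).Sentence) : Prop :=
  ∀ Γ : (L₀.sum LP).Sentence,
    IsInvariantUnder T₀ K Γ Init Update Φ ↔
    ∀ (M : Type) (_ : Nonempty M) (_ : L₀.Structure M) (_ : LP.Structure M)
      (_ : LN.Structure M) (s : V → M), IsSysModel T₀ K M s → M ⊨ Γ → M ⊨ Γ'

/-- The parameters occurring in the clause are constants. -/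
def NoFunctionalParameter (D : Clause L₀ (ExtL LP LN V) ℕ) : Prop :=
  ∀ (n : ℕ) (f : LP.Functions (n + 1)),
    ¬ D.HasSymbol ((FirstOrder.Language.LHom.sumInl : LP →ᴸ ExtL LP LN V).onFunction f)

/-- All extension symbols occurring in the clause are parameters. -/
def OnlyParameters (D : Clause L₀ (ExtL LP LN V) ℕ) : Prop :=
  ∀ (n : ℕ) (f : (LN.sum (FirstOrder.Language.constantsOn V)).Functions n),
    ¬ D.HasSymbol ((FirstOrder.Language.LHom.sumInr : _ →ᴸ ExtL LP LN V).onFunction f)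

/-- No clause of `K` links a functional parameter with a non-parametric extension symbol. -/
def ParametersSeparated (K : List (Clause L₀ (ExtL LP LN V) ℕ)) : Prop :=
  ∀ D ∈ K, NoFunctionalParameter D ∨ OnlyParameters D

/-- A set of clauses over the parameters, as clauses over the signature of the system. -/
def liftClauses (LN : FirstOrder.Language.{0, 0}) (V : Type) (Γ : List (Clause L₀ LP ℕ)) :
    List (Clause L₀ (ExtL LP LN V) ℕ) :=
  Γ.map fun D => D.mapExt FirstOrder.Language.LHom.sumInl

end Systems

/-! ## Ground satisfiability and quantifier elimination in the base theory -/

section Base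

variable {L₀ : FirstOrder.Language.{0, 0}}

/-- Satisfiability of `G` w.r.t. `T₀`; the free symbols of `G` are the fresh constants. -/
def BaseSat (T₀ : L₀.Theory) (G : L₀.Formula ℕ) : Prop :=
  ∃ (M : Type) (_ : Nonempty M) (_ : L₀.Structure M) (c : ℕ → M), M ⊨ T₀ ∧ G.Realize c

/-- `qe` assigns to every formula a quantifier-free formula that is equivalent modulo `T₀`.  Such
a function exists iff `T₀` allows quantifier elimination. -/
def EliminatesQuantifiers (T₀ : L₀.Theory) (qe : L₀.Formula ℕ → L₀.Formula ℕ) : Prop :=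
  ∀ φ : L₀.Formula ℕ, (qe φ).IsQF ∧
    ∀ (M : Type) (_ : Nonempty M) (_ : L₀.Structure M), M ⊨ T₀ →
      ∀ v : ℕ → M, (qe φ).Realize v ↔ φ.Realize v

end Base

/-! ## Gödel numbers and computability -/

section Coding

/-- Signatures with a decidable set of (countably many) symbols and computable arities. -/
class EffectiveSignature (L : FirstOrder.Language.{0, 0}) where
  functions : Primcodable (Σ n, L.Functions n)
  relations : Primcodable (Σ n, L.Relations n)
  arity_functions : Computable (Sigma.fst : (Σ n, L.Functions n) → ℕ)
  arity_relations : Computable (Sigma.fst : (Σ n, L.Relations n) → ℕ)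

/-- Numbering of the symbols of a signature. -/
class SymbolCode (L : FirstOrder.Language.{0, 0}) where
  fcode : (Σ n, L.Functions n) → ℕ
  rcode : (Σ n, L.Relations n) → ℕ
  fcode_inj : Function.Injective fcode
  rcode_inj : Function.Injective rcode

instance (L : FirstOrder.Language.{0, 0}) [h : EffectiveSignature L] : SymbolCode L where
  fcode := h.functions.encode
  rcode := h.relations.encode
  fcode_inj := h.functions.encode_injective
  rcode_inj := h.relations.encode_injective

instance (L L' : FirstOrder.Language.{0, 0}) [h : SymbolCode L] [h' : SymbolCode L'] :
    SymbolCode (L.sum L') where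
  fcode
    | ⟨n, Sum.inl f⟩ => 2 * h.fcode ⟨n, f⟩
    | ⟨n, Sum.inr f⟩ => 2 * h'.fcode ⟨n, f⟩ + 1
  rcode
    | ⟨n, Sum.inl R⟩ => 2 * h.rcode ⟨n, R⟩
    | ⟨n, Sum.inr R⟩ => 2 * h'.rcode ⟨n, R⟩ + 1
  fcode_inj := by
    rintro ⟨n, f | f⟩ ⟨m, g | g⟩ e <;> simp only at e
    · have := h.fcode_inj (show h.fcode ⟨n, f⟩ = h.fcode ⟨m, g⟩ by omega)
      cases this; rfl
    · omega
    · omega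
    · have := h'.fcode_inj (show h'.fcode ⟨n, f⟩ = h'.fcode ⟨m, g⟩ by omega)
      cases this; rfl
  rcode_inj := by
    rintro ⟨n, f | f⟩ ⟨m, g | g⟩ e <;> simp only at e
    · have := h.rcode_inj (show h.rcode ⟨n, f⟩ = h.rcode ⟨m, g⟩ by omega)
      cases this; rfl
    · omega
    · omega
    · have := h'.rcode_inj (show h'.rcode ⟨n, f⟩ = h'.rcode ⟨m, g⟩ by omega)
      cases this; rfl

instance (X : Type) [Encodable X] : SymbolCode (FirstOrder.Language.constantsOn X) where
  fcode
    | ⟨0, x⟩ => Encodable.encode (show X from x)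
    | ⟨_ + 1, x⟩ => nomatch (show PEmpty from x)
  rcode
    | ⟨_, R⟩ => nomatch (show Empty from R)
  fcode_inj := by
    rintro ⟨_ | n, x⟩ ⟨_ | m, y⟩ e
    · have : (show X from x) = (show X from y) := Encodable.encode_injective e
      exact congrArg (Sigma.mk 0) this
    · exact nomatch (show PEmpty from y)
    · exact nomatch (show PEmpty from x)
    · exact nomatch (show PEmpty from x)
  rcode_inj := by
    rintro ⟨_, R⟩
    exact nomatch (show Empty from R)

/-- Types of finite syntactic objects with a Gödel numbering. -/
class Coded (A : Type) where
  code : A → ℕ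
  code_inj : Function.Injective code

variable {L : FirstOrder.Language.{0, 0}} {α : Type}

def codeTerm [SymbolCode L] [Encodable α] : L.Term α → ℕ
  | .var a => Nat.pair 0 (Encodable.encode a)
  | @FirstOrder.Language.Term.func _ _ n f ts =>
    Nat.pair 1 (Nat.pair (SymbolCode.fcode (⟨n, f⟩ : Σ n, L.Functions n))
      (Encodable.encode (List.ofFn fun i => codeTerm (ts i))))

theorem codeTerm_inj [SymbolCode L] [Encodable α] :
    Function.Injective (codeTerm : L.Term α → ℕ) := by
  intro t
  induction t with
  | var a =>
    intro u e
    cases u with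
    | var b => simpa [codeTerm] using e
    | func g us => simp [codeTerm] at e
  | @func n f ts ih =>
    intro u e
    cases u with
    | var b => simp [codeTerm] at e
    | @func m g us =>
      simp only [codeTerm, Nat.pair_eq_pair, true_and] at e
      have h := SymbolCode.fcode_inj e.1
      cases h
      have h2 := List.ofFn_injective (Encodable.encode_injective e.2)
      exact congrArg _ (funext fun i => ih i (congrFun h2 i))

def codeFormula [SymbolCode L] [Encodable α] : ∀ {n : ℕ}, L.BoundedFormula α n → ℕ
  | _, .falsum => Nat.pair 0 0
  | _, .equal t u => Nat.pair 1 (Nat.pair (codeTerm t) (codeTerm u))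
  | _, @FirstOrder.Language.BoundedFormula.rel _ _ _ l R ts =>
    Nat.pair 2 (Nat.pair (SymbolCode.rcode (⟨l, R⟩ : Σ n, L.Relations n))
      (Encodable.encode (List.ofFn fun i => codeTerm (ts i))))
  | _, .imp φ ψ => Nat.pair 3 (Nat.pair (codeFormula φ) (codeFormula ψ))
  | _, .all φ => Nat.pair 4 (codeFormula φ)

theorem codeFormula_inj [SymbolCode L] [Encodable α] {n : ℕ} :
    Function.Injective (codeFormula : L.BoundedFormula α n → ℕ) := by
  intro φ
  induction φ with
  | falsum => intro ψ e; cases ψ <;> simp [codeFormula] at e ⊢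
  | equal t u =>
    intro ψ e
    cases ψ <;> simp [codeFormula] at e ⊢
    exact ⟨codeTerm_inj e.1, codeTerm_inj e.2⟩
  | @rel n l R ts =>
    intro ψ e
    cases ψ <;> simp only [codeFormula, Nat.pair_eq_pair] at e <;> try omega
    have h := SymbolCode.rcode_inj e.2.1
    cases h
    have h2 := List.ofFn_injective (Encodable.encode_injective e.2.2)
    exact congrArg _ (funext fun i => codeTerm_inj (congrFun h2 i))
  | imp φ₁ φ₂ ih₁ ih₂ =>
    intro ψ e
    cases ψ <;> simp [codeFormula] at e ⊢
    exact ⟨ih₁ e.1, ih₂ e.2⟩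
  | all φ ih =>
    intro ψ e
    cases ψ <;> simp [codeFormula] at e ⊢
    exact ih e

instance [SymbolCode L] [Encodable α] {n : ℕ} : Coded (L.BoundedFormula α n) :=
  ⟨codeFormula, codeFormula_inj⟩

instance (A B : Type) [Coded A] [Coded B] : Coded (A × B) where
  code x := Nat.pair (Coded.code x.1) (Coded.code x.2)
  code_inj x y e := by
    have h := Nat.pair_eq_pair.1 e
    exact Prod.ext (Coded.code_inj h.1) (Coded.code_inj h.2)

instance (A : Type) [Coded A] : Coded (List A) where
  code l := Encodable.encode (l.map Coded.code)
  code_inj l l' e :=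
    List.map_injective_iff.2 Coded.code_inj (Encodable.encode_injective e)

variable {L₀ L₁ : FirstOrder.Language.{0, 0}}

def codeAtom [SymbolCode L₀] [SymbolCode L₁] [Encodable α] : Atom L₀ L₁ α → ℕ
  | .eq t u => Nat.pair 0 (Nat.pair (codeTerm t) (codeTerm u))
  | @Atom.rel _ _ _ n R ts =>
    Nat.pair 1 (Nat.pair (SymbolCode.rcode (⟨n, R⟩ : Σ n, L₀.Relations n))
      (Encodable.encode (List.ofFn fun i => codeTerm (ts i))))

instance [SymbolCode L₀] [SymbolCode L₁] [Encodable α] : Coded (Literal L₀ L₁ α) where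
  code l := Nat.pair l.pos.toNat (codeAtom l.atom)
  code_inj := by
    rintro ⟨p, a⟩ ⟨q, b⟩ e
    have e' := Nat.pair_eq_pair.1 e
    have hp : p = q := by cases p <;> cases q <;> simp at e' ⊢
    have ha : a = b := by
      have h := e'.2
      cases a <;> cases b <;> simp only [codeAtom, Nat.pair_eq_pair] at h <;> try omega
      · rw [codeTerm_inj h.2.1, codeTerm_inj h.2.2]
      · have h1 := SymbolCode.rcode_inj h.2.1
        cases h1
        have h2 := List.ofFn_injective (Encodable.encode_injective h.2.2)
        exact congrArg _ (funext fun i => codeTerm_inj (congrFun h2 i))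
    rw [hp, ha]

/-- A function between syntactic objects is computable if it is so on Gödel numbers. -/
def ComputableOnCodes {A B : Type} [Coded A] [Coded B] (f : A → B) : Prop :=
  ∃ g : ℕ → ℕ, Computable g ∧ ∀ a, g (Coded.code a) = Coded.code (f a)

/-- The problem `Q` is decidable for the inputs that satisfy `P`. -/
def DecidableOn {A : Type} [Coded A] (P Q : A → Prop) : Prop :=
  ∃ d : ℕ → Bool, Computable d ∧ ∀ a, P a → (d (Coded.code a) = true ↔ Q a)

end Coding

/-! ## The inputs -/

section Inputs

/-- The quantifier-free formulas `Init`, `Update` and `Φ`. -/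
abbrev SysInput (L₀ LP LN : FirstOrder.Language.{0, 0}) (V : Type) : Type :=
  (L₀.sum (ExtL LP LN V)).Sentence × (L₀.sum (ExtL LP LN (V ⊕ V))).Sentence ×
    (L₀.sum (ExtL LP LN V)).Sentence

variable {L₀ LP LN : FirstOrder.Language.{0, 0}} {V : Type}

def SysInput.Ground (S : SysInput L₀ LP LN V) : Prop := S.1.IsQF ∧ S.2.1.IsQF ∧ S.2.2.IsQF

/-- An invariant checking problem: `K`, `Γ_Σ`, `Γ₀` and `(Init, Update, Φ)`. -/
abbrev CheckInput (L₀ LP LN : FirstOrder.Language.{0, 0}) (V : Type) : Type :=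
  List (Clause L₀ (ExtL LP LN V) ℕ) × List (Clause L₀ LP ℕ) × (L₀.sum LP).Sentence ×
    SysInput L₀ LP LN V

/-- `Init`, `Update`, `Φ` and `Γ₀` are quantifier-free, and Loc(`T_S ∪ Γ_Σ`) holds: `K ∪ Γ_Σ`
consists of flat and linear clauses in which all variables occur below extension functions, and
`T₀ ⊆ T₀ ∪ K ∪ Γ_Σ` is a local extension. -/
def CheckInput.Admissible (T₀ : L₀.Theory) (I : CheckInput L₀ LP LN V) : Prop :=
  I.2.2.2.Ground ∧ I.2.2.1.IsQF ∧
    FlatLinearBelow (I.1 ++ liftClauses LN V I.2.1) ∧ Loc T₀ (I.1 ++ liftClauses LN V I.2.1)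

/-- `Φ` is an inductive invariant of the system with theory `T_S = T₀ ∪ K` under the constraints
`Γ₀ ∪ Γ_Σ`. -/
def CheckInput.Invariant (T₀ : L₀.Theory) (I : CheckInput L₀ LP LN V) : Prop :=
  IsInvariantUnder T₀ (I.1 ++ liftClauses LN V I.2.1) I.2.2.1 I.2.2.2.1 I.2.2.2.2.1 I.2.2.2.2.2

/-- A synthesis problem: `K` and `(Init, Update, Φ)`. -/
abbrev SynthInput (L₀ LP LN : FirstOrder.Language.{0, 0}) (V : Type) : Type :=
  List (Clause L₀ (ExtL LP LN V) ℕ) × SysInput L₀ LP LN V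

end Inputs

end ParamSys

set_option linter.unusedSectionVars false
open FirstOrder

namespace ParamSys

/-! ## Automation for computability proofs -/

section Automation

attribute [fun_prop] Primrec Computable

variable {A B G : Type} [Primcodable A] [Primcodable B] [Primcodable G]

/-! The whole argument works with values of finitely many named terms. A name is a closure `cl tag e
t`: a term code `t`, an environment `e`, and a tag telling over which signature `t` is read (0:
unprimed and primed variables; 1: unprimed variables; 2: the same signature read with primed values;
3: parameters only; 4 to 7: second copies of these). Environment 0 belongs to ground terms, and
environment `e + 1` sends variables to ground closures. If `w` is the code of the input and `N = w +
1`, all terms of the input have codes below `N`. So all closures below `bound N` and all `envs N`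
environments may be used, without finding out which of them matter.

The formula `systemF` is the hierarchical reduction: base functions have their meaning, extension
functions satisfy the congruence axioms, variables take the values prescribed by the environment,
and all clauses hold in all environments. Superfluous names do no harm. In every structure there are
consistent values for all closures, including numbers that code no term (`exists_values`), and
superfluous instances follow from the universal reading of the clauses. Since the formula is
assembled from the number `w` by bounded conjunctions, it is computable on codes and independent of
the base theory.

For (a), a model of the system yields values satisfying the ground formula. Conversely, congruence
turns such values into total functions on the same support (`evaluates_interp`). The quantifier-free
formulas are rewritten as ground clauses `G`, with fresh constants for the primed variables
(`exists_clausesFor`). Flatness and the condition on variables force every variable in a local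
instance to take the value of a ground closure, so the environments cover all of `K[G]`
(`realize_instance`). Now `Loc` supplies a model of the full clauses together with `G`
(`exists_isSysModel`), and `G` is translated back there.

For (b), the existential quantifier binds all names except the parameter terms and the copies of
closures. Copies are kept because the arguments of a parameter may be terms that are eliminated; the
link condition equates each such argument with its copy. The constraint states that no values of the
kept names, when each parameter term is the parameter applied to the copies of its arguments,
satisfy the quantifier-free forms of the two queries (`realize_constraint`). A counterexample to
invariance would provide such values, so the constraint is sufficient.

For weakness, take a model of the system and of `Γ` with values that violate the constraint. Its
parameters are retained, and the other symbols are redefined from the values. The restriction to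
values of ground closures is a finite weak partial model, which `CompF` completes. The completion
may alter functional parameters; these are put back. Clauses without functional parameters keep the
truth value they have in the completion, and clauses with only parameters are true because they were
true in the original model (`exists_completion`). The result still satisfies `Γ`, which mentions
only base symbols and parameters, and it contradicts invariance under `Γ`. -/

@[fun_prop] theorem primrec_id : Primrec fun a : A => a := Primrec.id

@[fun_prop] theorem primrec_const (b : B) : Primrec fun _ : A => b := Primrec.const b

@[fun_prop] theorem primrec_comp {f : B → G} {g : A → B} (hf : Primrec f) (hg : Primrec g) :
    Primrec fun a => f (g a) := hf.comp hg

@[fun_prop] theorem primrec_mk {f : A → B} {g : A → G} (hf : Primrec f) (hg : Primrec g) :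
    Primrec fun a => (f a, g a) := hf.pair hg

@[fun_prop] theorem primrec_fst {f : A → B × G} (hf : Primrec f) : Primrec fun a => (f a).1 :=
  Primrec.fst.comp hf

@[fun_prop] theorem primrec_snd {f : A → B × G} (hf : Primrec f) : Primrec fun a => (f a).2 :=
  Primrec.snd.comp hf

@[fun_prop] theorem primrec_natPair {f g : A → ℕ} (hf : Primrec f) (hg : Primrec g) :
    Primrec fun a => Nat.pair (f a) (g a) := Primrec₂.natPair.comp hf hg

@[fun_prop] theorem primrec_unpair {f : A → ℕ} (hf : Primrec f) :
    Primrec fun a => Nat.unpair (f a) := Primrec.unpair.comp hf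

@[fun_prop] theorem primrec_add {f g : A → ℕ} (hf : Primrec f) (hg : Primrec g) :
    Primrec fun a => f a + g a := Primrec.nat_add.comp hf hg

@[fun_prop] theorem primrec_sub {f g : A → ℕ} (hf : Primrec f) (hg : Primrec g) :
    Primrec fun a => f a - g a := Primrec.nat_sub.comp hf hg

@[fun_prop] theorem primrec_mul {f g : A → ℕ} (hf : Primrec f) (hg : Primrec g) :
    Primrec fun a => f a * g a := Primrec.nat_mul.comp hf hg

@[fun_prop] theorem primrec_div {f g : A → ℕ} (hf : Primrec f) (hg : Primrec g) :
    Primrec fun a => f a / g a := Primrec.nat_div.comp hf hg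

@[fun_prop] theorem primrec_mod {f g : A → ℕ} (hf : Primrec f) (hg : Primrec g) :
    Primrec fun a => f a % g a := Primrec.nat_mod.comp hf hg

@[fun_prop] theorem primrec_pow {f g : A → ℕ} (hf : Primrec f) (hg : Primrec g) :
    Primrec fun a => f a ^ g a := (Primrec₂.unpaired'.1 Nat.Primrec.pow).comp hf hg

@[fun_prop] theorem primrec_if_eq {c d : A → ℕ} {f g : A → B} (hc : Primrec c) (hd : Primrec d)
    (hf : Primrec f) (hg : Primrec g) : Primrec fun a => if c a = d a then f a else g a :=
  Primrec.ite (Primrec.eq.comp hc hd) hf hg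

@[fun_prop] theorem primrec_if_lt {c d : A → ℕ} {f g : A → B} (hc : Primrec c) (hd : Primrec d)
    (hf : Primrec f) (hg : Primrec g) : Primrec fun a => if c a < d a then f a else g a :=
  Primrec.ite (Primrec.nat_lt.comp hc hd) hf hg

@[fun_prop] theorem computable_const (b : B) : Computable fun _ : A => b := Computable.const b

@[fun_prop] theorem computable_comp {f : B → G} {g : A → B} (hf : Computable f)
    (hg : Computable g) : Computable fun a => f (g a) := hf.comp hg

@[fun_prop] theorem computable_of_primrec {f : A → B} (hf : Primrec f) : Computable f := hf.to_comp

@[fun_prop] theorem computable_mk {f : A → B} {g : A → G} (hf : Computable f)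
    (hg : Computable g) : Computable fun a => (f a, g a) := hf.pair hg

@[fun_prop] theorem computable_natPair {f g : A → ℕ} (hf : Computable f) (hg : Computable g) :
    Computable fun a => Nat.pair (f a) (g a) := Primrec₂.natPair.to_comp.comp hf hg

@[fun_prop] theorem computable_add {f g : A → ℕ} (hf : Computable f) (hg : Computable g) :
    Computable fun a => f a + g a := Primrec.nat_add.to_comp.comp hf hg

@[fun_prop] theorem computable_if_eq {c d : A → ℕ} {f g : A → B} (hc : Computable c)
    (hd : Computable d) (hf : Computable f) (hg : Computable g) :
    Computable fun a => if c a = d a then f a else g a := by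
  have h : Computable fun a => decide (c a = d a) :=
    (Primrec.eq (α := ℕ)).decide.to_comp.comp hc hd
  exact (Computable.cond h hf hg).of_eq fun a => by simp [Bool.cond_decide]

end Automation

/-! ## Coded sequences and closures -/

/-- The sequence of numbers with the code `n`. -/
def seq (n : ℕ) : List ℕ := Denumerable.ofNat (List ℕ) n

@[simp] theorem seq_encode (l : List ℕ) : seq (Encodable.encode l) = l :=
  Denumerable.ofNat_encode l

@[simp] theorem encode_seq (n : ℕ) : Encodable.encode (seq n) = n :=
  Denumerable.encode_ofNat n

@[fun_prop] theorem primrec_seq : Primrec seq := Primrec.ofNat _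

theorem lt_encode_of_mem : ∀ {l : List ℕ} {a : ℕ}, a ∈ l → a < Encodable.encode l
  | b :: l, a, h => by
    rw [Encodable.encode_list_cons, Nat.lt_succ_iff]
    rcases List.mem_cons.1 h with rfl | h
    · exact Nat.left_le_pair _ _
    · exact (lt_encode_of_mem h).le.trans (Nat.right_le_pair _ _)

theorem lt_of_mem_seq {n a : ℕ} (h : a ∈ seq n) : a < n := by
  simpa using lt_encode_of_mem h

/-- A closure: the term `t`, over the signature given by `tag`, in the environment `e`. -/
def cl (tag e t : ℕ) : ℕ := Nat.pair (Nat.pair tag e) t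

/-- The code of a function symbol in the signature given by `tag`, translated to the signature
with unprimed and primed system variables. -/
def norm (tag f : ℕ) : ℕ :=
  if tag % 4 = 0 then f
  else if tag % 4 = 1 then if f % 8 = 7 then 2 * f - 7 else f
  else if tag % 4 = 2 then if f % 8 = 7 then 2 * f + 1 else f
  else if f % 2 = 1 then 2 * f - 1 else f

/-- The head symbol of a closure; `0` if the term of the closure is a variable. -/
def key (c : ℕ) : ℕ :=
  if c.unpair.2.unpair.1 = 0 then 0
  else norm c.unpair.1.unpair.1 c.unpair.2.unpair.2.unpair.1 + 1

/-- The closures of the arguments. -/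
def args (c : ℕ) : List ℕ :=
  (seq c.unpair.2.unpair.2.unpair.2).map (Nat.pair c.unpair.1)

/-- A second name for a closure. -/
def copy (c : ℕ) : ℕ := cl (4 + c.unpair.1.unpair.1 % 4) c.unpair.1.unpair.2 c.unpair.2

/-- The closure to which a variable is bound by its environment; the environments assign closed
terms with codes below `N`. -/
def entry (N c : ℕ) : ℕ :=
  let d := (c.unpair.1.unpair.2 - 1) / (4 * N) ^ c.unpair.2.unpair.2 % (4 * N)
  cl (d % 4) 0 (d / 4)

@[fun_prop] theorem primrec_norm {A : Type} [Primcodable A] {f g : A → ℕ} (hf : Primrec f)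
    (hg : Primrec g) : Primrec fun a => norm (f a) (g a) := by
  unfold norm; fun_prop

@[fun_prop] theorem primrec_cl {A : Type} [Primcodable A] {f g h : A → ℕ} (hf : Primrec f)
    (hg : Primrec g) (hh : Primrec h) : Primrec fun a => cl (f a) (g a) (h a) := by
  unfold cl; fun_prop

@[fun_prop] theorem primrec_key : Primrec key := by
  unfold key; fun_prop

@[fun_prop] theorem primrec_args : Primrec args := by
  unfold args
  exact Primrec.list_map (f := fun c : ℕ => seq c.unpair.2.unpair.2.unpair.2)
    (g := fun c t => Nat.pair c.unpair.1 t) (by fun_prop)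
    (show Primrec fun p : ℕ × ℕ => Nat.pair p.1.unpair.1 p.2 by fun_prop)

@[fun_prop] theorem primrec_copy : Primrec copy := by
  unfold copy; fun_prop

@[fun_prop] theorem primrec_entry {A : Type} [Primcodable A] {f g : A → ℕ} (hf : Primrec f)
    (hg : Primrec g) : Primrec fun a => entry (f a) (g a) := by
  unfold entry; fun_prop

theorem lt_of_mem_args {c d : ℕ} (h : d ∈ args c) : d < c := by
  obtain ⟨t, ht, rfl⟩ := List.mem_map.1 h
  have h1 := lt_of_mem_seq ht
  have h2 := (Nat.unpair_right_le c.unpair.2.unpair.2).trans (Nat.unpair_right_le c.unpair.2)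
  have h3 := Nat.pair_lt_pair_right c.unpair.1 (h1.trans_le h2)
  rwa [Nat.pair_unpair] at h3

theorem key_cl_app (tag e f l : ℕ) : key (cl tag e (Nat.pair 1 (Nat.pair f l))) = norm tag f + 1 := by
  simp [key, cl]

theorem args_cl_app (tag e f l : ℕ) :
    args (cl tag e (Nat.pair 1 (Nat.pair f l))) = (seq l).map (cl tag e) := by
  simp [args, cl]

theorem key_copy (c : ℕ) : key (copy c) = key c := by
  simp only [key, copy, cl, Nat.unpair_pair, norm, Nat.add_mod_left, Nat.mod_mod]

theorem args_copy (c : ℕ) : args (copy c) = (args c).map copy := by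
  simp [args, copy, cl, Function.comp_def]

theorem entry_copy (N c : ℕ) : entry N (copy c) = entry N c := by
  simp [entry, copy, cl]

/-- Positional notation in base `b`; it lets one number serve as an environment, and `b ^ n` then
counts the environments. -/
theorem exists_digits (b : ℕ) : ∀ (n : ℕ) (f : ℕ → ℕ), (∀ i < n, f i < b) →
    ∃ e < b ^ n, ∀ i < n, e / b ^ i % b = f i
  | 0, f, _ => ⟨0, by simp, by simp⟩
  | n + 1, f, hf => by
    obtain ⟨e, he, h⟩ := exists_digits b n f fun i hi => hf i (by omega)
    have hb : 0 < b := (Nat.zero_le _).trans_lt (hf n (by omega))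
    -- The new digit goes on top, so the lower digits of `e` are unaffected.
    refine ⟨e + b ^ n * f n, ?_, fun i hi => ?_⟩
    · have := hf n (by omega)
      calc e + b ^ n * f n < b ^ n + b ^ n * f n := by omega
        _ = b ^ n * (f n + 1) := by ring
        _ ≤ b ^ n * b := Nat.mul_le_mul_left _ this
        _ = b ^ (n + 1) := (pow_succ b n).symm
    · rcases Nat.lt_succ_iff_lt_or_eq.1 hi with hi' | rfl
      · obtain ⟨k, hk⟩ : ∃ k, n = i + (k + 1) := ⟨n - i - 1, by omega⟩
        have : b ^ n * f n = b ^ i * (b * (b ^ k * f n)) := by rw [hk]; ring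
        rw [this, Nat.add_mul_div_left _ _ (pow_pos hb i), Nat.add_mul_mod_self_left]
        exact h i hi'
      · rw [Nat.add_mul_div_left _ _ (pow_pos hb i), Nat.div_eq_of_lt he, zero_add]
        exact Nat.mod_eq_of_lt (hf i (by omega))

/-- Every assignment of closed terms to variables is given by an environment. -/
theorem exists_env (N : ℕ) (tag t : ℕ → ℕ) (htag : ∀ i < N, tag i < 4) (ht : ∀ i < N, t i < N) :
    ∃ e < (4 * N) ^ N, ∀ tag' : ℕ, ∀ i < N,
      entry N (cl tag' (e + 1) (Nat.pair 0 i)) = cl (tag i) 0 (t i) := by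
  -- One digit in base `4 * N` stores a term code and a tag below 4. The environment is entered as
  -- `e + 1`, which leaves 0 free for ground closures.
  obtain ⟨e, he, h⟩ := exists_digits (4 * N) N (fun i => 4 * t i + tag i) fun i hi => by
    have := htag i hi; have := ht i hi; omega
  refine ⟨e, he, fun tag' i hi => ?_⟩
  have h1 := h i hi
  have h2 := htag i hi
  simp only [entry, cl, Nat.unpair_pair, Nat.add_sub_cancel, h1]
  congr 2 <;> omega

end ParamSys


namespace ParamSys

open FirstOrder.Language (BoundedFormula)

/-! ## Decidability of arities -/

section Arity

variable (T T' : FirstOrder.Language.{0, 0}) [SymbolCode T] [SymbolCode T']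

open Classical in
/-- `n + 1` if `k` is the code of a function symbol of arity `n`, and `0` otherwise. -/
noncomputable def farity (k : ℕ) : ℕ :=
  if h : ∃ x : Σ n, T.Functions n, SymbolCode.fcode x = k then h.choose.1 + 1 else 0

open Classical in
/-- `n + 1` if `k` is the code of a predicate symbol of arity `n`, and `0` otherwise. -/
noncomputable def rarity (k : ℕ) : ℕ :=
  if h : ∃ x : Σ n, T.Relations n, SymbolCode.rcode x = k then h.choose.1 + 1 else 0

variable {T T'}

theorem farity_eq {k n : ℕ} :
    farity T k = n + 1 ↔ ∃ f : T.Functions n, SymbolCode.fcode (⟨n, f⟩ : Σ n, T.Functions n) = k := by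
  unfold farity
  split_ifs with h
  · constructor
    · intro e
      obtain rfl : h.choose.1 = n := by omega
      exact ⟨h.choose.2, h.choose_spec⟩
    · rintro ⟨f, hf⟩
      rw [SymbolCode.fcode_inj (h.choose_spec.trans hf.symm)]
  · exact ⟨fun e => (by omega : False).elim, fun ⟨f, hf⟩ => (h ⟨_, hf⟩).elim⟩

theorem rarity_eq {k n : ℕ} :
    rarity T k = n + 1 ↔ ∃ R : T.Relations n, SymbolCode.rcode (⟨n, R⟩ : Σ n, T.Relations n) = k := by
  unfold rarity
  split_ifs with h
  · constructor
    · intro e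
      obtain rfl : h.choose.1 = n := by omega
      exact ⟨h.choose.2, h.choose_spec⟩
    · rintro ⟨f, hf⟩
      rw [SymbolCode.rcode_inj (h.choose_spec.trans hf.symm)]
  · exact ⟨fun e => (by omega : False).elim, fun ⟨f, hf⟩ => (h ⟨_, hf⟩).elim⟩

/-- Arities are stored shifted by one with 0 as the failure value, so an arity function is
determined by its successor values. -/
theorem eq_of_forall_eq_succ_iff {a b : ℕ} (h : ∀ n, a = n + 1 ↔ b = n + 1) : a = b := by
  rcases a with _ | a
  · rcases b with _ | b
    · rfl
    · exact absurd ((h b).2 rfl) (by omega)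
  · exact ((h a).1 rfl).symm

variable (T) in
/-- It is decidable which numbers are codes of symbols, and the arities are computable. -/
class DecidableArity : Prop where
  farity : Computable (farity T)
  rarity : Computable (rarity T)

theorem computable_arity_of_primcodable {F : ℕ → Type} (P : Primcodable (Σ n, F n))
    (h : Computable (Sigma.fst : (Σ n, F n) → ℕ)) (a : ℕ → ℕ)
    (ha : ∀ k n, a k = n + 1 ↔ ∃ f : F n, P.encode ⟨n, f⟩ = k) : Computable a := by
  -- Decoding can succeed on numbers that are not codes; encoding the result again and comparing it
  -- with `k` excludes them.
  have h1 : Computable fun k : ℕ => Option.casesOn (motive := fun _ => ℕ)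
      (Encodable.decode (α := Σ n, F n) k) 0
      fun x => if Encodable.encode x = k then x.1 + 1 else 0 := by
    refine Computable.option_casesOn Computable.decode (Computable.const 0) ?_
    have h2 : Computable fun p : ℕ × Σ n, F n => Encodable.encode p.2 :=
      Computable.encode.comp Computable.snd
    have h3 : Computable fun p : ℕ × Σ n, F n => p.2.1 := h.comp Computable.snd
    exact computable_if_eq h2 Computable.fst (computable_add h3 (Computable.const 1))
      (Computable.const 0)
  refine h1.of_eq fun k => eq_of_forall_eq_succ_iff fun n => ?_
  rw [ha]
  constructor
  · intro e
    rcases hd : (Encodable.decode k : Option (Σ n, F n)) with _ | x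
    · simp [hd] at e
    · simp only [hd] at e
      split_ifs at e with hx
      obtain rfl : x.1 = n := by omega
      exact ⟨x.2, hx⟩
  · rintro ⟨f, rfl⟩
    have hd : (Encodable.decode (Encodable.encode (⟨n, f⟩ : Σ n, F n)) : Option (Σ n, F n)) =
      some ⟨n, f⟩ := Encodable.encodek _
    simp [hd]

instance (L : FirstOrder.Language.{0, 0}) [h : EffectiveSignature L] : DecidableArity L where
  farity := computable_arity_of_primcodable h.functions h.arity_functions _
    fun _ _ => farity_eq (T := L)
  rarity := computable_arity_of_primcodable h.relations h.arity_relations _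
    fun _ _ => rarity_eq (T := L)

theorem computable_arity_sum {a a' b : ℕ → ℕ} (ha : Computable a) (ha' : Computable a')
    (h : ∀ k, b (2 * k) = a k) (h' : ∀ k, b (2 * k + 1) = a' k) : Computable b := by
  have h1 : Computable fun k => if k % 2 = 0 then a (k / 2) else a' (k / 2) := by fun_prop
  refine h1.of_eq fun k => ?_
  split_ifs with hk
  · rw [← h, show 2 * (k / 2) = k by omega]
  · rw [← h', show 2 * (k / 2) + 1 = k by omega]

theorem fcode_sum_inl {n : ℕ} (f : T.Functions n) :
    SymbolCode.fcode (⟨n, Sum.inl f⟩ : Σ n, (T.sum T').Functions n) =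
      2 * SymbolCode.fcode (⟨n, f⟩ : Σ n, T.Functions n) := rfl

theorem fcode_sum_inr {n : ℕ} (f : T'.Functions n) :
    SymbolCode.fcode (⟨n, Sum.inr f⟩ : Σ n, (T.sum T').Functions n) =
      2 * SymbolCode.fcode (⟨n, f⟩ : Σ n, T'.Functions n) + 1 := rfl

theorem rcode_sum_inl {n : ℕ} (f : T.Relations n) :
    SymbolCode.rcode (⟨n, Sum.inl f⟩ : Σ n, (T.sum T').Relations n) =
      2 * SymbolCode.rcode (⟨n, f⟩ : Σ n, T.Relations n) := rfl

theorem rcode_sum_inr {n : ℕ} (f : T'.Relations n) :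
    SymbolCode.rcode (⟨n, Sum.inr f⟩ : Σ n, (T.sum T').Relations n) =
      2 * SymbolCode.rcode (⟨n, f⟩ : Σ n, T'.Relations n) + 1 := rfl

instance [DecidableArity T] [DecidableArity T'] : DecidableArity (T.sum T') where
  farity := by
    refine computable_arity_sum (DecidableArity.farity (T := T)) (DecidableArity.farity (T := T'))
      (fun k => eq_of_forall_eq_succ_iff fun n => ?_)
      (fun k => eq_of_forall_eq_succ_iff fun n => ?_) <;> rw [farity_eq, farity_eq] <;>
      constructor
    · rintro ⟨f | f, hf⟩
      · rw [fcode_sum_inl] at hf; exact ⟨f, by omega⟩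
      · rw [fcode_sum_inr] at hf; omega
    · rintro ⟨f, rfl⟩; exact ⟨Sum.inl f, rfl⟩
    · rintro ⟨f | f, hf⟩
      · rw [fcode_sum_inl] at hf; omega
      · rw [fcode_sum_inr] at hf; exact ⟨f, by omega⟩
    · rintro ⟨f, rfl⟩; exact ⟨Sum.inr f, rfl⟩
  rarity := by
    refine computable_arity_sum (DecidableArity.rarity (T := T)) (DecidableArity.rarity (T := T'))
      (fun k => eq_of_forall_eq_succ_iff fun n => ?_)
      (fun k => eq_of_forall_eq_succ_iff fun n => ?_) <;> rw [rarity_eq, rarity_eq] <;>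
      constructor
    · rintro ⟨f | f, hf⟩
      · rw [rcode_sum_inl] at hf; exact ⟨f, by omega⟩
      · rw [rcode_sum_inr] at hf; omega
    · rintro ⟨f, rfl⟩; exact ⟨Sum.inl f, rfl⟩
    · rintro ⟨f | f, hf⟩
      · rw [rcode_sum_inl] at hf; omega
      · rw [rcode_sum_inr] at hf; exact ⟨f, by omega⟩
    · rintro ⟨f, rfl⟩; exact ⟨Sum.inr f, rfl⟩

end Arity

/-! ## Quantifier-free formulas about named elements -/

section Formulas

variable {T : FirstOrder.Language.{0, 0}} [SymbolCode T] {α : Type} [Encodable α] {n : ℕ}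

/-- The numbers are names for the free symbols `α` and `n` bound variables. -/
def eqF (nm : ℕ → α ⊕ Fin n) (c d : ℕ) : T.BoundedFormula α n :=
  .equal (.var (nm c)) (.var (nm d))

open Classical in
/-- `c` is the value of the function symbol with code `k` at the arguments `l`. -/
noncomputable def appF (nm : ℕ → α ⊕ Fin n) (c k : ℕ) (l : List ℕ) : T.BoundedFormula α n :=
  if h : ∃ f : T.Functions l.length, SymbolCode.fcode (⟨_, f⟩ : Σ n, T.Functions n) = k then
    .equal (.var (nm c)) (.func h.choose fun i => .var (nm (l.get i)))
  else ⊤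

open Classical in
/-- The predicate symbol with code `k` holds at the arguments `l`. -/
noncomputable def relF (nm : ℕ → α ⊕ Fin n) (k : ℕ) (l : List ℕ) : T.BoundedFormula α n :=
  if h : ∃ R : T.Relations l.length, SymbolCode.rcode (⟨_, R⟩ : Σ n, T.Relations n) = k then
    .rel h.choose fun i => .var (nm (l.get i))
  else ⊥

/-- The conjunction of the first `N` members of a sequence of formulas. -/
def bigAnd (N : ℕ) (φ : ℕ → T.BoundedFormula α n) : T.BoundedFormula α n :=
  Nat.rec ⊤ (fun i ψ => ψ ⊓ φ i) N

variable {M : Type} [T.Structure M] {nm : ℕ → α ⊕ Fin n} {v : α → M} {xs : Fin n → M}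

@[simp] theorem realize_eqF {c d : ℕ} : (eqF nm c d : T.BoundedFormula α n).Realize v xs ↔
    Sum.elim v xs (nm c) = Sum.elim v xs (nm d) := Iff.rfl

-- Quantifying over all arities, symbols and argument tuples that match `k` and `l` hides the choice
-- and the dependence on `l.length` in the definition. If no symbol matches, both sides are
-- trivially true.
@[simp] theorem realize_appF {c k : ℕ} {l : List ℕ} :
    (appF nm c k l : T.BoundedFormula α n).Realize v xs ↔
      ∀ (m : ℕ) (f : T.Functions m) (a : Fin m → ℕ), l = List.ofFn a →
        SymbolCode.fcode (⟨m, f⟩ : Σ n, T.Functions n) = k →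
        Sum.elim v xs (nm c) = FirstOrder.Language.Structure.funMap f
          fun i => Sum.elim v xs (nm (a i)) := by
  unfold appF
  split_ifs with h
  · constructor
    · rintro e m f a rfl hf
      have hm : (List.ofFn a).length = m := List.length_ofFn
      have h1 := h.choose_spec
      have h2 := SymbolCode.fcode_inj (h1.trans hf.symm)
      generalize h.choose = g at e h2
      have e' : Sum.elim v xs (nm c) = FirstOrder.Language.Structure.funMap g
        fun i => Sum.elim v xs (nm ((List.ofFn a).get i)) := e
      rw [e']
      clear e e' h1 h hf
      -- The length of `List.ofFn a` equals `m` only propositionally, so the arity is generalised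
      -- before the equality of symbols is taken apart.
      have key : ∀ (p : ℕ) (hp : p = m) (g : T.Functions p) (b : Fin p → ℕ),
          (⟨p, g⟩ : Σ n, T.Functions n) = ⟨m, f⟩ → (∀ i, b i = a (i.cast hp)) →
          FirstOrder.Language.Structure.funMap g (fun i => Sum.elim v xs (nm (b i))) =
          FirstOrder.Language.Structure.funMap f (fun i => Sum.elim v xs (nm (a i))) := by
        rintro p rfl g b hg hb
        cases hg
        simp [hb]
      exact key _ hm g _ h2 fun i => by simp [Fin.cast]
    · intro H
      exact H _ h.choose (fun i => l.get i) (by simp) h.choose_spec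
  · refine ⟨fun _ m f a hl hf => ?_, fun _ => by simp⟩
    subst hl
    exact (h (by rw [List.length_ofFn]; exact ⟨f, hf⟩)).elim

@[simp] theorem realize_relF {k : ℕ} {m : ℕ} {a : Fin m → ℕ} {R : T.Relations m}
    (hR : SymbolCode.rcode (⟨m, R⟩ : Σ n, T.Relations n) = k) :
    (relF nm k (List.ofFn a) : T.BoundedFormula α n).Realize v xs ↔
      FirstOrder.Language.Structure.RelMap R fun i => Sum.elim v xs (nm (a i)) := by
  have h : ∃ R : T.Relations (List.ofFn a).length,
      SymbolCode.rcode (⟨_, R⟩ : Σ n, T.Relations n) = k := by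
    rw [List.length_ofFn]; exact ⟨R, hR⟩
  unfold relF
  rw [dif_pos h]
  have hm : (List.ofFn a).length = m := List.length_ofFn
  have h2 := SymbolCode.rcode_inj (h.choose_spec.trans hR.symm)
  generalize h.choose = g at h2
  have key : ∀ (p : ℕ) (hp : p = m) (g : T.Relations p) (b : Fin p → ℕ),
      (⟨p, g⟩ : Σ n, T.Relations n) = ⟨m, R⟩ → (∀ i, b i = a (i.cast hp)) →
      (FirstOrder.Language.Structure.RelMap g (fun i => Sum.elim v xs (nm (b i))) ↔
      FirstOrder.Language.Structure.RelMap R (fun i => Sum.elim v xs (nm (a i)))) := by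
    rintro p rfl g b hg hb
    cases hg
    simp [hb]
  exact key _ hm g _ h2 fun i => by simp [Fin.cast]

@[simp] theorem realize_bigAnd {φ : ℕ → T.BoundedFormula α n} {N : ℕ} :
    (bigAnd N φ).Realize v xs ↔ ∀ i < N, (φ i).Realize v xs := by
  induction N with
  | zero => simp [bigAnd]
  | succ N ih =>
    rw [show bigAnd (N + 1) φ = bigAnd N φ ⊓ φ N from rfl, FirstOrder.Language.BoundedFormula.realize_inf, ih]
    exact ⟨fun h i hi => (Nat.lt_succ_iff_lt_or_eq.1 hi).elim (h.1 i) fun e => e ▸ h.2,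
      fun h => ⟨fun i hi => h i (by omega), h N (by omega)⟩⟩

theorem isQF_eqF {c d : ℕ} : (eqF nm c d : T.BoundedFormula α n).IsQF :=
  (FirstOrder.Language.BoundedFormula.IsAtomic.equal _ _).isQF

theorem isQF_appF {c k : ℕ} {l : List ℕ} : (appF nm c k l : T.BoundedFormula α n).IsQF := by
  unfold appF
  split_ifs
  · exact (FirstOrder.Language.BoundedFormula.IsAtomic.equal _ _).isQF
  · exact FirstOrder.Language.BoundedFormula.IsQF.top

theorem isQF_relF {k : ℕ} {l : List ℕ} : (relF nm k l : T.BoundedFormula α n).IsQF := by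
  unfold relF
  split_ifs
  · exact (FirstOrder.Language.BoundedFormula.IsAtomic.rel _ _).isQF
  · exact FirstOrder.Language.BoundedFormula.isQF_bot

theorem isQF_bigAnd {φ : ℕ → T.BoundedFormula α n} (h : ∀ i, (φ i).IsQF) (N : ℕ) :
    (bigAnd N φ).IsQF := by
  induction N with
  | zero => exact FirstOrder.Language.BoundedFormula.IsQF.top
  | succ N ih => exact ih.inf (h N)

end Formulas

/-! ## Computable families of formulas -/

section Families

variable {T : FirstOrder.Language.{0, 0}} [SymbolCode T] {α : Type} [Encodable α]
  {A : Type} [Primcodable A] {n : A → ℕ}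

/-- A computable family of formulas. -/
def CF (φ : ∀ a, T.BoundedFormula α (n a)) : Prop := Computable fun a => codeFormula (φ a)

/-- A primitive recursive family of name assignments. -/
def PrimrecNames (nm : ∀ a, ℕ → α ⊕ Fin (n a)) : Prop :=
  Primrec fun p : A × ℕ => Encodable.encode (nm p.1 p.2)

variable {φ ψ : ∀ a, T.BoundedFormula α (n a)} {nm : ∀ a, ℕ → α ⊕ Fin (n a)}

theorem CF.bot : CF fun a => (⊥ : T.BoundedFormula α (n a)) := Computable.const _

theorem CF.top : CF fun a => (⊤ : T.BoundedFormula α (n a)) :=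
  Computable.const (Nat.pair 3 (Nat.pair (Nat.pair 0 0) (Nat.pair 0 0)))

theorem CF.imp (hφ : CF φ) (hψ : CF ψ) : CF fun a => (φ a).imp (ψ a) := by
  unfold CF at *
  simp only [codeFormula]
  fun_prop

theorem CF.not (hφ : CF φ) : CF fun a => ∼(φ a) := hφ.imp CF.bot

theorem CF.inf (hφ : CF φ) (hψ : CF ψ) : CF fun a => φ a ⊓ ψ a := (hφ.imp hψ.not).not

theorem CF.ite {c d : A → ℕ} (hc : Computable c) (hd : Computable d) (hφ : CF φ) (hψ : CF ψ) :
    CF fun a => if c a = d a then φ a else ψ a := by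
  unfold CF at *
  refine (computable_if_eq hc hd hφ hψ).of_eq fun a => ?_
  beta_reduce
  split_ifs <;> rfl

theorem CF.eqF (hnm : PrimrecNames nm) {c d : A → ℕ} (hc : Computable c) (hd : Computable d) :
    CF fun a => (eqF (nm a) (c a) (d a) : T.BoundedFormula α (n a)) := by
  unfold CF
  have h1 : Computable fun a => Encodable.encode (nm a (c a)) :=
    hnm.to_comp.comp (Computable.id.pair hc)
  have h2 : Computable fun a => Encodable.encode (nm a (d a)) :=
    hnm.to_comp.comp (Computable.id.pair hd)
  simp only [ParamSys.eqF, codeFormula, codeTerm]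
  fun_prop

theorem computable_encode_names (hnm : PrimrecNames nm) {l : A → List ℕ} (hl : Computable l) :
    Computable fun a => Encodable.encode
      ((l a).map fun i => Nat.pair 0 (Encodable.encode (nm a i))) := by
  have h1 : Primrec fun p : A × List ℕ => Encodable.encode
      (p.2.map fun i => Nat.pair 0 (Encodable.encode (nm p.1 i))) := by
    refine Primrec.encode.comp (Primrec.list_map Primrec.snd ?_)
    have h2 : Primrec fun p : (A × List ℕ) × ℕ => Encodable.encode (nm p.1.1 p.2) :=
      hnm.comp ((Primrec.fst.comp Primrec.fst).pair Primrec.snd)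
    exact primrec_natPair (Primrec.const 0) h2
  exact h1.to_comp.comp (Computable.id.pair hl)

theorem ofFn_codeTerm_var {m : ℕ} (nm : ℕ → α ⊕ Fin m) (l : List ℕ) :
    (List.ofFn fun i => codeTerm (.var (nm (l.get i)) : T.Term (α ⊕ Fin m))) =
      l.map fun i => Nat.pair 0 (Encodable.encode (nm i)) := by
  simp only [codeTerm]
  exact List.ofFn_getElem_eq_map l fun i => Nat.pair 0 (Encodable.encode (nm i))

/-- The chosen symbol has code `k`, so the code of the formula is explicit. What remains is the test
whether `k` codes a symbol of arity `length`, which `DecidableArity` makes computable. -/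
theorem CF.appF [DecidableArity T] (hnm : PrimrecNames nm) {c k : A → ℕ} {l : A → List ℕ}
    (hc : Computable c) (hk : Computable k) (hl : Computable l) :
    CF fun a => (appF (nm a) (c a) (k a) (l a) : T.BoundedFormula α (n a)) := by
  unfold CF
  have h1 : Computable fun a => Encodable.encode (nm a (c a)) :=
    hnm.to_comp.comp (Computable.id.pair hc)
  have h2 := computable_encode_names hnm hl
  have h3 : Computable fun a => farity T (k a) := DecidableArity.farity.comp hk
  have h4 : Computable fun a => (l a).length := Computable.list_length.comp hl
  have h5 : Computable fun a => if farity T (k a) = (l a).length + 1 then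
      Nat.pair 1 (Nat.pair (Nat.pair 0 (Encodable.encode (nm a (c a)))) (Nat.pair 1
        (Nat.pair (k a) (Encodable.encode
          ((l a).map fun i => Nat.pair 0 (Encodable.encode (nm a i)))))))
      else codeFormula (⊤ : T.BoundedFormula α (n a)) :=
    computable_if_eq h3 (by fun_prop) (by fun_prop) CF.top
  refine h5.of_eq fun a => ?_
  unfold ParamSys.appF
  beta_reduce
  by_cases h : ∃ f : T.Functions (l a).length, SymbolCode.fcode (⟨_, f⟩ : Σ n, T.Functions n) = k a
  · rw [dif_pos h, if_pos (farity_eq.2 h)]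
    simp only [codeFormula]
    rw [codeTerm, codeTerm, ofFn_codeTerm_var, h.choose_spec]
  · rw [dif_neg h, if_neg (mt farity_eq.1 h)]

theorem CF.relF [DecidableArity T] (hnm : PrimrecNames nm) {k : A → ℕ} {l : A → List ℕ}
    (hk : Computable k) (hl : Computable l) :
    CF fun a => (relF (nm a) (k a) (l a) : T.BoundedFormula α (n a)) := by
  unfold CF
  have h2 := computable_encode_names hnm hl
  have h3 : Computable fun a => rarity T (k a) := DecidableArity.rarity.comp hk
  have h4 : Computable fun a => (l a).length := Computable.list_length.comp hl
  have h5 : Computable fun a => if rarity T (k a) = (l a).length + 1 then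
      Nat.pair 2 (Nat.pair (k a) (Encodable.encode
          ((l a).map fun i => Nat.pair 0 (Encodable.encode (nm a i)))))
      else codeFormula (⊥ : T.BoundedFormula α (n a)) :=
    computable_if_eq h3 (by fun_prop) (by fun_prop) CF.bot
  refine h5.of_eq fun a => ?_
  unfold ParamSys.relF
  beta_reduce
  by_cases h : ∃ f : T.Relations (l a).length, SymbolCode.rcode (⟨_, f⟩ : Σ n, T.Relations n) = k a
  · rw [dif_pos h, if_pos (rarity_eq.2 h)]
    simp only [codeFormula]
    rw [ofFn_codeTerm_var, h.choose_spec]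
  · rw [dif_neg h, if_neg (mt rarity_eq.1 h)]

/-- The number of conjuncts depends on the input, so the code is built by recursion on `N`, spelling
out `ψ ⊓ φ i` through implication and falsity. -/
theorem CF.bigAnd {N : A → ℕ} {φ : ∀ a, ℕ → T.BoundedFormula α (n a)} (hN : Computable N)
    (hφ : CF fun p : A × ℕ => φ p.1 p.2) : CF fun a => bigAnd (N a) (φ a) := by
  unfold CF at *
  have h1 : Computable fun a => (N a).rec (motive := fun _ => ℕ)
      (codeFormula (⊤ : T.BoundedFormula α (n a)))
      fun i c => Nat.pair 3 (Nat.pair (Nat.pair 3 (Nat.pair c (Nat.pair 3 (Nat.pair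
        (codeFormula (φ a i)) (Nat.pair 0 0))))) (Nat.pair 0 0)) := by
    refine Computable.nat_rec hN CF.top (h := fun a p => Nat.pair 3 (Nat.pair (Nat.pair 3
      (Nat.pair p.2 (Nat.pair 3 (Nat.pair (codeFormula (φ a p.1)) (Nat.pair 0 0)))))
      (Nat.pair 0 0))) ?_
    have h2 : Computable fun p : A × ℕ × ℕ => codeFormula (φ p.1 p.2.1) :=
      hφ.comp (Computable.fst.pair (Computable.fst.comp Computable.snd))
    have h3 : Computable fun p : A × ℕ × ℕ => p.2.2 := Computable.snd.comp Computable.snd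
    show Computable fun p : A × ℕ × ℕ => _
    fun_prop
  refine h1.of_eq fun a => ?_
  beta_reduce
  generalize N a = N
  induction N with
  | zero => rfl
  | succ N ih => simp only; rw [ih]; rfl

theorem CF.congr {B : Type} [Primcodable B] (hφ : CF φ) {g : B → A} (hg : Computable g) :
    CF fun b => φ (g b) := Computable.comp hφ hg

/-- On codes every quantifier is the same operation, whatever the number of bound variables, so
closing off is an iteration of it. -/
theorem CF.alls (hn : Computable n) (hφ : CF φ) : CF (n := fun _ => 0) fun a => (φ a).alls := by
  have h : ∀ (m : ℕ) (θ : T.BoundedFormula α m), codeFormula θ.alls =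
      m.rec (motive := fun _ => ℕ) (codeFormula θ) fun _ c => Nat.pair 4 c := by
    intro m
    induction m with
    | zero => intro θ; rfl
    | succ m ih =>
      intro θ
      rw [FirstOrder.Language.BoundedFormula.alls, ih, codeFormula]
      generalize codeFormula θ = k
      clear ih θ
      induction m with
      | zero => rfl
      | succ m ih => simp only at ih ⊢; rw [ih]
  unfold CF at *
  simp only [h]
  refine Computable.nat_rec hn hφ (h := fun _ p => Nat.pair 4 p.2) ?_
  show Computable fun p : A × ℕ × ℕ => Nat.pair 4 p.2.2
  fun_prop

theorem CF.exs (hn : Computable n) (hφ : CF φ) : CF (n := fun _ => 0) fun a => (φ a).exs := by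
  have h : ∀ (m : ℕ) (θ : T.BoundedFormula α m), codeFormula θ.exs =
      m.rec (motive := fun _ => ℕ) (codeFormula θ) fun _ c => Nat.pair 3 (Nat.pair (Nat.pair 4
        (Nat.pair 3 (Nat.pair c (Nat.pair 0 0)))) (Nat.pair 0 0)) := by
    intro m
    induction m with
    | zero => intro θ; rfl
    | succ m ih =>
      intro θ
      have h1 : codeFormula θ.ex = Nat.pair 3 (Nat.pair (Nat.pair 4
        (Nat.pair 3 (Nat.pair (codeFormula θ) (Nat.pair 0 0)))) (Nat.pair 0 0)) := rfl
      rw [FirstOrder.Language.BoundedFormula.exs, ih, h1]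
      generalize codeFormula θ = k
      clear ih θ h1
      induction m with
      | zero => rfl
      | succ m ih => simp only at ih ⊢; rw [ih]
  unfold CF at *
  simp only [h]
  refine Computable.nat_rec hn hφ (h := fun _ p => Nat.pair 3 (Nat.pair (Nat.pair 4
        (Nat.pair 3 (Nat.pair p.2 (Nat.pair 0 0)))) (Nat.pair 0 0))) ?_
  show Computable fun p : A × ℕ × ℕ => Nat.pair 3 (Nat.pair (Nat.pair 4
        (Nat.pair 3 (Nat.pair p.2.2 (Nat.pair 0 0)))) (Nat.pair 0 0))
  fun_prop

end Families

end ParamSys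


namespace ParamSys

/-! ## Translation of coded formulas and clauses -/

theorem unpair_right_lt {k : ℕ} (h : k.unpair.1 ≠ 0) : k.unpair.2 < k := by
  have h1 : ∀ a b : ℕ, a ≠ 0 → b < Nat.pair a b := by
    intro a b ha
    unfold Nat.pair
    split_ifs
    · have : 0 < a := Nat.pos_of_ne_zero ha
      nlinarith
    · have : 0 < a := Nat.pos_of_ne_zero ha
      nlinarith
  simpa using h1 _ k.unpair.2 h

section Translation

variable {T : FirstOrder.Language.{0, 0}} [SymbolCode T] {α : Type} [Encodable α] {n : ℕ}

/-- The quantifier-free formula with code `k`, with the terms replaced by their names. -/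
noncomputable def trF (nm : ℕ → α ⊕ Fin n) (x ρ : ℕ → ℕ) (k : ℕ) : T.BoundedFormula α n :=
  if k.unpair.1 = 1 then eqF nm (x k.unpair.2.unpair.1) (x k.unpair.2.unpair.2)
  else if k.unpair.1 = 2 then
    relF nm (ρ k.unpair.2.unpair.1) ((seq k.unpair.2.unpair.2).map x)
  else if _h : k.unpair.1 = 3 then
    (trF nm x ρ k.unpair.2.unpair.1).imp (trF nm x ρ k.unpair.2.unpair.2)
  else ⊥
termination_by k
decreasing_by
  · exact (Nat.unpair_left_le _).trans_lt (unpair_right_lt (by omega))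
  · exact (Nat.unpair_right_le _).trans_lt (unpair_right_lt (by omega))

/-- The atom with code `k`, with the terms replaced by their names. -/
noncomputable def trAtom (nm : ℕ → α ⊕ Fin n) (x : ℕ → ℕ) (k : ℕ) : T.BoundedFormula α n :=
  if k.unpair.1 = 0 then eqF nm (x k.unpair.2.unpair.1) (x k.unpair.2.unpair.2)
  else relF nm k.unpair.2.unpair.1 ((seq k.unpair.2.unpair.2).map x)

noncomputable def trLit (nm : ℕ → α ⊕ Fin n) (x : ℕ → ℕ) (k : ℕ) : T.BoundedFormula α n :=
  if k.unpair.1 = 0 then ∼(trAtom nm x k.unpair.2) else trAtom nm x k.unpair.2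

/-- The disjunction is expressed by `bigAnd` through De Morgan. The definition makes sense for every
number `k`, so no check for well-formedness is needed. -/
noncomputable def trClause (nm : ℕ → α ⊕ Fin n) (x : ℕ → ℕ) (k : ℕ) : T.BoundedFormula α n :=
  ∼(bigAnd (seq k).length fun i => ∼(trLit nm x ((seq k).getD i 0)))

noncomputable def trClauses (nm : ℕ → α ⊕ Fin n) (x : ℕ → ℕ) (k : ℕ) : T.BoundedFormula α n :=
  bigAnd (seq k).length fun i => trClause nm x ((seq k).getD i 0)

theorem isQF_trF {nm : ℕ → α ⊕ Fin n} {x ρ : ℕ → ℕ} (k : ℕ) :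
    (trF nm x ρ k : T.BoundedFormula α n).IsQF := by
  induction k using Nat.strong_induction_on with
  | _ k ih =>
    unfold trF
    split_ifs with h1 h2 h3
    · exact isQF_eqF
    · exact isQF_relF
    · exact (ih _ ((Nat.unpair_left_le _).trans_lt (unpair_right_lt (by omega)))).imp
        (ih _ ((Nat.unpair_right_le _).trans_lt (unpair_right_lt (by omega))))
    · exact FirstOrder.Language.BoundedFormula.isQF_bot

theorem isQF_trAtom {nm : ℕ → α ⊕ Fin n} {x : ℕ → ℕ} (k : ℕ) :
    (trAtom nm x k : T.BoundedFormula α n).IsQF := by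
  unfold trAtom
  split_ifs
  · exact isQF_eqF
  · exact isQF_relF

theorem isQF_trLit {nm : ℕ → α ⊕ Fin n} {x : ℕ → ℕ} (k : ℕ) :
    (trLit nm x k : T.BoundedFormula α n).IsQF := by
  unfold trLit
  split_ifs
  · exact (isQF_trAtom _).not
  · exact isQF_trAtom _

theorem isQF_trClauses {nm : ℕ → α ⊕ Fin n} {x : ℕ → ℕ} (k : ℕ) :
    (trClauses nm x k : T.BoundedFormula α n).IsQF :=
  isQF_bigAnd (fun _ => (isQF_bigAnd (fun _ => (isQF_trLit _).not) _).not) _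

end Translation

/-! ### Computability of the translations. -/

section TranslationFamilies

variable {T : FirstOrder.Language.{0, 0}} [SymbolCode T] [DecidableArity T] {α : Type} [Encodable α]
  {A : Type} [Primcodable A] {n : A → ℕ} {nm : ∀ a, ℕ → α ⊕ Fin (n a)} {x ρ : A → ℕ → ℕ}
  {k : A → ℕ}

theorem PrimrecNames.congr {B : Type} [Primcodable B] (hnm : PrimrecNames nm) {g : B → A}
    (hg : Primrec g) : PrimrecNames fun b => nm (g b) :=
  Primrec.comp hnm ((hg.comp Primrec.fst).pair Primrec.snd)

theorem primrec_map {l : A → List ℕ} (hl : Primrec l) (hx : Primrec fun p : A × ℕ => x p.1 p.2) :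
    Primrec fun a => (l a).map (x a) := Primrec.list_map hl hx

theorem primrec_apply (hx : Primrec fun p : A × ℕ => x p.1 p.2) {g : A → ℕ} (hg : Primrec g) :
    Primrec fun a => x a (g a) := hx.comp (Primrec.id.pair hg)

@[fun_prop] theorem primrec_getD {l : A → List ℕ} {i : A → ℕ} (hl : Primrec l) (hi : Primrec i) :
    Primrec fun a => (l a).getD (i a) 0 := (Primrec.list_getD 0).comp hl hi

@[fun_prop] theorem primrec_length {l : A → List ℕ} (hl : Primrec l) :
    Primrec fun a => (l a).length := Primrec.list_length.comp hl

theorem CF.trF (hnm : PrimrecNames nm) (hx : Primrec fun p : A × ℕ => x p.1 p.2)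
    (hρ : Primrec fun p : A × ℕ => ρ p.1 p.2) (hk : Computable k) :
    CF fun a => (trF (nm a) (x a) (ρ a) (k a) : T.BoundedFormula α (n a)) := by
  have hx' : Primrec fun p : (A × ℕ) × ℕ => x p.1.1 p.2 :=
    hx.comp (g := fun p : (A × ℕ) × ℕ => (p.1.1, p.2)) (by fun_prop)
  have hρ' : Primrec fun p : (A × ℕ) × ℕ => ρ p.1.1 p.2 :=
    hρ.comp (g := fun p : (A × ℕ) × ℕ => (p.1.1, p.2)) (by fun_prop)
  have hnm' : PrimrecNames fun p : A × ℕ => nm p.1 := hnm.congr Primrec.fst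
  have h1 : CF fun p : A × ℕ => (ParamSys.eqF (nm p.1) (x p.1 p.2.unpair.2.unpair.1)
      (x p.1 p.2.unpair.2.unpair.2) : T.BoundedFormula α (n p.1)) :=
    CF.eqF hnm' (primrec_apply (x := fun p : A × ℕ => x p.1) hx' (by fun_prop)).to_comp
      (primrec_apply (x := fun p : A × ℕ => x p.1) hx' (by fun_prop)).to_comp
  have h2 : CF fun p : A × ℕ => (ParamSys.relF (nm p.1) (ρ p.1 p.2.unpair.2.unpair.1)
      ((seq p.2.unpair.2.unpair.2).map (x p.1)) : T.BoundedFormula α (n p.1)) :=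
    CF.relF hnm' (primrec_apply (x := fun p : A × ℕ => ρ p.1) hρ' (by fun_prop)).to_comp
      (primrec_map (x := fun p : A × ℕ => x p.1) (by fun_prop) hx').to_comp
  -- Course-of-values recursion: `p.2` lists the results for all smaller numbers, so its length is
  -- the number being translated.
  have hg : Computable fun p : A × List ℕ => some (
      if p.2.length.unpair.1 = 1 then codeFormula (ParamSys.eqF (nm p.1)
        (x p.1 p.2.length.unpair.2.unpair.1) (x p.1 p.2.length.unpair.2.unpair.2) :
          T.BoundedFormula α (n p.1))
      else if p.2.length.unpair.1 = 2 then codeFormula (ParamSys.relF (nm p.1)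
        (ρ p.1 p.2.length.unpair.2.unpair.1) ((seq p.2.length.unpair.2.unpair.2).map (x p.1)) :
          T.BoundedFormula α (n p.1))
      else if p.2.length.unpair.1 = 3 then
        Nat.pair 3 (Nat.pair (p.2.getD p.2.length.unpair.2.unpair.1 0)
          (p.2.getD p.2.length.unpair.2.unpair.2 0))
      else Nat.pair 0 0) := by
    have hq : Primrec fun p : A × List ℕ => (p.1, p.2.length) := by fun_prop
    have h1' : Computable _ := h1.congr hq.to_comp
    have h2' : Computable _ := h2.congr hq.to_comp
    refine Computable.option_some.comp ?_
    exact computable_if_eq (by fun_prop) (by fun_prop) h1' (computable_if_eq (by fun_prop)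
      (by fun_prop) h2' (by fun_prop))
  have h3 := Computable.nat_strong_rec
    (fun a k => codeFormula (ParamSys.trF (nm a) (x a) (ρ a) k : T.BoundedFormula α (n a)))
    hg.to₂ fun a k => by
      simp only [List.length_map, List.length_range, Option.some.injEq]
      rw [ParamSys.trF]
      split_ifs with h1 h2 h3
      · rfl
      · rfl
      · have e1 : k.unpair.2.unpair.1 < k :=
          (Nat.unpair_left_le _).trans_lt (unpair_right_lt (by omega))
        have e2 : k.unpair.2.unpair.2 < k :=
          (Nat.unpair_right_le _).trans_lt (unpair_right_lt (by omega))
        simp [List.getD, e1, e2, codeFormula]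
      · rfl
  exact h3.comp Computable.id hk

theorem CF.trAtom (hnm : PrimrecNames nm) (hx : Primrec fun p : A × ℕ => x p.1 p.2)
    (hk : Primrec k) : CF fun a => (trAtom (nm a) (x a) (k a) : T.BoundedFormula α (n a)) :=
  CF.ite (by fun_prop) (by fun_prop)
    (CF.eqF hnm (primrec_apply hx (by fun_prop)).to_comp (primrec_apply hx (by fun_prop)).to_comp)
    (CF.relF hnm (by fun_prop) (primrec_map (by fun_prop) hx).to_comp)

theorem CF.trLit (hnm : PrimrecNames nm) (hx : Primrec fun p : A × ℕ => x p.1 p.2)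
    (hk : Primrec k) : CF fun a => (trLit (nm a) (x a) (k a) : T.BoundedFormula α (n a)) :=
  CF.ite (by fun_prop) (by fun_prop) (CF.trAtom hnm hx (by fun_prop)).not
    (CF.trAtom hnm hx (by fun_prop))

theorem CF.trClause (hnm : PrimrecNames nm) (hx : Primrec fun p : A × ℕ => x p.1 p.2)
    (hk : Primrec k) : CF fun a => (trClause (nm a) (x a) (k a) : T.BoundedFormula α (n a)) :=
  (CF.bigAnd (by fun_prop) (CF.trLit (hnm.congr Primrec.fst) (x := fun p : A × ℕ => x p.1)
    (hx.comp (g := fun p : (A × ℕ) × ℕ => (p.1.1, p.2)) (by fun_prop)) (by fun_prop)).not).not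

theorem CF.trClauses (hnm : PrimrecNames nm) (hx : Primrec fun p : A × ℕ => x p.1 p.2)
    (hk : Primrec k) : CF fun a => (trClauses (nm a) (x a) (k a) : T.BoundedFormula α (n a)) :=
  CF.bigAnd (by fun_prop) (CF.trClause (hnm.congr Primrec.fst) (x := fun p : A × ℕ => x p.1)
    (hx.comp (g := fun p : (A × ℕ) × ℕ => (p.1.1, p.2)) (by fun_prop)) (by fun_prop))

end TranslationFamilies

/-! ## The ground problems -/

/-- The number of environments. -/
def envs (N : ℕ) : ℕ := (4 * N) ^ N

/-- A bound for the closures of terms with codes below `N`. -/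
def bound (N : ℕ) : ℕ := cl 3 (envs N) N

/-- The components of a coded invariant checking problem. -/
def inK (w : ℕ) : ℕ := w.unpair.1
def inGammaSigma (w : ℕ) : ℕ := w.unpair.2.unpair.1
def inGammaZero (w : ℕ) : ℕ := w.unpair.2.unpair.2.unpair.1
def inInit (w : ℕ) : ℕ := w.unpair.2.unpair.2.unpair.2.unpair.1
def inUpdate (w : ℕ) : ℕ := w.unpair.2.unpair.2.unpair.2.unpair.2.unpair.1
def inPhi (w : ℕ) : ℕ := w.unpair.2.unpair.2.unpair.2.unpair.2.unpair.2

section Problems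

variable {T : FirstOrder.Language.{0, 0}} [SymbolCode T] {α : Type} [Encodable α] {n : ℕ}
  (nm : ℕ → α ⊕ Fin n)

/-- Variables take their values from the environment. -/
def varF (N c : ℕ) : T.BoundedFormula α n :=
  if c.unpair.2.unpair.1 = 0 then
    if c.unpair.1.unpair.2 = 0 then ⊤ else eqF nm c (entry N c)
  else ⊤

/-- The meaning of the base functions. -/
noncomputable def baseF (c : ℕ) : T.BoundedFormula α n :=
  if key c % 2 = 1 then appF nm c (key c / 2) (args c) else ⊤

/-- Functional consistency of the extension functions. -/
def consF (c d : ℕ) : T.BoundedFormula α n :=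
  if key c = key d then
    if key c = 0 then ⊤
    else if key c % 2 = 1 then ⊤
    else if (args c).length = (args d).length then
      (bigAnd (args c).length fun i => eqF nm ((args c).getD i 0) ((args d).getD i 0)).imp
        (eqF nm c d)
    else ⊤
  else ⊤

noncomputable def closureF (N : ℕ) : T.BoundedFormula α n :=
  bigAnd (bound N) fun c => varF nm N c ⊓ baseF nm c ⊓ bigAnd (bound N) (consF nm c)

noncomputable def systemF (w : ℕ) : T.BoundedFormula α n :=
  closureF nm (w + 1) ⊓ bigAnd (envs (w + 1)) fun e =>
    trClauses nm (cl 1 (e + 1)) (inK w) ⊓ trClauses nm (cl 3 (e + 1)) (inGammaSigma w)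

/-- A closed formula over the signature given by `tag`. -/
noncomputable def groundF (tag k : ℕ) : T.BoundedFormula α n := trF nm (cl tag 0) (· / 2) k

/-- The parameters satisfy the constraints, and there is an initial state in which the property
fails. -/
noncomputable def initGroundF (w : ℕ) : T.BoundedFormula α n :=
  groundF nm 3 (inGammaZero w) ⊓ (groundF nm 1 (inInit w) ⊓ ∼(groundF nm 1 (inPhi w)))

/-- The parameters satisfy the constraints, and there is an update that does not preserve the
property. -/
noncomputable def stepGroundF (w : ℕ) : T.BoundedFormula α n :=
  groundF nm 3 (inGammaZero w) ⊓ (groundF nm 1 (inPhi w) ⊓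
    (groundF nm 0 (inUpdate w) ⊓ ∼(groundF nm 2 (inPhi w))))

noncomputable def initF (w : ℕ) : T.BoundedFormula α n := systemF nm w ⊓ initGroundF nm w

noncomputable def stepF (w : ℕ) : T.BoundedFormula α n := systemF nm w ⊓ stepGroundF nm w

/-- The arguments of the parameters agree with their copies. -/
def linkF (N : ℕ) : T.BoundedFormula α n :=
  bigAnd (bound N) fun c =>
    if key c % 4 = 2 then
      bigAnd (args c).length fun i => eqF nm ((args c).getD i 0) (copy ((args c).getD i 0))
    else ⊤

theorem isQF_systemF (w : ℕ) : (systemF nm w : T.BoundedFormula α n).IsQF := by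
  refine (isQF_bigAnd (fun c => (FirstOrder.Language.BoundedFormula.IsQF.inf ?_ ?_).inf
    (isQF_bigAnd (fun d => ?_) _)) _).inf
    (isQF_bigAnd (fun e => (isQF_trClauses _).inf (isQF_trClauses _)) _)
  · unfold varF
    split_ifs
    exacts [FirstOrder.Language.BoundedFormula.IsQF.top, isQF_eqF,
      FirstOrder.Language.BoundedFormula.IsQF.top]
  · unfold baseF
    split_ifs
    exacts [isQF_appF, FirstOrder.Language.BoundedFormula.IsQF.top]
  · unfold consF
    split_ifs
    all_goals first
      | exact FirstOrder.Language.BoundedFormula.IsQF.top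
      | exact (isQF_bigAnd (fun i => isQF_eqF) _).imp isQF_eqF

theorem isQF_initF (w : ℕ) : (initF nm w : T.BoundedFormula α n).IsQF :=
  (isQF_systemF nm w).inf ((isQF_trF _).inf ((isQF_trF _).inf (isQF_trF _).not))

theorem isQF_stepF (w : ℕ) : (stepF nm w : T.BoundedFormula α n).IsQF :=
  (isQF_systemF nm w).inf ((isQF_trF _).inf ((isQF_trF _).inf ((isQF_trF _).inf (isQF_trF _).not)))

end Problems

/-! ### Computability of the ground problems. -/

section ProblemFamilies

@[fun_prop] theorem primrec_envs : Primrec envs := by unfold envs; fun_prop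
@[fun_prop] theorem primrec_bound : Primrec bound := by unfold bound; fun_prop
@[fun_prop] theorem primrec_inK : Primrec inK := by unfold inK; fun_prop
@[fun_prop] theorem primrec_inGammaSigma : Primrec inGammaSigma := by unfold inGammaSigma; fun_prop
@[fun_prop] theorem primrec_inGammaZero : Primrec inGammaZero := by unfold inGammaZero; fun_prop
@[fun_prop] theorem primrec_inInit : Primrec inInit := by unfold inInit; fun_prop
@[fun_prop] theorem primrec_inUpdate : Primrec inUpdate := by unfold inUpdate; fun_prop
@[fun_prop] theorem primrec_inPhi : Primrec inPhi := by unfold inPhi; fun_prop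

variable {T : FirstOrder.Language.{0, 0}} [SymbolCode T] [DecidableArity T] {α : Type} [Encodable α]
  {A : Type} [Primcodable A] {n : A → ℕ} {nm : ∀ a, ℕ → α ⊕ Fin (n a)} {w : A → ℕ}

theorem CF.varF (hnm : PrimrecNames nm) {c : A → ℕ} (hw : Primrec w) (hc : Primrec c) :
    CF fun a => (varF (nm a) (w a) (c a) : T.BoundedFormula α (n a)) :=
  CF.ite (by fun_prop) (by fun_prop) (CF.ite (by fun_prop) (by fun_prop) CF.top
    (CF.eqF hnm (by fun_prop) (by fun_prop))) CF.top

theorem CF.baseF (hnm : PrimrecNames nm) {c : A → ℕ} (hc : Primrec c) :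
    CF fun a => (baseF (nm a) (c a) : T.BoundedFormula α (n a)) :=
  CF.ite (by fun_prop) (by fun_prop) (CF.appF hnm (by fun_prop) (by fun_prop) (by fun_prop)) CF.top

theorem CF.consF (hnm : PrimrecNames nm) {c d : A → ℕ} (hc : Primrec c) (hd : Primrec d) :
    CF fun a => (consF (nm a) (c a) (d a) : T.BoundedFormula α (n a)) := by
  refine CF.ite (by fun_prop) (by fun_prop) (CF.ite (by fun_prop) (by fun_prop) CF.top
    (CF.ite (by fun_prop) (by fun_prop) CF.top (CF.ite (by fun_prop) (by fun_prop)
      ((CF.bigAnd (by fun_prop) ?_).imp (CF.eqF hnm (by fun_prop) (by fun_prop))) CF.top))) CF.top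
  exact CF.eqF (hnm.congr Primrec.fst) (by fun_prop) (by fun_prop)

theorem CF.closureF (hnm : PrimrecNames nm) (hw : Primrec w) :
    CF fun a => (closureF (nm a) (w a) : T.BoundedFormula α (n a)) := by
  have hnm1 : PrimrecNames fun p : A × ℕ => nm p.1 := hnm.congr Primrec.fst
  have hnm2 : PrimrecNames fun p : (A × ℕ) × ℕ => nm p.1.1 := hnm1.congr Primrec.fst
  have h1 : CF fun p : A × ℕ => (ParamSys.varF (nm p.1) (w p.1) p.2 :
      T.BoundedFormula α (n p.1)) := CF.varF hnm1 (by fun_prop) (by fun_prop)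
  have h2 : CF fun p : A × ℕ => (ParamSys.baseF (nm p.1) p.2 : T.BoundedFormula α (n p.1)) :=
    CF.baseF hnm1 (by fun_prop)
  have h3 : CF fun p : (A × ℕ) × ℕ => (ParamSys.consF (nm p.1.1) p.1.2 p.2 :
      T.BoundedFormula α (n p.1.1)) := CF.consF hnm2 (by fun_prop) (by fun_prop)
  exact CF.bigAnd (by fun_prop) ((h1.inf h2).inf (CF.bigAnd (by fun_prop) h3))

theorem CF.systemF (hnm : PrimrecNames nm) (hw : Primrec w) :
    CF fun a => (systemF (nm a) (w a) : T.BoundedFormula α (n a)) := by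
  have hnm1 : PrimrecNames fun p : A × ℕ => nm p.1 := hnm.congr Primrec.fst
  refine (CF.closureF hnm (by fun_prop)).inf (CF.bigAnd (by fun_prop) (CF.inf ?_ ?_))
  · exact CF.trClauses hnm1 (x := fun p : A × ℕ => cl 1 (p.2 + 1)) (by fun_prop) (by fun_prop)
  · exact CF.trClauses hnm1 (x := fun p : A × ℕ => cl 3 (p.2 + 1)) (by fun_prop) (by fun_prop)

theorem CF.groundF (hnm : PrimrecNames nm) (tag : ℕ) (hw : Primrec w) :
    CF fun a => (groundF (nm a) tag (w a) : T.BoundedFormula α (n a)) :=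
  CF.trF hnm (x := fun _ => cl tag 0) (ρ := fun _ => (· / 2)) (by fun_prop) (by fun_prop)
    (by fun_prop)

theorem CF.initF (hnm : PrimrecNames nm) (hw : Primrec w) :
    CF fun a => (initF (nm a) (w a) : T.BoundedFormula α (n a)) :=
  (CF.systemF hnm hw).inf ((CF.groundF hnm 3 (by fun_prop)).inf
    ((CF.groundF hnm 1 (by fun_prop)).inf (CF.groundF hnm 1 (by fun_prop)).not))

theorem CF.stepF (hnm : PrimrecNames nm) (hw : Primrec w) :
    CF fun a => (stepF (nm a) (w a) : T.BoundedFormula α (n a)) :=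
  (CF.systemF hnm hw).inf ((CF.groundF hnm 3 (by fun_prop)).inf
    ((CF.groundF hnm 1 (by fun_prop)).inf ((CF.groundF hnm 0 (by fun_prop)).inf
      (CF.groundF hnm 2 (by fun_prop)).not)))

theorem CF.linkF (hnm : PrimrecNames nm) (hw : Primrec w) :
    CF fun a => (linkF (nm a) (w a) : T.BoundedFormula α (n a)) := by
  have hnm1 : PrimrecNames fun p : A × ℕ => nm p.1 := hnm.congr Primrec.fst
  have hnm2 : PrimrecNames fun p : (A × ℕ) × ℕ => nm p.1.1 := hnm1.congr Primrec.fst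
  exact CF.bigAnd (by fun_prop) (CF.ite (by fun_prop) (by fun_prop) (CF.bigAnd (by fun_prop)
    (CF.eqF hnm2 (by fun_prop) (by fun_prop))) CF.top)

end ProblemFamilies

/-! ## Queries and the synthesized constraint -/

section Synthesis

/-- The names that are not eliminated are the parameter terms and the copies. -/
def elimNames (C c : ℕ) : ℕ ⊕ Fin C :=
  if key c % 4 = 2 then Sum.inl c
  else if 3 < c.unpair.1.unpair.1 then Sum.inl c
  else if h : c < C then Sum.inr ⟨c, h⟩ else Sum.inl c

/-- All names are universally quantified. -/
def allNames (m k : ℕ) : Empty ⊕ Fin (m + 1) :=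
  if h : k < m + 1 then Sum.inr ⟨k, h⟩ else Sum.inr 0

theorem primrecNames_inl : PrimrecNames (n := fun _ : ℕ => 0) fun _ => (Sum.inl : ℕ → ℕ ⊕ Fin 0) := by
  unfold PrimrecNames
  simp only [Encodable.encode_inl]
  exact primrec_mul (Primrec.const 2) Primrec.snd

theorem primrecNames_elimNames {A : Type} [Primcodable A] {C : A → ℕ} (hC : Primrec C) :
    PrimrecNames fun a => elimNames (C a) := by
  unfold PrimrecNames
  have h : Primrec fun p : A × ℕ => if key p.2 % 4 = 2 then 2 * p.2
      else if 3 < p.2.unpair.1.unpair.1 then 2 * p.2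
      else if p.2 < C p.1 then 2 * p.2 + 1 else 2 * p.2 := by fun_prop
  refine h.of_eq fun p => ?_
  unfold elimNames
  beta_reduce
  split_ifs <;> rfl

theorem primrecNames_allNames {A : Type} [Primcodable A] {m : A → ℕ} (hm : Primrec m) :
    PrimrecNames fun a => allNames (m a) := by
  unfold PrimrecNames
  have h : Primrec fun p : A × ℕ => if p.2 < m p.1 + 1 then 2 * p.2 + 1 else 1 := by fun_prop
  refine h.of_eq fun p => ?_
  unfold allNames
  beta_reduce
  split_ifs <;> rfl

variable (L₀ LP : FirstOrder.Language.{0, 0}) [SymbolCode L₀] [SymbolCode LP]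

/-- The free variables are the kept names, with the closure `c` itself as index. The link formula
ties the arguments of parameter terms, which may be quantified, to copies that stay free. -/
noncomputable def initQuery (w : ℕ) : L₀.Formula ℕ :=
  FirstOrder.Language.BoundedFormula.exs
    (initF (elimNames (bound (w + 1))) w ⊓ linkF (elimNames (bound (w + 1))) (w + 1))

noncomputable def stepQuery (w : ℕ) : L₀.Formula ℕ :=
  FirstOrder.Language.BoundedFormula.exs
    (stepF (elimNames (bound (w + 1))) w ⊓ linkF (elimNames (bound (w + 1))) (w + 1))

/-- The code of the variable `k`. -/
def varCode (k : ℕ) : ℕ := Nat.pair 0 (2 * k)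

@[fun_prop] theorem primrec_varCode {A : Type} [Primcodable A] {f : A → ℕ} (hf : Primrec f) :
    Primrec fun a => varCode (f a) := by unfold varCode; fun_prop

/-- The universally quantified names are the terms with codes up to `m`. -/
noncomputable def constraintBody (m N k₁ k₂ : ℕ) : (L₀.sum LP).BoundedFormula Empty (m + 1) :=
  (bigAnd (m + 1) (fun t =>
      if t.unpair.1 = 0 then ⊤
      else appF (allNames m) t (2 * t.unpair.2.unpair.1) (seq t.unpair.2.unpair.2)) ⊓
    bigAnd (bound N) (fun c =>
      if key c % 4 = 2 then
        appF (allNames m) (varCode c) (key c / 2) ((args c).map fun d => varCode (copy d))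
      else ⊤)).imp
  (∼(trF (allNames m) id (2 * ·) k₁) ⊓ ∼(trF (allNames m) id (2 * ·) k₂))

/-- The quantified names: all subterms of the formulas with codes `k₁` and `k₂`, and the names
of the parameter terms and of the copies of their arguments. -/
def nameBound (N k₁ k₂ : ℕ) : ℕ :=
  k₁ + k₂ + varCode (cl (bound N + 4) (bound N) (bound N))

@[fun_prop] theorem primrec_nameBound {A : Type} [Primcodable A] {f g h : A → ℕ} (hf : Primrec f)
    (hg : Primrec g) (hh : Primrec h) : Primrec fun a => nameBound (f a) (g a) (h a) := by
  unfold nameBound; fun_prop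

noncomputable def constraint (N k₁ k₂ : ℕ) : (L₀.sum LP).Sentence :=
  FirstOrder.Language.BoundedFormula.alls (constraintBody L₀ LP (nameBound N k₁ k₂) N k₁ k₂)

variable {L₀ LP} {A : Type} [Primcodable A] [DecidableArity L₀] [DecidableArity LP]

theorem CF.initQuery {w : A → ℕ} (hw : Primrec w) :
    CF (n := fun _ => 0) fun a => (initQuery L₀ (w a)) :=
  CF.exs (by fun_prop) ((CF.initF (primrecNames_elimNames (by fun_prop)) (by fun_prop)).inf
    (CF.linkF (primrecNames_elimNames (by fun_prop)) (by fun_prop)))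

theorem CF.stepQuery {w : A → ℕ} (hw : Primrec w) :
    CF (n := fun _ => 0) fun a => (stepQuery L₀ (w a)) :=
  CF.exs (by fun_prop) ((CF.stepF (primrecNames_elimNames (by fun_prop)) (by fun_prop)).inf
    (CF.linkF (primrecNames_elimNames (by fun_prop)) (by fun_prop)))

theorem CF.constraint {N k₁ k₂ : A → ℕ} (hN : Primrec N) (h₁ : Primrec k₁) (h₂ : Primrec k₂) :
    CF (n := fun _ => 0) fun a => constraint L₀ LP (N a) (k₁ a) (k₂ a) := by
  have hm : Primrec fun a => nameBound (N a) (k₁ a) (k₂ a) := by fun_prop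
  have hnm := primrecNames_allNames hm
  have hnm1 : PrimrecNames fun p : A × ℕ => allNames (nameBound (N p.1) (k₁ p.1) (k₂ p.1)) :=
    hnm.congr Primrec.fst
  refine CF.alls (by fun_prop) (CF.imp (CF.inf (CF.bigAnd (by fun_prop) ?_)
    (CF.bigAnd (by fun_prop) ?_)) (CF.inf (CF.not ?_) (CF.not ?_)))
  · exact CF.ite (by fun_prop) (by fun_prop) CF.top
      (CF.appF hnm1 (by fun_prop) (by fun_prop) (by fun_prop))
  · refine CF.ite (by fun_prop) (by fun_prop)
      (CF.appF hnm1 (by fun_prop) (by fun_prop) ?_) CF.top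
    exact (primrec_map (x := fun _ d => varCode (copy d)) (by fun_prop) (by fun_prop)).to_comp
  · exact CF.trF hnm (x := fun _ => id) (ρ := fun _ => (2 * ·))
      (by simp only [id]; fun_prop) (by fun_prop) h₁.to_comp
  · exact CF.trF hnm (x := fun _ => id) (ρ := fun _ => (2 * ·))
      (by simp only [id]; fun_prop) (by fun_prop) h₂.to_comp

theorem isUniversal_alls {L : FirstOrder.Language.{0, 0}} {α : Type} :
    ∀ {n : ℕ} (φ : L.BoundedFormula α n), φ.IsUniversal → φ.alls.IsUniversal
  | 0, _, h => h
  | _ + 1, φ, h => isUniversal_alls φ.all h.all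

theorem isUniversal_constraint (N k₁ k₂ : ℕ) : (constraint L₀ LP N k₁ k₂).IsUniversal := by
  refine isUniversal_alls _ (FirstOrder.Language.BoundedFormula.IsUniversal.of_isQF
    (((isQF_bigAnd (fun t => ?_) _).inf (isQF_bigAnd (fun c => ?_) _)).imp
    ((isQF_trF _).not.inf (isQF_trF _).not)))
  · split_ifs
    exacts [FirstOrder.Language.BoundedFormula.IsQF.top, isQF_appF]
  · split_ifs
    exacts [isQF_appF, FirstOrder.Language.BoundedFormula.IsQF.top]

attribute [irreducible] initQuery stepQuery constraint

end Synthesis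

end ParamSys


namespace ParamSys

/-! ## Semantics of the translations -/

section TranslationSemantics

theorem codeTerm_lt_func {L : FirstOrder.Language.{0, 0}} [SymbolCode L] {β : Type} [Encodable β]
    {m : ℕ} (f : L.Functions m) (ts : Fin m → L.Term β) (i : Fin m) :
    codeTerm (ts i) < codeTerm (.func f ts) := by
  have h : codeTerm (ts i) < Encodable.encode (List.ofFn fun i => codeTerm (ts i)) :=
    lt_encode_of_mem ((List.mem_ofFn' _ _).2 ⟨i, rfl⟩)
  rw [codeTerm]
  exact h.trans_le ((Nat.right_le_pair _ _).trans (Nat.right_le_pair _ _))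

theorem right_lt_pair {a b : ℕ} (h : a ≠ 0) : b < Nat.pair a b := by
  simpa using unpair_right_lt (k := Nat.pair a b) (by simpa using h)

variable {T : FirstOrder.Language.{0, 0}} [SymbolCode T] {α : Type} [Encodable α] {n : ℕ}
  {M : Type} [T.Structure M] {nm : ℕ → α ⊕ Fin n} {v : α → M} {xs : Fin n → M}

/-- Names are assumed correct only for terms with codes below `N`; this suffices because terms of a
formula have smaller codes than the formula. The map `ρ` recodes predicates, so the lemma serves
both the passage down to the base signature and the passage from it to the signature with
parameters. -/
theorem realize_trF {L : FirstOrder.Language.{0, 0}} [SymbolCode L] [L.Structure M] {β : Type}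
    [Encodable β] {k N : ℕ} {x ρ : ℕ → ℕ} {v' : β → M} {xs' : Fin k → M}
    (hterm : ∀ t : L.Term (β ⊕ Fin k), codeTerm t < N →
      Sum.elim v xs (nm (x (codeTerm t))) = t.realize (Sum.elim v' xs'))
    (hrel : ∀ (m : ℕ) (R : L.Relations m), ∃ R' : T.Relations m,
      SymbolCode.rcode (⟨m, R'⟩ : Σ n, T.Relations n) =
        ρ (SymbolCode.rcode (⟨m, R⟩ : Σ n, L.Relations n)) ∧
      ∀ a : Fin m → M, FirstOrder.Language.Structure.RelMap R' a ↔
        FirstOrder.Language.Structure.RelMap R a)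
    {φ : L.BoundedFormula β k} (hφ : φ.IsQF) (hN : codeFormula φ ≤ N) :
    (trF nm x ρ (codeFormula φ) : T.BoundedFormula α n).Realize v xs ↔ φ.Realize v' xs' := by
  induction hφ with
  | falsum =>
    rw [codeFormula, trF]
    simp
    exact fun h => h
  | of_isAtomic h =>
    cases h with
    | equal t u =>
      have e : codeFormula (t.bdEqual u) = Nat.pair 1 (Nat.pair (codeTerm t) (codeTerm u)) := rfl
      rw [e] at hN
      have h1 := right_lt_pair (a := 1) (b := Nat.pair (codeTerm t) (codeTerm u)) (by omega)
      have h2 := Nat.left_le_pair (codeTerm t) (codeTerm u)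
      have h3 := Nat.right_le_pair (codeTerm t) (codeTerm u)
      rw [e, trF]
      simp [hterm t (by omega), hterm u (by omega)]
    | @rel l R ts =>
      have e : codeFormula (R.boundedFormula ts) = Nat.pair 2 (Nat.pair (SymbolCode.rcode
        (⟨l, R⟩ : Σ n, L.Relations n)) (Encodable.encode (List.ofFn fun i => codeTerm (ts i)))) :=
        rfl
      obtain ⟨R', hR', hR⟩ := hrel l R
      have ht : ∀ i, Sum.elim v xs (nm (x (codeTerm (ts i)))) =
          (ts i).realize (Sum.elim v' xs') := fun i => by
        refine hterm _ (lt_of_lt_of_le ?_ hN)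
        have h1 : codeTerm (ts i) < Encodable.encode (List.ofFn fun i => codeTerm (ts i)) :=
          lt_encode_of_mem ((List.mem_ofFn' _ _).2 ⟨i, rfl⟩)
        rw [e]
        exact h1.trans_le ((Nat.right_le_pair _ _).trans (Nat.right_le_pair _ _))
      rw [e, trF]
      simp only [Nat.unpair_pair, seq_encode, List.map_ofFn]
      rw [if_neg (by omega), if_pos trivial, realize_relF hR',
        FirstOrder.Language.BoundedFormula.realize_rel,
        ← hR]
      simp only [Function.comp_apply, ht]
  | @imp φ ψ _ _ ih₁ ih₂ =>
    have e : codeFormula (φ.imp ψ) = Nat.pair 3 (Nat.pair (codeFormula φ) (codeFormula ψ)) := rfl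
    rw [e] at hN
    have h1 := right_lt_pair (a := 3) (b := Nat.pair (codeFormula φ) (codeFormula ψ)) (by omega)
    have h2 := Nat.left_le_pair (codeFormula φ) (codeFormula ψ)
    have h3 := Nat.right_le_pair (codeFormula φ) (codeFormula ψ)
    rw [e, trF]
    simp [ih₁ (by omega), ih₂ (by omega)]

end TranslationSemantics

/-! ### Semantics of translated atoms, literals and clauses. -/

section ClauseSemantics

variable {L₀ L₁ : FirstOrder.Language.{0, 0}} [SymbolCode L₀] [SymbolCode L₁] {α : Type}
  [Encodable α] {n : ℕ} {M : Type} [L₀.Structure M] [L₁.Structure M] {nm : ℕ → α ⊕ Fin n}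
  {v : α → M} {xs : Fin n → M} {β : Type} [Encodable β]

theorem code_lt_of_mem {B : Type} [Coded B] {b : B} {l : List B} (h : b ∈ l) :
    Coded.code b < Coded.code l :=
  lt_encode_of_mem (List.mem_map.2 ⟨b, h, rfl⟩)

theorem code_literal (l : Literal L₀ L₁ β) :
    Coded.code l = Nat.pair l.pos.toNat (codeAtom l.atom) := rfl

theorem code_clauses {B : Type} [Coded B] (l : List B) :
    seq (Coded.code l) = l.map Coded.code := seq_encode _

/-- The codes of the terms in an atom are smaller than the code of the atom. -/
theorem codeTerm_lt_codeAtom_rel {m : ℕ} (R : L₀.Relations m)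
    (ts : Fin m → (L₀.sum L₁).Term β) (i : Fin m) : codeTerm (ts i) < codeAtom (.rel R ts) := by
  have h1 : codeTerm (ts i) < Encodable.encode (List.ofFn fun i => codeTerm (ts i)) :=
    lt_encode_of_mem ((List.mem_ofFn' _ _).2 ⟨i, rfl⟩)
  exact h1.trans_le ((Nat.right_le_pair _ _).trans (Nat.right_le_pair _ _))

variable {N : ℕ} {x : ℕ → ℕ} {v' : β → M}

theorem realize_trAtom
    (hterm : ∀ t : (L₀.sum L₁).Term β, codeTerm t < N →
      Sum.elim v xs (nm (x (codeTerm t))) = t.realize v')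
    (D : Atom L₀ L₁ β) (hN : codeAtom D < N) :
    (trAtom nm x (codeAtom D) : L₀.BoundedFormula α n).Realize v xs ↔ D.Realize v' := by
  cases D with
  | eq t u =>
    have h1 := Nat.right_le_pair 0 (Nat.pair (codeTerm t) (codeTerm u))
    have h2 := Nat.left_le_pair (codeTerm t) (codeTerm u)
    have h3 := Nat.right_le_pair (codeTerm t) (codeTerm u)
    rw [codeAtom] at hN ⊢
    rw [trAtom]
    simp [hterm t (by omega), hterm u (by omega), Atom.Realize]
  | @rel l R ts =>
    have ht : ∀ i, Sum.elim v xs (nm (x (codeTerm (ts i)))) = (ts i).realize v' := fun i =>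
      hterm _ ((codeTerm_lt_codeAtom_rel R ts i).trans hN)
    rw [codeAtom, trAtom]
    simp only [Nat.unpair_pair, seq_encode, List.map_ofFn]
    rw [if_neg (by omega), realize_relF rfl]
    simp only [Function.comp_apply, ht]
    rfl

theorem realize_trLit
    (hterm : ∀ t : (L₀.sum L₁).Term β, codeTerm t < N →
      Sum.elim v xs (nm (x (codeTerm t))) = t.realize v')
    (l : Literal L₀ L₁ β) (hN : Coded.code l < N) :
    (trLit nm x (Coded.code l) : L₀.BoundedFormula α n).Realize v xs ↔ l.Realize v' := by
  have h := realize_trAtom hterm l.atom ((Nat.right_le_pair _ _).trans_lt hN)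
  rw [code_literal, trLit, Literal.Realize]
  rcases l with ⟨_ | _, D⟩
  · simpa using not_congr h
  · simpa using h

theorem exists_lt_length_getD {p : ℕ → Prop} {l : List ℕ} :
    (∃ i < l.length, p (l.getD i 0)) ↔ ∃ a ∈ l, p a := by
  constructor
  · rintro ⟨i, hi, h⟩
    rw [List.getD_eq_getElem _ _ hi] at h
    exact ⟨_, List.getElem_mem hi, h⟩
  · rintro ⟨a, ha, h⟩
    obtain ⟨i, hi, rfl⟩ := List.getElem_of_mem ha
    exact ⟨i, hi, by rwa [List.getD_eq_getElem _ _ hi]⟩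

theorem forall_lt_length_getD {p : ℕ → Prop} {l : List ℕ} :
    (∀ i < l.length, p (l.getD i 0)) ↔ ∀ a ∈ l, p a := by
  have := exists_lt_length_getD (p := fun a => ¬ p a) (l := l)
  constructor
  · intro h
    by_contra! hc
    obtain ⟨i, hi, hp⟩ := this.2 hc
    exact hp (h i hi)
  · intro h
    by_contra! hc
    obtain ⟨i, hi, hp⟩ := this.1 hc
    exact hp (h i hi)

theorem realize_trClause
    (hterm : ∀ t : (L₀.sum L₁).Term β, codeTerm t < N →
      Sum.elim v xs (nm (x (codeTerm t))) = t.realize v')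
    (D : Clause L₀ L₁ β) (hN : Coded.code D < N) :
    (trClause nm x (Coded.code D) : L₀.BoundedFormula α n).Realize v xs ↔ D.Realize v' := by
  rw [trClause]
  simp only [FirstOrder.Language.BoundedFormula.realize_not, realize_bigAnd, not_forall, not_not, exists_prop]
  rw [exists_lt_length_getD (p := fun a => (trLit nm x a : L₀.BoundedFormula α n).Realize v xs),
    code_clauses]
  constructor
  · rintro ⟨a, ha, h⟩
    obtain ⟨l, hl, rfl⟩ := List.mem_map.1 ha
    exact ⟨l, hl, (realize_trLit hterm l ((code_lt_of_mem hl).trans hN)).1 h⟩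
  · rintro ⟨l, hl, h⟩
    exact ⟨_, List.mem_map.2 ⟨l, hl, rfl⟩,
      (realize_trLit hterm l ((code_lt_of_mem hl).trans hN)).2 h⟩

theorem realize_trClauses
    (hterm : ∀ t : (L₀.sum L₁).Term β, codeTerm t < N →
      Sum.elim v xs (nm (x (codeTerm t))) = t.realize v')
    (K : List (Clause L₀ L₁ β)) (hN : Coded.code K < N) :
    (trClauses nm x (Coded.code K) : L₀.BoundedFormula α n).Realize v xs ↔
      ∀ D ∈ K, D.Realize v' := by
  rw [trClauses, realize_bigAnd, forall_lt_length_getD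
    (p := fun a => (trClause nm x a : L₀.BoundedFormula α n).Realize v xs), code_clauses]
  simp only [List.mem_map, forall_exists_index, and_imp, forall_apply_eq_imp_iff₂]
  exact forall₂_congr fun D hD => realize_trClause hterm D ((code_lt_of_mem hD).trans hN)

end ClauseSemantics

/-! ## Semantics of the constraints on closures -/

section ClosureSemantics

variable {L₀ : FirstOrder.Language.{0, 0}} [SymbolCode L₀] {α : Type} [Encodable α] {n : ℕ}
  {M : Type} [L₀.Structure M] {nm : ℕ → α ⊕ Fin n} {v : α → M} {xs : Fin n → M}

/-- The elements `X c` are possible values of the closures below `bound N`. -/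
structure ClosureSat (L₀ : FirstOrder.Language.{0, 0}) [SymbolCode L₀] {M : Type} [L₀.Structure M]
    (N : ℕ) (X : ℕ → M) : Prop where
  var : ∀ c < bound N, c.unpair.2.unpair.1 = 0 → c.unpair.1.unpair.2 ≠ 0 → X c = X (entry N c)
  base : ∀ c < bound N, ∀ (m : ℕ) (f : L₀.Functions m) (a : Fin m → ℕ), args c = List.ofFn a →
    key c = 2 * SymbolCode.fcode (⟨m, f⟩ : Σ n, L₀.Functions n) + 1 →
    X c = FirstOrder.Language.Structure.funMap f fun i => X (a i)
  cons : ∀ c < bound N, ∀ d < bound N, key c = key d → key c ≠ 0 → key c % 2 = 0 →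
    (args c).map X = (args d).map X → X c = X d

theorem realize_varF {N c : ℕ} : (varF nm N c : L₀.BoundedFormula α n).Realize v xs ↔
    (c.unpair.2.unpair.1 = 0 → c.unpair.1.unpair.2 ≠ 0 →
      Sum.elim v xs (nm c) = Sum.elim v xs (nm (entry N c))) := by
  unfold varF
  split_ifs with h1 h2 <;> simp [h1] <;> simp [h2]

theorem realize_baseF {c : ℕ} : (baseF nm c : L₀.BoundedFormula α n).Realize v xs ↔
    ∀ (m : ℕ) (f : L₀.Functions m) (a : Fin m → ℕ), args c = List.ofFn a →
      key c = 2 * SymbolCode.fcode (⟨m, f⟩ : Σ n, L₀.Functions n) + 1 →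
      Sum.elim v xs (nm c) =
        FirstOrder.Language.Structure.funMap f fun i => Sum.elim v xs (nm (a i)) := by
  unfold baseF
  split_ifs with h1
  · rw [realize_appF]
    refine forall₄_congr fun m f a _ => ?_
    rw [show SymbolCode.fcode (⟨m, f⟩ : Σ n, L₀.Functions n) = key c / 2 ↔
      key c = 2 * SymbolCode.fcode (⟨m, f⟩ : Σ n, L₀.Functions n) + 1 by omega]
  · refine ⟨fun _ m f a _ h => by omega, fun _ => by simp⟩

theorem map_eq_map_iff {X : ℕ → M} {l l' : List ℕ} (h : l.length = l'.length) :
    l.map X = l'.map X ↔ ∀ i < l.length, X (l.getD i 0) = X (l'.getD i 0) := by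
  constructor
  · intro e i hi
    have h1 := congrArg (fun l => l[i]?) e
    simpa [hi, h ▸ hi] using h1
  · intro H
    refine List.ext_getElem (by simpa using h) fun i h1 h2 => ?_
    have h3 := H i (by simpa using h1)
    rw [List.length_map] at h1 h2
    rw [List.getD_eq_getElem _ _ h1, List.getD_eq_getElem _ _ h2] at h3
    simpa using h3

/-- Base functions have odd keys, extension symbols have nonzero even keys and variables have key 0,
so congruence is imposed exactly on extension terms. Equality of the lists of values includes
equality of their lengths. -/
theorem realize_consF {c d : ℕ} : (consF nm c d : L₀.BoundedFormula α n).Realize v xs ↔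
    (key c = key d → key c ≠ 0 → key c % 2 = 0 →
      (args c).map (fun c => Sum.elim v xs (nm c)) = (args d).map (fun c => Sum.elim v xs (nm c)) →
      Sum.elim v xs (nm c) = Sum.elim v xs (nm d)) := by
  unfold consF
  split_ifs with h1 h2 h3 h4
  · simp [h2]
  · refine ⟨fun _ _ _ h => by omega, fun _ => by simp⟩
  · have h5 : key c % 2 = 0 := by omega
    rw [FirstOrder.Language.BoundedFormula.realize_imp, realize_bigAnd, map_eq_map_iff h4]
    simp only [realize_eqF]
    exact ⟨fun h _ _ _ => h, fun h => h h1 h2 h5⟩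
  · refine ⟨fun _ _ _ _ e => (h4 (by simpa using congrArg List.length e)).elim, fun _ => by simp⟩
  · exact ⟨fun _ e => (h1 e).elim, fun _ => by simp⟩

theorem realize_closureF {N : ℕ} : (closureF nm N : L₀.BoundedFormula α n).Realize v xs ↔
    ClosureSat L₀ N fun c => Sum.elim v xs (nm c) := by
  unfold closureF
  simp only [realize_bigAnd, FirstOrder.Language.BoundedFormula.realize_inf, realize_varF, realize_baseF,
    realize_consF]
  exact ⟨fun h => ⟨fun c hc => (h c hc).1.1, fun c hc => (h c hc).1.2, fun c hc => (h c hc).2⟩,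
    fun h c hc => ⟨⟨h.var c hc, h.base c hc⟩, h.cons c hc⟩⟩

theorem realize_linkF {N : ℕ} : (linkF nm N : L₀.BoundedFormula α n).Realize v xs ↔
    ∀ c < bound N, key c % 4 = 2 → ∀ d ∈ args c,
      Sum.elim v xs (nm d) = Sum.elim v xs (nm (copy d)) := by
  unfold linkF
  rw [realize_bigAnd]
  refine forall₂_congr fun c _ => ?_
  split_ifs with h
  · rw [realize_bigAnd, ← forall_lt_length_getD
      (p := fun d => Sum.elim v xs (nm d) = Sum.elim v xs (nm (copy d)))]
    simp [h]
  · simp [h]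

end ClosureSemantics

end ParamSys


namespace ParamSys

/-! ## Structures with unprimed and primed system variables -/

section Canonical

variable (L₀ LP LN : FirstOrder.Language.{0, 0}) (V : Type)

/-- The signature with unprimed and primed system variables. -/
abbrev FullL : FirstOrder.Language.{0, 0} := L₀.sum (ExtL LP LN (V ⊕ V))

variable {L₀ LP LN V} {M : Type} [L₀.Structure M] [LP.Structure M] [LN.Structure M]

/-- The structure for the extension symbols with the values `s` of the constants in `X`. -/
@[reducible] def extStructure (LP LN : FirstOrder.Language.{0, 0}) {X M : Type} [LP.Structure M]
    [LN.Structure M] (s : X → M) : (ExtL LP LN X).Structure M :=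
  letI : (FirstOrder.Language.constantsOn X).Structure M :=
    FirstOrder.Language.constantsOn.structure s
  inferInstance

/-- The structure for all symbols with the values `s` of the constants in `X`. -/
@[reducible] def sysStructure (L₀ LP LN : FirstOrder.Language.{0, 0}) {X M : Type} [L₀.Structure M]
    [LP.Structure M] [LN.Structure M] (s : X → M) : (L₀.sum (ExtL LP LN X)).Structure M :=
  letI := extStructure LP LN s
  inferInstance

variable [SymbolCode L₀] [SymbolCode LP] [SymbolCode LN] [Encodable V]

/-- The symbols of `L`, which have the codes of the signature given by `tag`, have the same
interpretation in `M` as in the full structure. -/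
structure TagCompatible (tag : ℕ) (L : FirstOrder.Language.{0, 0}) [SymbolCode L] [L.Structure M]
    (s s' : V → M) : Prop where
  func : ∀ (m : ℕ) (f : L.Functions m), ∃ g : (FullL L₀ LP LN V).Functions m,
    SymbolCode.fcode (⟨m, g⟩ : Σ n, (FullL L₀ LP LN V).Functions n) =
      norm tag (SymbolCode.fcode (⟨m, f⟩ : Σ n, L.Functions n)) ∧
    ∀ a : Fin m → M, FirstOrder.Language.Structure.funMap
      (self := sysStructure L₀ LP LN (Sum.elim s s')) g a =
        FirstOrder.Language.Structure.funMap f a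
  rel : ∀ (m : ℕ) (R : L.Relations m), ∃ R₀ : L₀.Relations m,
    SymbolCode.rcode (⟨m, R₀⟩ : Σ n, L₀.Relations n) =
      SymbolCode.rcode (⟨m, R⟩ : Σ n, L.Relations n) / 2 ∧
    ∀ a : Fin m → M, FirstOrder.Language.Structure.RelMap R₀ a ↔
      FirstOrder.Language.Structure.RelMap R a

/-- `X c` is the value of the closure `c`, for the closures in `R` that are not variables. -/
def Evaluates (L₀ LP LN : FirstOrder.Language.{0, 0}) {V M : Type} [L₀.Structure M]
    [LP.Structure M] [LN.Structure M] [SymbolCode L₀] [SymbolCode LP] [SymbolCode LN] [Encodable V]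
    (R : ℕ → Prop) (X : ℕ → M) (s s' : V → M) : Prop :=
  ∀ c, R c → ∀ (m : ℕ) (g : (FullL L₀ LP LN V).Functions m) (a : Fin m → ℕ),
    args c = List.ofFn a →
    key c = SymbolCode.fcode (⟨m, g⟩ : Σ n, (FullL L₀ LP LN V).Functions n) + 1 →
    X c = FirstOrder.Language.Structure.funMap
      (self := sysStructure L₀ LP LN (Sum.elim s s')) g fun i => X (a i)

variable {s s' : V → M} {R : ℕ → Prop} {X : ℕ → M}

theorem Evaluates.mono {R' : ℕ → Prop} (h : Evaluates L₀ LP LN R X s s') (hR : ∀ c, R' c → R c) :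
    Evaluates L₀ LP LN R' X s s' := fun c hc => h c (hR c hc)

/-- The arguments of the closure of `f(ts)` are the closures of the `ts` with the same tag and
environment, so induction on the term applies; only the leaves remain as free values. -/
theorem Evaluates.term (h : Evaluates L₀ LP LN R X s s') {tag : ℕ}
    {L : FirstOrder.Language.{0, 0}} [SymbolCode L] [L.Structure M]
    (hL : TagCompatible (L₀ := L₀) (LP := LP) (LN := LN) tag L s s') {e N : ℕ}
    (hR : ∀ t < N, R (cl tag e t)) {β : Type} [Encodable β] (t : L.Term β) (ht : codeTerm t < N) :
    X (cl tag e (codeTerm t)) =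
      t.realize fun b => X (cl tag e (Nat.pair 0 (Encodable.encode b))) := by
  induction t with
  | var b => rfl
  | @func m f ts ih =>
    obtain ⟨g, hg, hgf⟩ := hL.func m f
    have h1 : codeTerm (FirstOrder.Language.Term.func f ts) = Nat.pair 1 (Nat.pair
      (SymbolCode.fcode (⟨m, f⟩ : Σ n, L.Functions n))
      (Encodable.encode (List.ofFn fun i => codeTerm (ts i)))) := by rw [codeTerm]
    have h2 := h _ (hR _ ht) m g (fun i => cl tag e (codeTerm (ts i)))
      (by rw [h1, args_cl_app, seq_encode, List.map_ofFn]; rfl)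
      (by rw [h1, key_cl_app, hg])
    rw [h2, hgf, FirstOrder.Language.Term.realize_func]
    exact congrArg _ (funext fun i => ih i ((codeTerm_lt_func f ts i).trans ht))

/-! ### Symbol codes and their translation to the full signature. -/

section Codes

variable {X : Type} [Encodable X] {m : ℕ}

theorem fcode_base (f : L₀.Functions m) :
    SymbolCode.fcode (⟨m, Sum.inl f⟩ : Σ n, (L₀.sum (ExtL LP LN X)).Functions n) =
      2 * SymbolCode.fcode (⟨m, f⟩ : Σ n, L₀.Functions n) := rfl

theorem fcode_param (f : LP.Functions m) :
    SymbolCode.fcode (⟨m, Sum.inr (Sum.inl f)⟩ : Σ n, (L₀.sum (ExtL LP LN X)).Functions n) =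
      4 * SymbolCode.fcode (⟨m, f⟩ : Σ n, LP.Functions n) + 1 := by
  change 2 * (2 * SymbolCode.fcode (⟨m, f⟩ : Σ n, LP.Functions n)) + 1 = _
  omega

theorem fcode_fun (f : LN.Functions m) :
    SymbolCode.fcode (⟨m, Sum.inr (Sum.inr (Sum.inl f))⟩ :
      Σ n, (L₀.sum (ExtL LP LN X)).Functions n) =
      8 * SymbolCode.fcode (⟨m, f⟩ : Σ n, LN.Functions n) + 3 := by
  change 2 * (2 * (2 * SymbolCode.fcode (⟨m, f⟩ : Σ n, LN.Functions n)) + 1) + 1 = _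
  omega

theorem fcode_var (x : (FirstOrder.Language.constantsOn X).Functions 0) :
    SymbolCode.fcode (⟨0, Sum.inr (Sum.inr (Sum.inr x))⟩ :
      Σ n, (L₀.sum (ExtL LP LN X)).Functions n) = 8 * @Encodable.encode X _ x + 7 := by
  change 2 * (2 * (2 * @Encodable.encode X _ x + 1) + 1) + 1 = _
  omega

/-- The encoding of `V ⊕ V` sends `Sum.inl` to even and `Sum.inr` to odd numbers, so reading a
variable as unprimed replaces its code `a` by `2 * a`; reading it as primed gives `2 * a + 1`. -/
theorem norm_one_var (a : ℕ) : norm 1 (8 * a + 7) = 8 * (2 * a) + 7 := by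
  have h : (8 * a + 7) % 8 = 7 := by omega
  simp only [norm, h, Nat.reduceMod]
  norm_num
  omega

theorem norm_two_var (a : ℕ) : norm 2 (8 * a + 7) = 8 * (2 * a + 1) + 7 := by
  have h : (8 * a + 7) % 8 = 7 := by omega
  simp only [norm, h, Nat.reduceMod]
  norm_num
  omega

/-- In the full signature a parameter sits under `Sum.inr (Sum.inl ·)` instead of a single
`Sum.inr`, hence one more doubling. -/
theorem norm_three_param (a : ℕ) : norm 3 (2 * a + 1) = 4 * a + 1 := by
  have h : (2 * a + 1) % 2 = 1 := by omega
  simp only [norm, h, Nat.reduceMod]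
  norm_num
  omega

end Codes

/-! ### Compatibility of the four tagged signatures with the full one. -/

section Tags

variable (L₀ LP LN) [LP.IsAlgebraic] [LN.IsAlgebraic] (s s')

theorem rel_compatible {L : FirstOrder.Language.{0, 0}} [L.IsAlgebraic] [SymbolCode L]
    [L.Structure M] (m : ℕ) (R : (L₀.sum L).Relations m) : ∃ R₀ : L₀.Relations m,
    SymbolCode.rcode (⟨m, R₀⟩ : Σ n, L₀.Relations n) =
      SymbolCode.rcode (⟨m, R⟩ : Σ n, (L₀.sum L).Relations n) / 2 ∧
    ∀ a : Fin m → M, FirstOrder.Language.Structure.RelMap R₀ a ↔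
      FirstOrder.Language.Structure.RelMap R a := by
  rcases R with R | R
  · refine ⟨R, ?_, fun a => Iff.rfl⟩
    rw [rcode_sum_inl]
    omega
  · exact isEmptyElim R

instance isAlgebraic_extL (X : Type) : (ExtL LP LN X).IsAlgebraic := by
  unfold ExtL
  infer_instance

theorem tagCompatible_zero :
    letI := sysStructure L₀ LP LN (Sum.elim s s')
    TagCompatible (L₀ := L₀) (LP := LP) (LN := LN) 0 (FullL L₀ LP LN V) s s' := by
  let := extStructure LP LN (Sum.elim s s')
  exact ⟨fun m f => ⟨f, rfl, fun a => rfl⟩, fun m R => rel_compatible L₀ m R⟩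

theorem tagCompatible_one :
    letI := sysStructure L₀ LP LN s
    TagCompatible (L₀ := L₀) (LP := LP) (LN := LN) 1 (L₀.sum (ExtL LP LN V)) s s' := by
  let := extStructure LP LN s
  refine ⟨?_, fun m R => rel_compatible L₀ m R⟩
  rintro m (f | f | f | f)
  · exact ⟨Sum.inl f, (fcode_base f).trans (Eq.trans (by unfold norm; split_ifs <;> omega)
      (congrArg (norm 1) (fcode_base f)).symm), fun a => rfl⟩
  · exact ⟨Sum.inr (Sum.inl f), (fcode_param f).trans (Eq.trans
      (by unfold norm; split_ifs <;> omega) (congrArg (norm 1) (fcode_param f)).symm),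
      fun a => rfl⟩
  · exact ⟨Sum.inr (Sum.inr (Sum.inl f)), (fcode_fun f).trans (Eq.trans
      (by unfold norm; split_ifs <;> omega) (congrArg (norm 1) (fcode_fun f)).symm),
      fun a => rfl⟩
  · rcases m with _ | m
    · refine ⟨Sum.inr (Sum.inr (Sum.inr (Sum.inl (id f : V) : V ⊕ V))),
        (fcode_var _).trans (Eq.trans ?_ (congrArg (norm 1) (fcode_var f)).symm), fun a => rfl⟩
      exact (norm_one_var _).symm
    · exact isEmptyElim f

theorem tagCompatible_two :
    letI := sysStructure L₀ LP LN s'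
    TagCompatible (L₀ := L₀) (LP := LP) (LN := LN) 2 (L₀.sum (ExtL LP LN V)) s s' := by
  let := extStructure LP LN s'
  refine ⟨?_, fun m R => rel_compatible L₀ m R⟩
  rintro m (f | f | f | f)
  · exact ⟨Sum.inl f, (fcode_base f).trans (Eq.trans (by unfold norm; split_ifs <;> omega)
      (congrArg (norm 2) (fcode_base f)).symm), fun a => rfl⟩
  · exact ⟨Sum.inr (Sum.inl f), (fcode_param f).trans (Eq.trans
      (by unfold norm; split_ifs <;> omega) (congrArg (norm 2) (fcode_param f)).symm),
      fun a => rfl⟩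
  · exact ⟨Sum.inr (Sum.inr (Sum.inl f)), (fcode_fun f).trans (Eq.trans
      (by unfold norm; split_ifs <;> omega) (congrArg (norm 2) (fcode_fun f)).symm),
      fun a => rfl⟩
  · rcases m with _ | m
    · refine ⟨Sum.inr (Sum.inr (Sum.inr (Sum.inr (id f : V) : V ⊕ V))),
        (fcode_var _).trans (Eq.trans ?_ (congrArg (norm 2) (fcode_var f)).symm), fun a => rfl⟩
      exact (norm_two_var _).symm
    · exact isEmptyElim f

theorem tagCompatible_three :
    TagCompatible (L₀ := L₀) (LP := LP) (LN := LN) 3 (L₀.sum LP) s s' := by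
  refine ⟨?_, fun m R => rel_compatible L₀ m R⟩
  rintro m (f | f)
  · exact ⟨Sum.inl f, (fcode_base f).trans (Eq.trans (by unfold norm; split_ifs <;> omega)
      (congrArg (norm 3) (fcode_sum_inl f)).symm), fun a => rfl⟩
  · exact ⟨Sum.inr (Sum.inl f), (fcode_param f).trans ((norm_three_param _).symm.trans
      (congrArg (norm 3) (fcode_sum_inr f)).symm),
      fun a => rfl⟩

end Tags

/-! ## The values of all closures in a given structure -/

section Soundness

open Classical in
/-- The interpretation of the function symbol with code `k - 1`. -/
noncomputable def symbolMap {L : FirstOrder.Language.{0, 0}} [SymbolCode L] [L.Structure M]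
    [Nonempty M] (k : ℕ) (l : List M) : M :=
  if h : ∃ g : L.Functions l.length, SymbolCode.fcode (⟨_, g⟩ : Σ n, L.Functions n) + 1 = k then
    FirstOrder.Language.Structure.funMap h.choose l.get
  else Classical.arbitrary M

theorem symbolMap_ofFn {L : FirstOrder.Language.{0, 0}} [SymbolCode L] [L.Structure M] [Nonempty M]
    {m : ℕ} (g : L.Functions m) (b : Fin m → M) :
    symbolMap (L := L) (SymbolCode.fcode (⟨m, g⟩ : Σ n, L.Functions n) + 1) (List.ofFn b) =
      FirstOrder.Language.Structure.funMap g b := by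
  have h : ∃ g' : L.Functions (List.ofFn b).length,
      SymbolCode.fcode (⟨_, g'⟩ : Σ n, L.Functions n) + 1 =
        SymbolCode.fcode (⟨m, g⟩ : Σ n, L.Functions n) + 1 := by
    rw [List.length_ofFn]; exact ⟨g, rfl⟩
  unfold symbolMap
  rw [dif_pos h]
  have hm : (List.ofFn b).length = m := List.length_ofFn
  have h2 := SymbolCode.fcode_inj (Nat.succ_injective h.choose_spec)
  generalize h.choose = g' at h2
  have key : ∀ (p : ℕ) (hp : p = m) (g' : L.Functions p) (b' : Fin p → M),
      (⟨p, g'⟩ : Σ n, L.Functions n) = ⟨m, g⟩ → (∀ i, b' i = b (i.cast hp)) →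
      FirstOrder.Language.Structure.funMap g' b' = FirstOrder.Language.Structure.funMap g b := by
    rintro p rfl g' b' hg hb
    cases hg
    exact congrArg _ (funext hb)
  exact key _ hm g' _ h2 fun i => by simp [Fin.cast]

/-- The value of a closure, where variables have the values `u`. -/
noncomputable def closureValue (L : FirstOrder.Language.{0, 0}) [SymbolCode L] [L.Structure M]
    [Nonempty M] (u : ℕ → M) (c : ℕ) : M :=
  if key c = 0 then u c
  else symbolMap (L := L) (key c) ((args c).attach.map fun d => closureValue L u d.1)
termination_by c
decreasing_by exact lt_of_mem_args d.2

variable {L : FirstOrder.Language.{0, 0}} [SymbolCode L] [L.Structure M] [Nonempty M]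

theorem closureValue_of_key_ne_zero {u : ℕ → M} {c : ℕ} (h : key c ≠ 0) : closureValue L u c =
    symbolMap (L := L) (key c) ((args c).map (closureValue L u)) := by
  rw [closureValue, if_neg h]
  congr 1
  exact List.attach_map_val

theorem closureValue_of_key_eq_zero {u : ℕ → M} {c : ℕ} (h : key c = 0) :
    closureValue L u c = u c := by
  rw [closureValue, if_pos h]

/-- Values depend only on keys, arguments and leaves. With `f = id` this shows that ground closures
are insensitive to the values in other environments; with `f = copy` it shows that a copy has the
original value. -/
theorem closureValue_congr {u u' : ℕ → M} (f : ℕ → ℕ) (p : ℕ → Prop)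
    (hp : ∀ c, p c → ∀ d ∈ args c, p d) (hu : ∀ c, p c → u (f c) = u' c)
    (hkey : ∀ c, key (f c) = key c) (hargs : ∀ c, args (f c) = (args c).map f) (c : ℕ) (hc : p c) :
    closureValue L u (f c) = closureValue L u' c := by
  induction c using Nat.strong_induction_on with
  | _ c ih =>
    by_cases h : key c = 0
    · rw [closureValue_of_key_eq_zero h, closureValue_of_key_eq_zero ((hkey c).trans h), hu c hc]
    · rw [closureValue_of_key_ne_zero h, closureValue_of_key_ne_zero (by rwa [hkey]), hkey, hargs,
        List.map_map]
      congr 1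
      exact List.map_congr_left fun d hd => ih d (lt_of_mem_args hd) (hp c hc d hd)

theorem env_of_mem_args {c d : ℕ} (h : d ∈ args c) : d.unpair.1 = c.unpair.1 := by
  obtain ⟨t, _, rfl⟩ := List.mem_map.1 h
  simp

theorem key_eq_zero_iff {c : ℕ} : key c = 0 ↔ c.unpair.2.unpair.1 = 0 := by
  unfold key
  split_ifs with h <;> simp [h]

variable (L₀ LP LN) in
/-- In every structure, there are values for all closures. -/
theorem exists_values (N : ℕ) (s s' : V → M) : ∃ X : ℕ → M,
    Evaluates L₀ LP LN (fun _ => True) X s s' ∧ ClosureSat L₀ N X ∧ ∀ c, X (copy c) = X c := by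
  let : (FullL L₀ LP LN V).Structure M := sysStructure L₀ LP LN (Sum.elim s s')
  -- Two passes are made, because the recursion only descends to arguments and cannot jump from a
  -- variable to its entry. The first pass fixes the ground closures; the second uses these values
  -- at variables.
  let X₀ : ℕ → M := closureValue (FullL L₀ LP LN V) fun _ => Classical.arbitrary M
  let u : ℕ → M := fun c => if c.unpair.1.unpair.2 = 0 then Classical.arbitrary M
    else X₀ (entry N c)
  let X : ℕ → M := closureValue (FullL L₀ LP LN V) u
  have hX₀ : ∀ c, c.unpair.1.unpair.2 = 0 → X c = X₀ c := fun c hc =>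
    closureValue_congr id (fun c => c.unpair.1.unpair.2 = 0)
      (fun c hc d hd => by rw [env_of_mem_args hd]; exact hc) (fun c hc => if_pos hc)
      (fun _ => rfl) (fun _ => (List.map_id _).symm) c hc
  have hev : Evaluates L₀ LP LN (fun _ => True) X s s' := by
    intro c _ m g a ha hk
    have h := closureValue_of_key_ne_zero (L := FullL L₀ LP LN V) (u := u) (c := c) (by omega)
    rw [hk, ha, List.map_ofFn, symbolMap_ofFn] at h
    exact h
  refine ⟨X, hev, ⟨?_, ?_, ?_⟩, ?_⟩
  · intro c _ hc he
    have h1 : X c = u c := closureValue_of_key_eq_zero (key_eq_zero_iff.2 hc)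
    rw [h1, hX₀ (entry N c) (by simp [entry, cl])]
    exact if_neg he
  · intro c _ m f a ha hk
    exact hev c trivial m (Sum.inl f) a ha hk
  · intro c _ d _ hk h0 _ he
    have h1 : X c = _ := closureValue_of_key_ne_zero h0
    have h2 : X d = _ := closureValue_of_key_ne_zero (hk ▸ h0)
    rw [h1, h2, hk]
    exact congrArg _ he
  · intro c
    refine closureValue_congr copy (fun _ => True) (fun _ _ _ _ => trivial) (fun c _ => ?_) key_copy
      args_copy c trivial
    simp only [u, entry_copy]
    simp [copy, cl]

end Soundness

end Canonical

/-! ## Structures obtained from the values of closures -/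

section Construction

variable {L₀ LP LN : FirstOrder.Language.{0, 0}} {V M : Type} [SymbolCode L₀] [SymbolCode LP]
  [SymbolCode LN] [Encodable V] {X : ℕ → M}

open Classical in
/-- The interpretation of the symbol with key `k` determined by the values `X`. -/
noncomputable def interp (X : ℕ → M) (B k : ℕ) (l : List M) : M :=
  if h : ∃ c < B, key c = k ∧ (args c).map X = l then X h.choose else X 0

/-- Congruence makes the choice of the representing closure irrelevant, so the interpretation read
off from `X` is well defined. -/
theorem interp_eq [L₀.Structure M] {N : ℕ} (hX : ClosureSat L₀ N X) {c : ℕ} (hc : c < bound N) (h0 : key c ≠ 0)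
    (h2 : key c % 2 = 0) : interp X (bound N) (key c) ((args c).map X) = X c := by
  have h : ∃ d < bound N, key d = key c ∧ (args d).map X = (args c).map X := ⟨c, hc, rfl, rfl⟩
  unfold interp
  rw [dif_pos h]
  have hs := h.choose_spec
  exact hX.cons _ hs.1 _ hc hs.2.1 (by rw [hs.2.1]; exact h0) (by rw [hs.2.1]; exact h2) hs.2.2

/-- The interpretation of the parameters determined by the values `X`. -/
@[reducible] noncomputable def interpParam (LP : FirstOrder.Language.{0, 0}) [SymbolCode LP]
    [LP.IsAlgebraic] (X : ℕ → M) (B : ℕ) : LP.Structure M where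
  funMap {m} f a := interp X B (4 * SymbolCode.fcode (⟨m, f⟩ : Σ n, LP.Functions n) + 2)
    (List.ofFn a)
  RelMap R := isEmptyElim R

/-- The interpretation of the other function symbols determined by the values `X`. -/
@[reducible] noncomputable def interpFun (LN : FirstOrder.Language.{0, 0}) [SymbolCode LN]
    [LN.IsAlgebraic] (X : ℕ → M) (B : ℕ) : LN.Structure M where
  funMap {m} f a := interp X B (8 * SymbolCode.fcode (⟨m, f⟩ : Σ n, LN.Functions n) + 4)
    (List.ofFn a)
  RelMap R := isEmptyElim R

/-- The values of the unprimed and primed system variables determined by the values `X`. -/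
noncomputable def interpVar (X : ℕ → M) (B : ℕ) (w : V ⊕ V) : M :=
  interp X B (8 * Encodable.encode w + 8) []

/-- The parameters are an arbitrary structure subject to `hP`: the reduction to ground
satisfiability builds them from `X`, whereas the weakest condition needs those of a given model. -/
theorem evaluates_interp [L₀.Structure M] [LP.Structure M] [LN.IsAlgebraic] {N : ℕ} (hX : ClosureSat L₀ N X)
    (hP : ∀ c < bound N, ∀ (m : ℕ) (f : LP.Functions m) (a : Fin m → ℕ), args c = List.ofFn a →
      key c = 4 * SymbolCode.fcode (⟨m, f⟩ : Σ n, LP.Functions n) + 2 →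
      X c = FirstOrder.Language.Structure.funMap f fun i => X (a i)) :
    letI := interpFun LN X (bound N)
    Evaluates L₀ LP LN (· < bound N) X (fun v : V => interpVar X (bound N) (Sum.inl v))
      (fun v : V => interpVar X (bound N) (Sum.inr v)) := by
  intro c hc m g a ha hk
  have hI := fun h0 h2 => interp_eq hX hc h0 h2
  rw [ha, List.map_ofFn, hk] at hI
  rcases g with g | g | g | g
  · exact hX.base c hc m g a ha (hk.trans (congrArg (· + 1) (fcode_base g)))
  · exact hP c hc m g a ha (hk.trans (congrArg (· + 1) (fcode_param g)))
  · have e := fcode_fun (L₀ := L₀) (LP := LP) (X := V ⊕ V) g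
    have h1 := hI (by omega) (by omega)
    exact (h1.symm.trans (congrArg (fun k => interp X (bound N) (k + 1) _) e) :)
  · rcases m with _ | m
    · have e := fcode_var (L₀ := L₀) (LP := LP) (LN := LN) g
      have h1 := hI (by omega) (by omega)
      rw [List.ofFn_zero] at h1
      have h2 := h1.symm.trans (congrArg (fun k => interp X (bound N) (k + 1) []) e)
      have h3 : ∀ w : V ⊕ V, interp X (bound N) (8 * Encodable.encode w + 8) [] =
          Sum.elim (fun v : V => interpVar X (bound N) (Sum.inl v))
            (fun v : V => interpVar X (bound N) (Sum.inr v)) w := by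
        rintro (w | w) <;> rfl
      exact h2.trans (h3 _)
    · exact isEmptyElim g

theorem interpParam_eq [L₀.Structure M] [LP.IsAlgebraic] {N : ℕ} (hX : ClosureSat L₀ N X) :
    letI := interpParam LP X (bound N)
    ∀ c < bound N, ∀ (m : ℕ) (f : LP.Functions m) (a : Fin m → ℕ), args c = List.ofFn a →
      key c = 4 * SymbolCode.fcode (⟨m, f⟩ : Σ n, LP.Functions n) + 2 →
      X c = FirstOrder.Language.Structure.funMap f fun i => X (a i) := by
  intro c hc m f a ha hk
  have h1 := interp_eq hX hc (by omega) (by omega)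
  rw [ha, List.map_ofFn, hk] at h1
  exact h1.symm

end Construction

end ParamSys


namespace ParamSys

/-! ## Semantics of the ground problems -/

section Inputs

variable {L₀ LP LN : FirstOrder.Language.{0, 0}} {V : Type} [SymbolCode L₀] [SymbolCode LP]
  [SymbolCode LN] [Encodable V]

theorem inK_code (I : CheckInput L₀ LP LN V) : inK (Coded.code I) = Coded.code I.1 := by
  simp [inK, Coded.code]

theorem inGammaSigma_code (I : CheckInput L₀ LP LN V) :
    inGammaSigma (Coded.code I) = Coded.code I.2.1 := by
  simp [inGammaSigma, Coded.code]

theorem inGammaZero_code (I : CheckInput L₀ LP LN V) :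
    inGammaZero (Coded.code I) = codeFormula I.2.2.1 := by
  simp [inGammaZero, Coded.code]

theorem inInit_code (I : CheckInput L₀ LP LN V) :
    inInit (Coded.code I) = codeFormula I.2.2.2.1 := by
  simp [inInit, Coded.code]

theorem inUpdate_code (I : CheckInput L₀ LP LN V) :
    inUpdate (Coded.code I) = codeFormula I.2.2.2.2.1 := by
  simp [inUpdate, Coded.code]

theorem inPhi_code (I : CheckInput L₀ LP LN V) :
    inPhi (Coded.code I) = codeFormula I.2.2.2.2.2 := by
  simp [inPhi, Coded.code]

theorem inK_le (w : ℕ) : inK w ≤ w := Nat.unpair_left_le _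

theorem inGammaSigma_le (w : ℕ) : inGammaSigma w ≤ w :=
  (Nat.unpair_left_le _).trans (Nat.unpair_right_le _)

theorem inGammaZero_le (w : ℕ) : inGammaZero w ≤ w :=
  (Nat.unpair_left_le _).trans ((Nat.unpair_right_le _).trans (Nat.unpair_right_le _))

theorem inInit_le (w : ℕ) : inInit w ≤ w :=
  (Nat.unpair_left_le _).trans ((Nat.unpair_right_le _).trans ((Nat.unpair_right_le _).trans
    (Nat.unpair_right_le _)))

theorem inUpdate_le (w : ℕ) : inUpdate w ≤ w :=
  (Nat.unpair_left_le _).trans ((Nat.unpair_right_le _).trans ((Nat.unpair_right_le _).trans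
    ((Nat.unpair_right_le _).trans (Nat.unpair_right_le _))))

theorem inPhi_le (w : ℕ) : inPhi w ≤ w :=
  (Nat.unpair_right_le _).trans ((Nat.unpair_right_le _).trans ((Nat.unpair_right_le _).trans
    ((Nat.unpair_right_le _).trans (Nat.unpair_right_le _))))

/-- Pairing is monotone, and strictness comes from `t < N`. Equality is allowed for `e` because
environments occur as `e + 1` with `e < envs N`. -/
theorem cl_lt_bound {N tag e t : ℕ} (htag : tag < 4) (he : e ≤ envs N) (ht : t < N) :
    cl tag e t < bound N := by
  have h1 : Nat.pair tag e ≤ Nat.pair 3 (envs N) := by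
    rcases (Nat.le_of_lt_succ htag).lt_or_eq with h | h
    · rcases he.lt_or_eq with h' | h'
      · exact ((Nat.pair_lt_pair_left _ h).trans (Nat.pair_lt_pair_right _ h')).le
      · rw [h']; exact (Nat.pair_lt_pair_left _ h).le
    · rw [h]
      rcases he.lt_or_eq with h' | h'
      · exact (Nat.pair_lt_pair_right _ h').le
      · rw [h']
  unfold cl bound
  rcases h1.lt_or_eq with h | h
  · exact (Nat.pair_lt_pair_left _ h).trans (Nat.pair_lt_pair_right _ ht)
  · rw [h]; exact Nat.pair_lt_pair_right _ ht

end Inputs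

/-! ### Invariance of clauses under renaming of extension symbols. -/

section MapExt

variable {L₀ L₁ L₂ : FirstOrder.Language.{0, 0}} {α M : Type} [L₀.Structure M] [L₁.Structure M]
  [L₂.Structure M]

theorem realize_mapExt (φ : L₁ →ᴸ L₂) [φ.IsExpansionOn M] (D : Clause L₀ L₁ α) (v : α → M) :
    (D.mapExt φ).Realize v ↔ D.Realize v := by
  have hA : ∀ A : Atom L₀ L₁ α, (A.mapExt φ).Realize v ↔ A.Realize v := by
    intro A
    cases A with
    | eq t u => simp [Atom.mapExt, Atom.Realize, FirstOrder.Language.LHom.realize_onTerm]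
    | rel R ts => simp [Atom.mapExt, Atom.Realize, FirstOrder.Language.LHom.realize_onTerm]
  have hl : ∀ l : Literal L₀ L₁ α,
      Literal.Realize (⟨l.pos, l.atom.mapExt φ⟩ : Literal L₀ L₂ α) v ↔ l.Realize v := by
    intro l
    unfold Literal.Realize
    rw [hA]
  simp [Clause.Realize, Clause.mapExt, hl]

end MapExt

section ProblemSemantics

variable {L₀ LP LN : FirstOrder.Language.{0, 0}} {V : Type} [SymbolCode L₀] [SymbolCode LP]
  [SymbolCode LN] [Encodable V] [LP.IsAlgebraic] [LN.IsAlgebraic] {M : Type} [L₀.Structure M]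
  [LP.Structure M] [LN.Structure M] {s s' : V → M} {R : ℕ → Prop} {X : ℕ → M}
  {α : Type} [Encodable α] {n : ℕ} {nm : ℕ → α ⊕ Fin n} {v : α → M} {xs : Fin n → M}

/-- A sentence has no variables at the leaves, so the values of ground closures determine its truth.
The set `R` is kept general because after a completion only the ground closures are known to be
evaluated. -/
theorem realize_groundF (hX : ∀ c, Sum.elim v xs (nm c) = X c)
    (hev : Evaluates L₀ LP LN R X s s') {tag : ℕ} {L : FirstOrder.Language.{0, 0}}
    [SymbolCode L] [L.Structure M]
    (hL : TagCompatible (L₀ := L₀) (LP := LP) (LN := LN) tag L s s') {N : ℕ}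
    (hR : ∀ t < N, R (cl tag 0 t)) {φ : L.Sentence} (hφ : φ.IsQF) (hN : codeFormula φ ≤ N) :
    (groundF nm tag (codeFormula φ) : L₀.BoundedFormula α n).Realize v xs ↔ M ⊨ φ := by
  refine realize_trF (N := N) (fun t ht => ?_) hL.rel hφ hN
  rw [hX, hev.term hL hR t ht]
  congr 1
  funext b
  rcases b with b | b
  · exact b.elim
  · exact b.elim0

/-- The clauses hold in the environments below `envs N`. -/
def EnvSat (I : CheckInput L₀ LP LN V) (N : ℕ) (X : ℕ → M) (s : V → M) : Prop :=
  letI := extStructure LP LN s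
  ∀ e < envs N,
    (∀ D ∈ I.1, D.Realize fun i => X (cl 1 (e + 1) (Nat.pair 0 i))) ∧
    (∀ D ∈ I.2.1, D.Realize fun i => X (cl 3 (e + 1) (Nat.pair 0 i)))

theorem realize_systemF (hX : ∀ c, Sum.elim v xs (nm c) = X c) (I : CheckInput L₀ LP LN V)
    (hev : Evaluates L₀ LP LN (· < bound (Coded.code I + 1)) X s s') :
    (systemF nm (Coded.code I) : L₀.BoundedFormula α n).Realize v xs ↔
      ClosureSat L₀ (Coded.code I + 1) X ∧ EnvSat I (Coded.code I + 1) X s := by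
  let := extStructure LP LN s
  rw [systemF, FirstOrder.Language.BoundedFormula.realize_inf, realize_closureF,
    show (fun c => Sum.elim v xs (nm c)) = X from funext hX, realize_bigAnd]
  refine and_congr Iff.rfl (forall₂_congr fun e he => ?_)
  rw [FirstOrder.Language.BoundedFormula.realize_inf]
  refine and_congr ?_ ?_
  · rw [inK_code]
    refine realize_trClauses (N := Coded.code I + 1) (fun t ht => ?_) I.1
      (Nat.lt_succ_of_le (by rw [← inK_code]; exact inK_le _))
    rw [hX]
    exact hev.term (tagCompatible_one L₀ LP LN s s') (fun t ht => cl_lt_bound (by omega) he ht) t ht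
  · rw [inGammaSigma_code]
    refine realize_trClauses (N := Coded.code I + 1) (fun t ht => ?_) I.2.1
      (Nat.lt_succ_of_le (by rw [← inGammaSigma_code]; exact inGammaSigma_le _))
    rw [hX]
    exact hev.term (tagCompatible_three L₀ LP LN s s') (fun t ht => cl_lt_bound (by omega) he ht)
      t ht

theorem realize_initGroundF (hX : ∀ c, Sum.elim v xs (nm c) = X c) (I : CheckInput L₀ LP LN V)
    (hev : Evaluates L₀ LP LN R X s s') (hR : ∀ tag < 4, ∀ t < Coded.code I + 1, R (cl tag 0 t))
    (hI : I.2.2.2.Ground) (h₀ : I.2.2.1.IsQF) :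
    (initGroundF nm (Coded.code I) : L₀.BoundedFormula α n).Realize v xs ↔
      M ⊨ I.2.2.1 ∧ HoldsAt M s I.2.2.2.1 ∧ ¬ HoldsAt M s I.2.2.2.2.2 := by
  have b1 := inGammaZero_le (Coded.code I)
  have b2 := inInit_le (Coded.code I)
  have b3 := inPhi_le (Coded.code I)
  rw [inGammaZero_code] at b1
  rw [inInit_code] at b2
  rw [inPhi_code] at b3
  rw [initGroundF, inGammaZero_code, inInit_code, inPhi_code]
  simp only [FirstOrder.Language.BoundedFormula.realize_inf,
    FirstOrder.Language.BoundedFormula.realize_not]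
  refine and_congr ?_ (and_congr ?_ (not_congr ?_))
  · exact realize_groundF hX hev (tagCompatible_three L₀ LP LN s s') (hR 3 (by omega)) h₀ (by omega)
  · let := sysStructure L₀ LP LN s
    exact realize_groundF hX hev (tagCompatible_one L₀ LP LN s s') (hR 1 (by omega)) hI.1 (by omega)
  · let := sysStructure L₀ LP LN s
    exact realize_groundF hX hev (tagCompatible_one L₀ LP LN s s') (hR 1 (by omega)) hI.2.2
      (by omega)

theorem realize_stepGroundF (hX : ∀ c, Sum.elim v xs (nm c) = X c) (I : CheckInput L₀ LP LN V)
    (hev : Evaluates L₀ LP LN R X s s') (hR : ∀ tag < 4, ∀ t < Coded.code I + 1, R (cl tag 0 t))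
    (hI : I.2.2.2.Ground) (h₀ : I.2.2.1.IsQF) :
    (stepGroundF nm (Coded.code I) : L₀.BoundedFormula α n).Realize v xs ↔
      M ⊨ I.2.2.1 ∧ HoldsAt M s I.2.2.2.2.2 ∧ HoldsAt M (Sum.elim s s') I.2.2.2.2.1 ∧
        ¬ HoldsAt M s' I.2.2.2.2.2 := by
  have b1 := inGammaZero_le (Coded.code I)
  have b2 := inUpdate_le (Coded.code I)
  have b3 := inPhi_le (Coded.code I)
  rw [inGammaZero_code] at b1
  rw [inUpdate_code] at b2
  rw [inPhi_code] at b3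
  rw [stepGroundF, inGammaZero_code, inUpdate_code, inPhi_code]
  simp only [FirstOrder.Language.BoundedFormula.realize_inf,
    FirstOrder.Language.BoundedFormula.realize_not]
  refine and_congr ?_ (and_congr ?_ (and_congr ?_ (not_congr ?_)))
  · exact realize_groundF hX hev (tagCompatible_three L₀ LP LN s s') (hR 3 (by omega)) h₀ (by omega)
  · let := sysStructure L₀ LP LN s
    exact realize_groundF hX hev (tagCompatible_one L₀ LP LN s s') (hR 1 (by omega)) hI.2.2
      (by omega)
  · let := sysStructure L₀ LP LN (Sum.elim s s')
    exact realize_groundF hX hev (tagCompatible_zero L₀ LP LN s s') (hR 0 (by omega)) hI.2.1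
      (by omega)
  · let := sysStructure L₀ LP LN s'
    exact realize_groundF hX hev (tagCompatible_two L₀ LP LN s s') (hR 2 (by omega)) hI.2.2
      (by omega)

/-- Clauses hold for all assignments, hence for those given by environments, whatever `X` is. -/
theorem envSat_of_isSysModel {T₀ : L₀.Theory} (I : CheckInput L₀ LP LN V)
    (h : IsSysModel T₀ (I.1 ++ liftClauses LN V I.2.1) M s) (N : ℕ) (X : ℕ → M) :
    EnvSat I N X s := by
  let := extStructure LP LN s
  intro e _
  refine ⟨fun D hD => h.2 D (List.mem_append_left _ hD) _, fun D hD => ?_⟩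
  have h1 := h.2 (D.mapExt FirstOrder.Language.LHom.sumInl)
    (List.mem_append_right _ (List.mem_map.2 ⟨D, hD, rfl⟩)) fun i => X (cl 3 (e + 1) (Nat.pair 0 i))
  exact (realize_mapExt _ D _).1 h1

/-- A model of the theory of the system gives values that satisfy the constraints. -/
theorem realize_systemF_of_isSysModel [Nonempty M] {T₀ : L₀.Theory} (I : CheckInput L₀ LP LN V)
    (h : IsSysModel T₀ (I.1 ++ liftClauses LN V I.2.1) M s) (s' : V → M) : ∃ X : ℕ → M,
      Evaluates L₀ LP LN (fun _ => True) X s s' ∧ (∀ c, X (copy c) = X c) ∧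
      ∀ {α : Type} [Encodable α] {n : ℕ} {nm : ℕ → α ⊕ Fin n} {v : α → M} {xs : Fin n → M},
        (∀ c, Sum.elim v xs (nm c) = X c) →
        (systemF nm (Coded.code I) : L₀.BoundedFormula α n).Realize v xs := by
  obtain ⟨X, hev, hcs, hcopy⟩ := exists_values L₀ LP LN (Coded.code I + 1) s s'
  exact ⟨X, hev, hcopy, fun hX => (realize_systemF hX I (hev.mono fun _ _ => trivial)).2
    ⟨hcs, envSat_of_isSysModel I h _ X⟩⟩

end ProblemSemantics

end ParamSys


namespace ParamSys

/-! ## Terms and variables of clauses -/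

section Subterms

variable {L : FirstOrder.Language.{0, 0}} {α β : Type}

theorem mem_subterms_self (t : L.Term α) : t ∈ subterms t := by
  cases t with
  | var a => exact Set.mem_singleton _
  | func f ts => exact Set.mem_insert _ _

theorem mem_subterms_func {m : ℕ} {f : L.Functions m} {ts : Fin m → L.Term α} {u : L.Term α} :
    u ∈ subterms (.func f ts) ↔ u = .func f ts ∨ ∃ i, u ∈ subterms (ts i) := by
  simp [subterms]

theorem subterms_trans {t u w : L.Term α} (h : u ∈ subterms t) (hw : w ∈ subterms u) :
    w ∈ subterms t := by
  induction t with
  | var a => cases (Set.mem_singleton_iff.1 h); exact hw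
  | func f ts ih =>
    rcases mem_subterms_func.1 h with rfl | ⟨i, hi⟩
    · exact hw
    · exact mem_subterms_func.2 (Or.inr ⟨i, ih i hi⟩)

theorem mem_varList {t : L.Term α} {x : α} : x ∈ varList t ↔ FirstOrder.Language.Term.var x ∈ subterms t := by
  induction t with
  | var a => simp [varList, subterms]
  | func f ts ih =>
    rw [mem_subterms_func]
    simp [varList, List.mem_ofFn', ih]

theorem varList_eq_nil_of_mem {t u : L.Term α} (ht : varList t = []) (hu : u ∈ subterms t) :
    varList u = [] := by
  rw [List.eq_nil_iff_forall_not_mem] at ht ⊢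
  exact fun x hx => ht x (mem_varList.2 (subterms_trans hu (mem_varList.1 hx)))

theorem realize_congr_varList {M : Type} [L.Structure M] {t : L.Term α} {v v' : α → M}
    (h : ∀ x, FirstOrder.Language.Term.var x ∈ subterms t → v x = v' x) :
    t.realize v = t.realize v' := by
  induction t with
  | var a => exact h a (Set.mem_singleton _)
  | func f ts ih =>
    rw [FirstOrder.Language.Term.realize_func, FirstOrder.Language.Term.realize_func]
    exact congrArg _ (funext fun i => ih i fun x hx => h x (mem_subterms_func.2 (Or.inr ⟨i, hx⟩)))

theorem realize_congr_closed {M : Type} [L.Structure M] {t : L.Term α} (ht : varList t = [])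
    (v v' : α → M) : t.realize v = t.realize v' :=
  realize_congr_varList fun x hx => absurd (mem_varList.2 hx) (by simp [ht])

theorem mem_subterms_subst {t u : L.Term α} (σ : α → L.Term β) (h : u ∈ subterms t) :
    u.subst σ ∈ subterms (t.subst σ) := by
  induction t with
  | var a => cases (Set.mem_singleton_iff.1 h); exact mem_subterms_self _
  | func f ts ih =>
    rcases mem_subterms_func.1 h with rfl | ⟨i, hi⟩
    · exact mem_subterms_self _
    · exact mem_subterms_func.2 (Or.inr ⟨i, ih i hi⟩)

theorem mem_subterms_onTerm {L' : FirstOrder.Language.{0, 0}} (φ : L →ᴸ L') {t : L.Term α}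
    {u : L'.Term α} : u ∈ subterms (φ.onTerm t) ↔ ∃ u₀ ∈ subterms t, φ.onTerm u₀ = u := by
  induction t with
  | var a => simp [subterms, FirstOrder.Language.LHom.onTerm, eq_comm]
  | func f ts ih =>
    rw [FirstOrder.Language.LHom.onTerm, mem_subterms_func]
    simp only [ih, mem_subterms_func]
    constructor
    · rintro (rfl | ⟨i, u₀, h, rfl⟩)
      · exact ⟨_, Or.inl rfl, rfl⟩
      · exact ⟨u₀, Or.inr ⟨i, h⟩, rfl⟩
    · rintro ⟨u₀, rfl | ⟨i, h⟩, rfl⟩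
      · exact Or.inl rfl
      · exact Or.inr ⟨i, u₀, h, rfl⟩

theorem codeTerm_le_of_mem [SymbolCode L] [Encodable α] {t u : L.Term α} (h : u ∈ subterms t) :
    codeTerm u ≤ codeTerm t := by
  induction t with
  | var a => cases (Set.mem_singleton_iff.1 h); exact le_rfl
  | func f ts ih =>
    rcases mem_subterms_func.1 h with rfl | ⟨i, hi⟩
    · exact le_rfl
    · exact (ih i hi).trans (codeTerm_lt_func f ts i).le

end Subterms

section Clauses

variable {L₀ L₁ L₂ : FirstOrder.Language.{0, 0}} {α β : Type}

theorem Clause.mem_subterms {D : Clause L₀ L₁ α} {u : (L₀.sum L₁).Term α} :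
    u ∈ D.subterms ↔ ∃ l ∈ D, u ∈ l.atom.subterms := by
  simp [Clause.subterms]

theorem Atom.subterms_trans {A : Atom L₀ L₁ α} {t u : (L₀.sum L₁).Term α} (ht : t ∈ A.subterms)
    (hu : u ∈ ParamSys.subterms t) : u ∈ A.subterms := by
  cases A with
  | eq a b => exact ht.imp (fun h => ParamSys.subterms_trans h hu) fun h =>
      ParamSys.subterms_trans h hu
  | rel R ts =>
    obtain ⟨i, hi⟩ := Set.mem_iUnion.1 ht
    exact Set.mem_iUnion.2 ⟨i, ParamSys.subterms_trans hi hu⟩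

theorem Clause.subterms_trans {D : Clause L₀ L₁ α} {t u : (L₀.sum L₁).Term α}
    (ht : t ∈ D.subterms) (hu : u ∈ ParamSys.subterms t) : u ∈ D.subterms := by
  obtain ⟨l, hl, h⟩ := Clause.mem_subterms.1 ht
  exact Clause.mem_subterms.2 ⟨l, hl, Atom.subterms_trans h hu⟩

theorem Clause.mem_subterms_subst {D : Clause L₀ L₁ α} {u : (L₀.sum L₁).Term α}
    (σ : α → (L₀.sum L₁).Term β) (h : u ∈ D.subterms) : u.subst σ ∈ (D.subst σ).subterms := by
  obtain ⟨⟨p, A⟩, hl, h⟩ := Clause.mem_subterms.1 h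
  refine Clause.mem_subterms.2 ⟨_, List.mem_map.2 ⟨_, hl, rfl⟩, ?_⟩
  cases A with
  | eq a b => exact Or.imp (ParamSys.mem_subterms_subst σ) (ParamSys.mem_subterms_subst σ) h
  | rel R ts =>
    obtain ⟨i, hi⟩ := Set.mem_iUnion.1 h
    exact Set.mem_iUnion.2 ⟨i, ParamSys.mem_subterms_subst σ hi⟩

theorem Clause.mem_subterms_mapExt (φ : L₁ →ᴸ L₂) {D : Clause L₀ L₁ α}
    {u : (L₀.sum L₂).Term α} : u ∈ (D.mapExt φ).subterms ↔ ∃ u₀ ∈ D.subterms,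
      (FirstOrder.Language.LHom.sumMap (FirstOrder.Language.LHom.id L₀) φ).onTerm u₀ = u := by
  have hA : ∀ A : Atom L₀ L₁ α, u ∈ (A.mapExt φ).subterms ↔ ∃ u₀ ∈ A.subterms,
      (FirstOrder.Language.LHom.sumMap (FirstOrder.Language.LHom.id L₀) φ).onTerm u₀ = u := by
    intro A
    cases A with
    | eq a b =>
      simp only [Atom.mapExt, Atom.subterms, Set.mem_union, mem_subterms_onTerm, or_and_right,
        exists_or]
    | rel R ts =>
      simp only [Atom.mapExt, Atom.subterms, Set.mem_iUnion, mem_subterms_onTerm]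
      exact ⟨fun ⟨i, u₀, h, e⟩ => ⟨u₀, ⟨i, h⟩, e⟩, fun ⟨u₀, ⟨i, h⟩, e⟩ => ⟨i, u₀, h, e⟩⟩
  simp only [Clause.mem_subterms, Clause.mapExt, List.mem_map]
  constructor
  · rintro ⟨_, ⟨l, hl, rfl⟩, h⟩
    obtain ⟨u₀, h, e⟩ := (hA _).1 h
    exact ⟨u₀, ⟨l, hl, h⟩, e⟩
  · rintro ⟨u₀, ⟨l, hl, h⟩, e⟩
    exact ⟨_, ⟨l, hl, rfl⟩, (hA _).2 ⟨u₀, h, e⟩⟩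

theorem Clause.hasVar_mapExt (φ : L₁ →ᴸ L₂) {D : Clause L₀ L₁ α} {x : α} :
    (D.mapExt φ).HasVar x ↔ D.HasVar x := by
  unfold Clause.HasVar
  rw [Clause.mem_subterms_mapExt]
  constructor
  · rintro ⟨u₀, h, e⟩
    cases u₀ with
    | var y => cases e; exact h
    | func f ts => cases e
  · exact fun h => ⟨_, h, rfl⟩

theorem codeTerm_lt_code [SymbolCode L₀] [SymbolCode L₁] [Encodable α] {D : Clause L₀ L₁ α}
    {u : (L₀.sum L₁).Term α} (h : u ∈ D.subterms) : codeTerm u < Coded.code D := by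
  obtain ⟨l, hl, h⟩ := Clause.mem_subterms.1 h
  refine lt_of_le_of_lt (le_trans ?_ (Nat.right_le_pair l.pos.toNat _)) (code_lt_of_mem hl)
  generalize l.atom = A at h
  cases A with
  | eq a b =>
    refine le_trans ?_ (Nat.right_le_pair _ _)
    rcases h with h | h
    · exact (codeTerm_le_of_mem h).trans (Nat.left_le_pair _ _)
    · exact (codeTerm_le_of_mem h).trans (Nat.right_le_pair _ _)
  | rel R ts =>
    obtain ⟨i, hi⟩ := Set.mem_iUnion.1 h
    exact (codeTerm_le_of_mem hi).trans (codeTerm_lt_codeAtom_rel R ts i).le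

variable {M : Type} [L₀.Structure M] [L₁.Structure M]

theorem Clause.realize_subst (D : Clause L₀ L₁ α) (σ : α → (L₀.sum L₁).Term β) (v : β → M) :
    (D.subst σ).Realize v ↔ D.Realize fun x => (σ x).realize v := by
  have hl : ∀ l : Literal L₀ L₁ α, Literal.Realize (⟨l.pos, l.atom.subst σ⟩ : Literal L₀ L₁ β) v ↔
      l.Realize fun x => (σ x).realize v := by
    rintro ⟨p, _ | _⟩ <;> simp [Literal.Realize, Atom.subst, Atom.Realize]
  simp [Clause.Realize, Clause.subst, hl]

theorem Atom.realize_congr {A : Atom L₀ L₁ α} {v v' : α → M}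
    (h : ∀ x, FirstOrder.Language.Term.var x ∈ A.subterms → v x = v' x) :
    A.Realize v ↔ A.Realize v' := by
  cases A with
  | eq a b =>
    simp only [Atom.Realize]
    rw [realize_congr_varList fun x hx => h x (Or.inl hx),
      realize_congr_varList fun x hx => h x (Or.inr hx)]
  | rel R ts =>
    simp only [Atom.Realize]
    rw [show (fun i => (ts i).realize v) = fun i => (ts i).realize v' from
      funext fun i => realize_congr_varList fun x hx => h x (Set.mem_iUnion.2 ⟨i, hx⟩)]

theorem Clause.realize_congr {D : Clause L₀ L₁ α} {v v' : α → M}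
    (h : ∀ x, D.HasVar x → v x = v' x) : D.Realize v ↔ D.Realize v' := by
  unfold Clause.Realize
  refine exists_congr fun l => and_congr_right fun hl => ?_
  unfold Literal.Realize
  rw [Atom.realize_congr fun x hx => h x (Clause.mem_subterms.2 ⟨l, hl, hx⟩)]

end Clauses

/-! ## Environments for given values of the variables -/

section Environments

variable {L₀ : FirstOrder.Language.{0, 0}} [SymbolCode L₀] {M : Type} [L₀.Structure M]

/-- An assignment of values of ground closures to finitely many variables is realised by an
environment, uniformly in the tag under which the clause is read. A variable with code below `N` has
index below `N`, hence a digit in the environment. -/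
theorem exists_env_values {N : ℕ} {X : ℕ → M} (hX : ClosureSat L₀ N X) (p : ℕ → Prop)
    (val : ℕ → M) (hp : ∀ x, p x → Nat.pair 0 x < N)
    (h : ∀ x, p x → ∃ tag < 4, ∃ t < N, val x = X (cl tag 0 t)) :
    ∃ e < envs N, ∀ tag' < 4, ∀ x, p x → X (cl tag' (e + 1) (Nat.pair 0 x)) = val x := by
  -- Indices outside `p` also need a digit; they receive the dummy closure with tag and term code 0.
  have h' : ∀ x, ∃ tag t, x < N → tag < 4 ∧ t < N ∧ (p x → val x = X (cl tag 0 t)) := by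
    intro x
    by_cases hx : p x
    · obtain ⟨tag, h1, t, h2, h3⟩ := h x hx
      exact ⟨tag, t, fun _ => ⟨h1, h2, fun _ => h3⟩⟩
    · exact ⟨0, 0, fun hN => ⟨by omega, by omega, fun h => (hx h).elim⟩⟩
  choose tag t ht using h'
  obtain ⟨e, he, henv⟩ := exists_env N tag t (fun i hi => (ht i hi).1) fun i hi => (ht i hi).2.1
  refine ⟨e, he, fun tag' htag' x hx => ?_⟩
  have hxN : x < N := (Nat.right_le_pair 0 x).trans_lt (hp x hx)
  rw [hX.var _ (cl_lt_bound htag' he (hp x hx)) (by simp [cl]) (by simp [cl]), henv tag' x hxN,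
    (ht x hxN).2.2 hx]

end Environments

end ParamSys


namespace ParamSys

/-! ## Ground formulas as sets of ground clauses -/

section GroundClauses

variable {L₀ LP LN : FirstOrder.Language.{0, 0}} {V : Type} [Encodable V]

/-- The application of a symbol, where the primed system variables are replaced by fresh
constants. -/
def unprimedApp : ∀ {m : ℕ}, (FullL L₀ LP LN V).Functions m →
    (Fin m → (L₀.sum (ExtL LP LN V)).Term ℕ) → (L₀.sum (ExtL LP LN V)).Term ℕ
  | _, Sum.inl f, us => .func (Sum.inl f) us
  | _, Sum.inr (Sum.inl f), us => .func (Sum.inr (Sum.inl f)) us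
  | _, Sum.inr (Sum.inr (Sum.inl f)), us => .func (Sum.inr (Sum.inr (Sum.inl f))) us
  | 0, Sum.inr (Sum.inr (Sum.inr x)), us =>
    match (show V ⊕ V from x) with
    | Sum.inl w => .func (l := 0)
        (Sum.inr (Sum.inr (Sum.inr (show (FirstOrder.Language.constantsOn V).Functions 0 from w)))) us
    | Sum.inr w => .var (Encodable.encode w)
  | _ + 1, Sum.inr (Sum.inr (Sum.inr x)), _ => nomatch (show PEmpty from x)

theorem realize_unprimedApp {M : Type} [L₀.Structure M] [LP.Structure M] [LN.Structure M]
    {s s' : V → M} {c : ℕ → M} (hc : ∀ w, c (Encodable.encode w) = s' w) {m : ℕ}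
    (g : (FullL L₀ LP LN V).Functions m) (us : Fin m → (L₀.sum (ExtL LP LN V)).Term ℕ) :
    letI := extStructure LP LN s
    (unprimedApp g us).realize c = FirstOrder.Language.Structure.funMap
      (self := sysStructure L₀ LP LN (Sum.elim s s')) g fun i => (us i).realize c := by
  rcases g with g | g | g | g
  · cases m <;> rfl
  · cases m <;> rfl
  · cases m <;> rfl
  · cases m with
    | zero =>
      rcases g with g | g
      · rfl
      · exact hc g
    | succ m => exact (nomatch (show PEmpty from g))

theorem mem_subterms_unprimedApp {m : ℕ} {g : (FullL L₀ LP LN V).Functions m}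
    {us : Fin m → (L₀.sum (ExtL LP LN V)).Term ℕ} {u : (L₀.sum (ExtL LP LN V)).Term ℕ}
    (h : u ∈ subterms (unprimedApp g us)) : u = unprimedApp g us ∨ ∃ i, u ∈ subterms (us i) := by
  rcases g with g | g | g | g
  · cases m <;> exact mem_subterms_func.1 h
  · cases m <;> exact mem_subterms_func.1 h
  · cases m <;> exact mem_subterms_func.1 h
  · cases m with
    | zero =>
      rcases g with g | g
      · exact mem_subterms_func.1 h
      · exact Or.inl (Set.mem_singleton_iff.1 h)
    | succ m => exact (nomatch (show PEmpty from g))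

variable [SymbolCode L₀] [SymbolCode LP] [SymbolCode LN]

/-- The term `u`, with fresh constants for the primed system variables, has the same values as the
term `t` over the signature given by `tag`. -/
def Translates (tag : ℕ) {L : FirstOrder.Language.{0, 0}} [SymbolCode L] {γ : Type}
    (u : (L₀.sum (ExtL LP LN V)).Term ℕ) (t : L.Term γ) : Prop :=
  ∀ (M : Type) [L₀.Structure M] [LP.Structure M] [LN.Structure M] [L.Structure M] (s s' : V → M)
    (c : ℕ → M) (v : γ → M), TagCompatible (L₀ := L₀) (LP := LP) (LN := LN) tag L s s' →
    (∀ w, c (Encodable.encode w) = s' w) →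
    letI := extStructure LP LN s
    u.realize c = t.realize v

/-- The symbols of `L` have translations. -/
structure TagTranslation (L₀ LP LN : FirstOrder.Language.{0, 0}) (V : Type) [SymbolCode L₀]
    [SymbolCode LP] [SymbolCode LN] [Encodable V] (tag : ℕ) (L : FirstOrder.Language.{0, 0})
    [SymbolCode L] : Prop where
  func : ∀ (m : ℕ) (f : L.Functions m), ∃ g : (FullL L₀ LP LN V).Functions m,
    SymbolCode.fcode (⟨m, g⟩ : Σ n, (FullL L₀ LP LN V).Functions n) =
      norm tag (SymbolCode.fcode (⟨m, f⟩ : Σ n, L.Functions n))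
  rel : ∀ (m : ℕ) (R : L.Relations m), ∃ R₀ : L₀.Relations m,
    SymbolCode.rcode (⟨m, R₀⟩ : Σ n, L₀.Relations n) =
      SymbolCode.rcode (⟨m, R⟩ : Σ n, L.Relations n) / 2

variable {tag : ℕ} {L : FirstOrder.Language.{0, 0}} [SymbolCode L]

theorem TagCompatible.translation {M : Type} [L₀.Structure M] [LP.Structure M] [LN.Structure M]
    [L.Structure M] {s s' : V → M} (h : TagCompatible (L₀ := L₀) (LP := LP) (LN := LN) tag L s s') :
    TagTranslation L₀ LP LN V tag L :=
  ⟨fun m f => let ⟨g, hg, _⟩ := h.func m f; ⟨g, hg⟩,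
    fun m R => let ⟨R₀, hR, _⟩ := h.rel m R; ⟨R₀, hR⟩⟩

theorem eq_of_fcode_eq {m : ℕ} {f g : L.Functions m}
    (h : SymbolCode.fcode (⟨m, f⟩ : Σ n, L.Functions n) = SymbolCode.fcode ⟨m, g⟩) : f = g := by
  cases SymbolCode.fcode_inj h; rfl

theorem eq_of_rcode_eq {m : ℕ} {R S : L.Relations m}
    (h : SymbolCode.rcode (⟨m, R⟩ : Σ n, L.Relations n) = SymbolCode.rcode ⟨m, S⟩) : R = S := by
  cases SymbolCode.rcode_inj h; rfl

/-- Besides the translated term, a source is recorded for each of its subterms, with no larger code.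
This later locates all extension terms of `G` among the ground closures. -/
theorem exists_translates (h : TagTranslation L₀ LP LN V tag L) {γ : Type} [IsEmpty γ] [Encodable γ]
    (t : L.Term γ) : ∃ u : (L₀.sum (ExtL LP LN V)).Term ℕ, Translates tag u t ∧
      ∀ u' ∈ subterms u, ∃ t' : L.Term γ, codeTerm t' ≤ codeTerm t ∧ Translates tag u' t' := by
  induction t with
  | var b => exact isEmptyElim b
  | @func m f ts ih =>
    choose us hus hsub using ih
    obtain ⟨g, hg⟩ := h.func m f
    have key : Translates tag (unprimedApp g us) (FirstOrder.Language.Term.func f ts) := by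
      intro M _ _ _ _ s s' c v hL hc
      obtain ⟨g', hg', hfun⟩ := hL.func m f
      -- A symbol is determined by its code, so the `g` chosen once is the symbol supplied by every
      -- compatible structure.
      obtain rfl := eq_of_fcode_eq (hg.trans hg'.symm)
      rw [FirstOrder.Language.Term.realize_func, ← hfun]
      exact (realize_unprimedApp hc g us).trans
        (congrArg _ (funext fun i => hus i M s s' c v hL hc))
    refine ⟨_, key, fun u' hu' => ?_⟩
    rcases mem_subterms_unprimedApp hu' with rfl | ⟨i, hi⟩
    · exact ⟨_, le_rfl, key⟩
    · obtain ⟨t', ht', h'⟩ := hsub i u' hi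
      exact ⟨t', ht'.trans (codeTerm_lt_func f ts i).le, h'⟩

/-- The ground clauses `G` are equivalent to the statement `P` about structures. -/
def ClausesFor (tag : ℕ) (L : FirstOrder.Language.{0, 0}) [SymbolCode L]
    (G : List (Clause L₀ (ExtL LP LN V) ℕ)) (P : ∀ (M : Type) [L.Structure M], Prop) : Prop :=
  ∀ (M : Type) [L₀.Structure M] [LP.Structure M] [LN.Structure M] [L.Structure M] (s s' : V → M)
    (c : ℕ → M), TagCompatible (L₀ := L₀) (LP := LP) (LN := LN) tag L s s' →
    (∀ w, c (Encodable.encode w) = s' w) →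
    letI := extStructure LP LN s
    (∀ D ∈ G, D.Realize c) ↔ P M

/-- The terms in `G` are translations of terms with codes below `N`. -/
def NamedClauses (tag : ℕ) (L : FirstOrder.Language.{0, 0}) [SymbolCode L] (N : ℕ)
    (G : List (Clause L₀ (ExtL LP LN V) ℕ)) : Prop :=
  ∀ D ∈ G, ∀ u ∈ D.subterms, ∃ t : L.Term (Empty ⊕ Fin 0), codeTerm t < N ∧ Translates tag u t

theorem NamedClauses.mono {N N' : ℕ} {G : List (Clause L₀ (ExtL LP LN V) ℕ)}
    (h : NamedClauses tag L N G) (hN : N ≤ N') : NamedClauses tag L N' G := fun D hD u hu =>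
  let ⟨t, ht, h'⟩ := h D hD u hu
  ⟨t, ht.trans_le hN, h'⟩

theorem exists_clausesFor_atom (A : Atom L₀ (ExtL LP LN V) ℕ) {N : ℕ}
    {P : ∀ (M : Type) [L.Structure M], Prop}
    (hA : ∀ (M : Type) [L₀.Structure M] [LP.Structure M] [LN.Structure M] [L.Structure M]
      (s s' : V → M) (c : ℕ → M), TagCompatible (L₀ := L₀) (LP := LP) (LN := LN) tag L s s' →
      (∀ w, c (Encodable.encode w) = s' w) →
      letI := extStructure LP LN s
      A.Realize c ↔ P M)
    (hN : ∀ u ∈ A.subterms, ∃ t : L.Term (Empty ⊕ Fin 0), codeTerm t < N ∧ Translates tag u t) :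
    ∃ G G' : List (Clause L₀ (ExtL LP LN V) ℕ), ClausesFor tag L G P ∧
      ClausesFor tag L G' (fun M _ => ¬ P M) ∧ NamedClauses tag L N G ∧
      NamedClauses tag L N G' := by
  refine ⟨[ [⟨true, A⟩] ], [ [⟨false, A⟩] ], ?_, ?_, ?_, ?_⟩
  · intro M _ _ _ _ s s' c hL hc
    rw [← hA M s s' c hL hc]
    simp [Clause.Realize, Literal.Realize]
  · intro M _ _ _ _ s s' c hL hc
    beta_reduce
    rw [← hA M s s' c hL hc]
    simp [Clause.Realize, Literal.Realize]
  all_goals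
    intro D hD u hu
    rw [List.mem_singleton.1 hD, Clause.mem_subterms] at hu
    obtain ⟨l, hl, h⟩ := hu
    rw [List.mem_singleton.1 hl] at h
    exact hN u h

theorem realize_append {M : Type} {L₁ : FirstOrder.Language.{0, 0}} [L₀.Structure M]
    [L₁.Structure M] {D D' : Clause L₀ L₁ ℕ} {c : ℕ → M} :
    Clause.Realize (D ++ D') c ↔ D.Realize c ∨ D'.Realize c := by
  simp [Clause.Realize, or_and_right, exists_or]

/-- Conjunctive normal form, obtained simultaneously for a formula and its negation. The equivalence
is uniform in the structure, so the same clauses can be checked in the structure built from the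
values and read back in the model provided by `Loc`. -/
theorem exists_clausesFor (h : TagTranslation L₀ LP LN V tag L) {φ : L.Sentence} (hφ : φ.IsQF) :
    ∃ G G' : List (Clause L₀ (ExtL LP LN V) ℕ), ClausesFor tag L G (fun M _ => M ⊨ φ) ∧
      ClausesFor tag L G' (fun M _ => ¬ M ⊨ φ) ∧ NamedClauses tag L (codeFormula φ) G ∧
      NamedClauses tag L (codeFormula φ) G' := by
  have hv : ∀ (M : Type) (v : Empty ⊕ Fin 0 → M), v = Sum.elim default default := fun M v =>
    funext fun x => isEmptyElim x
  induction hφ with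
  | falsum =>
    refine ⟨[ [] ], [], ?_, ?_, ?_, ?_⟩
    · intro M _ _ _ _ s s' c hL hc
      simp [Clause.Realize, FirstOrder.Language.Sentence.Realize, FirstOrder.Language.Formula.Realize]
      exact fun h => h
    · intro M _ _ _ _ s s' c hL hc
      simp [FirstOrder.Language.Sentence.Realize, FirstOrder.Language.Formula.Realize]
      exact fun h => h
    · intro D hD u hu
      rw [List.mem_singleton.1 hD, Clause.mem_subterms] at hu
      simp at hu
    · intro D hD
      simp at hD
  | of_isAtomic hat =>
    cases hat with
    | equal t₁ t₂ =>
      obtain ⟨u₁, h₁, hs₁⟩ := exists_translates h t₁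
      obtain ⟨u₂, h₂, hs₂⟩ := exists_translates h t₂
      have e : codeFormula (t₁.bdEqual t₂) = Nat.pair 1 (Nat.pair (codeTerm t₁) (codeTerm t₂)) := rfl
      have b1 := right_lt_pair (a := 1) (b := Nat.pair (codeTerm t₁) (codeTerm t₂)) (by omega)
      have b2 := Nat.left_le_pair (codeTerm t₁) (codeTerm t₂)
      have b3 := Nat.right_le_pair (codeTerm t₁) (codeTerm t₂)
      refine exists_clausesFor_atom (.eq u₁ u₂) (fun M _ _ _ _ s s' c hL hc => ?_) fun u hu => ?_
      · simp only [Atom.Realize]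
        rw [h₁ M s s' c (Sum.elim default default) hL hc,
          h₂ M s s' c (Sum.elim default default) hL hc]
        rfl
      · rcases hu with hu | hu
        · obtain ⟨t', ht', h'⟩ := hs₁ u hu
          exact ⟨t', by omega, h'⟩
        · obtain ⟨t', ht', h'⟩ := hs₂ u hu
          exact ⟨t', by omega, h'⟩
    | @rel l R ts =>
      choose us hus hsub using fun i => exists_translates h (ts i)
      obtain ⟨R₀, hR₀⟩ := h.rel l R
      have e : codeFormula (R.boundedFormula ts) = Nat.pair 2 (Nat.pair (SymbolCode.rcode
        (⟨l, R⟩ : Σ n, L.Relations n)) (Encodable.encode (List.ofFn fun i => codeTerm (ts i)))) :=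
        rfl
      refine exists_clausesFor_atom (.rel R₀ us) (fun M _ _ _ _ s s' c hL hc => ?_) fun u hu => ?_
      · obtain ⟨R₁, hR₁, hR⟩ := hL.rel l R
        obtain rfl := eq_of_rcode_eq (hR₀.trans hR₁.symm)
        let := extStructure LP LN s
        simp only [Atom.Realize]
        rw [hR, show (fun i => @FirstOrder.Language.Term.realize _ M _ _ c (us i)) = _ from
          funext fun i => hus i M s s' c (Sum.elim default default) hL hc]
        rfl
      · obtain ⟨i, hi⟩ := Set.mem_iUnion.1 hu
        obtain ⟨t', ht', h'⟩ := hsub i u hi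
        refine ⟨t', ht'.trans_lt ?_, h'⟩
        have h1 : codeTerm (ts i) < Encodable.encode (List.ofFn fun i => codeTerm (ts i)) :=
          lt_encode_of_mem ((List.mem_ofFn' _ _).2 ⟨i, rfl⟩)
        rw [e]
        exact h1.trans_le ((Nat.right_le_pair _ _).trans (Nat.right_le_pair _ _))
  | @imp φ ψ _ _ ih₁ ih₂ =>
    obtain ⟨G₁, G₁', a₁, a₁', n₁, n₁'⟩ := ih₁
    obtain ⟨G₂, G₂', a₂, a₂', n₂, n₂'⟩ := ih₂
    have e : codeFormula (φ.imp ψ) = Nat.pair 3 (Nat.pair (codeFormula φ) (codeFormula ψ)) := rfl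
    have b1 := right_lt_pair (a := 3) (b := Nat.pair (codeFormula φ) (codeFormula ψ)) (by omega)
    have b2 := Nat.left_le_pair (codeFormula φ) (codeFormula ψ)
    have b3 := Nat.right_le_pair (codeFormula φ) (codeFormula ψ)
    have hreal : ∀ (M : Type) [L.Structure M], M ⊨ (φ.imp ψ : L.Sentence) ↔
        (M ⊨ (φ : L.Sentence) → M ⊨ (ψ : L.Sentence)) := fun M _ => Iff.rfl
    -- The implication is `¬φ ∨ ψ`, distributed over the conjunctions; its negation is `φ ∧ ¬ψ`.
    refine ⟨G₁'.flatMap fun D => G₂.map fun D' => D ++ D', G₁ ++ G₂', ?_, ?_, ?_, ?_⟩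
    · intro M _ _ _ _ s s' c hL hc
      let := extStructure LP LN s
      have h1 := a₁' M s s' c hL hc
      have h2 := a₂ M s s' c hL hc
      beta_reduce at h1 h2 ⊢
      rw [hreal, imp_iff_not_or, ← h1, ← h2]
      simp only [List.mem_flatMap, List.mem_map, forall_exists_index, and_imp]
      constructor
      · intro H
        by_contra! hc'
        obtain ⟨⟨D, hD, hDc⟩, D', hD', hDc'⟩ := hc'
        exact (realize_append.1 (H _ D hD D' hD' rfl)).elim hDc hDc'
      · rintro H _ D hD D' hD' rfl
        exact realize_append.2 (H.imp (fun H => H D hD) fun H => H D' hD')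
    · intro M _ _ _ _ s s' c hL hc
      have h1 := a₁ M s s' c hL hc
      have h2 := a₂' M s s' c hL hc
      beta_reduce at h1 h2 ⊢
      rw [hreal, Classical.not_imp, ← h1, ← h2]
      simp only [List.mem_append, or_imp, forall_and]
    · intro D hD u hu
      simp only [List.mem_flatMap, List.mem_map] at hD
      obtain ⟨D₁, hD₁, D₂, hD₂, rfl⟩ := hD
      obtain ⟨l, hl, h⟩ := Clause.mem_subterms.1 hu
      rcases List.mem_append.1 hl with hl | hl
      · exact n₁'.mono (by omega) D₁ hD₁ u (Clause.mem_subterms.2 ⟨l, hl, h⟩)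
      · exact n₂.mono (by omega) D₂ hD₂ u (Clause.mem_subterms.2 ⟨l, hl, h⟩)
    · intro D hD
      rcases List.mem_append.1 hD with hD | hD
      · exact n₁.mono (by omega) D hD
      · exact n₂'.mono (by omega) D hD

end GroundClauses

end ParamSys


namespace ParamSys

/-! ## Models from local instances -/

section Locality

variable {L₀ LP LN : FirstOrder.Language.{0, 0}} {V : Type} [SymbolCode L₀] [SymbolCode LP]
  [SymbolCode LN] [Encodable V] [LP.IsAlgebraic] [LN.IsAlgebraic]

/-- Every structure for the extension symbols is of the form `extStructure`. -/
theorem exists_eq_extStructure {M : Type} (h : (ExtL LP LN V).Structure M) :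
    ∃ (_ : LP.Structure M) (_ : LN.Structure M) (s : V → M), h = extStructure LP LN s := by
  refine ⟨⟨fun f a => h.funMap (Sum.inl f) a, fun R => isEmptyElim R⟩,
    ⟨fun f a => h.funMap (Sum.inr (Sum.inl f)) a, fun R => isEmptyElim R⟩,
    fun w => h.funMap (n := 0)
      (Sum.inr (Sum.inr (show (FirstOrder.Language.constantsOn V).Functions 0 from w))) default, ?_⟩
  refine FirstOrder.Language.Structure.ext ?_ ?_
  · funext m f a
    rcases f with f | f | f
    · rfl
    · rfl
    · cases m with
      | zero => exact congrArg _ (Subsingleton.elim _ _)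
      | succ m => exact (nomatch (show PEmpty from f))
  · funext m R
    exact isEmptyElim R

variable {M : Type} [L₀.Structure M] [LP.Structure M] [LN.Structure M] {s s' : V → M}
  {X : ℕ → M}

theorem TagCompatible.realize_eq {tag N : ℕ} {L : FirstOrder.Language.{0, 0}} [SymbolCode L]
    [L.Structure M] (hL : TagCompatible (L₀ := L₀) (LP := LP) (LN := LN) tag L s s')
    (hev : Evaluates L₀ LP LN (· < bound N) X s s') (htag : tag < 4) {γ : Type} [IsEmpty γ]
    [Encodable γ] {t : L.Term γ} (ht : codeTerm t < N) (v : γ → M) :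
    t.realize v = X (cl tag 0 (codeTerm t)) := by
  rw [hev.term hL (fun t ht => cl_lt_bound htag (Nat.zero_le _) ht) t ht]
  exact congrArg (fun v => t.realize v) (funext fun b => isEmptyElim b)

/-- If the variables of a clause have values of ground closures, the clause holds. -/
theorem realize_of_envSat (I : CheckInput L₀ LP LN V)
    (hX : ClosureSat L₀ (Coded.code I + 1) X) (hE : EnvSat I (Coded.code I + 1) X s)
    {D : Clause L₀ (ExtL LP LN V) ℕ} (hD : D ∈ I.1 ++ liftClauses LN V I.2.1) (val : ℕ → M)
    (h : ∀ x, D.HasVar x → ∃ tag < 4, ∃ t < Coded.code I + 1, val x = X (cl tag 0 t)) :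
    letI := extStructure LP LN s
    D.Realize val := by
  let := extStructure LP LN s
  have b1 := inK_le (Coded.code I)
  have b2 := inGammaSigma_le (Coded.code I)
  rw [inK_code] at b1
  rw [inGammaSigma_code] at b2
  rcases List.mem_append.1 hD with hD | hD
  · have b3 := code_lt_of_mem hD
    obtain ⟨e, he, hv⟩ := exists_env_values hX D.HasVar val (fun x hx => by
      have : codeTerm (FirstOrder.Language.Term.var x : (L₀.sum (ExtL LP LN V)).Term ℕ) < _ :=
        codeTerm_lt_code hx
      exact Nat.lt_succ_of_le ((this.trans (b3.trans_le b1)).le)) h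
    exact (Clause.realize_congr fun x hx => hv 1 (by omega) x hx).1 ((hE e he).1 D hD)
  · obtain ⟨D, hD₀, rfl⟩ := List.mem_map.1 hD
    have b3 := code_lt_of_mem hD₀
    simp only [Clause.hasVar_mapExt] at h
    obtain ⟨e, he, hv⟩ := exists_env_values hX D.HasVar val (fun x hx => by
      have : codeTerm (FirstOrder.Language.Term.var x : (L₀.sum LP).Term ℕ) < _ :=
        codeTerm_lt_code hx
      exact Nat.lt_succ_of_le ((this.trans (b3.trans_le b2)).le)) h
    refine (realize_mapExt _ D _).2 ?_
    exact (Clause.realize_congr fun x hx => hv 3 (by omega) x hx).1 ((hE e he).2 D hD₀)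

/-- Closed terms of the clauses have values of ground closures. -/
theorem exists_closure_of_closed (I : CheckInput L₀ LP LN V)
    (hev : Evaluates L₀ LP LN (· < bound (Coded.code I + 1)) X s s')
    {D : Clause L₀ (ExtL LP LN V) ℕ} (hD : D ∈ I.1 ++ liftClauses LN V I.2.1)
    {u : (L₀.sum (ExtL LP LN V)).Term ℕ} (hu : u ∈ D.subterms) (hc : varList u = []) (c : ℕ → M) :
    letI := extStructure LP LN s
    ∃ tag < 4, ∃ t < Coded.code I + 1, u.realize c = X (cl tag 0 t) := by
  let := extStructure LP LN s
  have b1 := inK_le (Coded.code I)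
  have b2 := inGammaSigma_le (Coded.code I)
  rw [inK_code] at b1
  rw [inGammaSigma_code] at b2
  rcases List.mem_append.1 hD with hD | hD
  · have b3 := code_lt_of_mem hD
    have b4 := codeTerm_lt_code hu
    have b5 : codeTerm u < Coded.code I + 1 := by omega
    refine ⟨1, by omega, _, b5, ?_⟩
    rw [hev.term (tagCompatible_one L₀ LP LN s s')
      (fun t ht => cl_lt_bound (by omega) (Nat.zero_le _) ht) u b5]
    exact realize_congr_closed hc _ _
  · obtain ⟨D, hD₀, rfl⟩ := List.mem_map.1 hD
    obtain ⟨u, hu₀, rfl⟩ := (Clause.mem_subterms_mapExt _).1 hu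
    have b3 := code_lt_of_mem hD₀
    have b4 := codeTerm_lt_code hu₀
    have b5 : codeTerm u < Coded.code I + 1 := by omega
    refine ⟨3, by omega, _, b5, ?_⟩
    rw [hev.term (tagCompatible_three L₀ LP LN s s')
      (fun t ht => cl_lt_bound (by omega) (Nat.zero_le _) ht) u b5,
      FirstOrder.Language.LHom.realize_onTerm]
    refine realize_congr_closed ?_ _ _
    rw [List.eq_nil_iff_forall_not_mem] at hc ⊢
    exact fun x hx => hc x (mem_varList.2 ((mem_subterms_onTerm _).2 ⟨_, mem_varList.1 hx, rfl⟩))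

/-- Every variable of a clause is an argument of an extension term whose instance lies in `est`. The
substituted term is therefore a subterm of a ground extension term of `K` or `G`, and its value is
that of a ground closure, so some environment realises the instance. -/
theorem realize_instance (I : CheckInput L₀ LP LN V)
    (hFL : FlatLinearBelow (I.1 ++ liftClauses LN V I.2.1))
    (hX : ClosureSat L₀ (Coded.code I + 1) X) (hE : EnvSat I (Coded.code I + 1) X s)
    (hev : Evaluates L₀ LP LN (· < bound (Coded.code I + 1)) X s s')
    {G : List (Clause L₀ (ExtL LP LN V) ℕ)} {c : ℕ → M}
    (hG : letI := extStructure LP LN s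
      ∀ D ∈ G, ∀ u ∈ D.subterms, ∃ tag < 4, ∃ t < Coded.code I + 1, u.realize c = X (cl tag 0 t)) :
    letI := extStructure LP LN s
    ∀ D ∈ instances (I.1 ++ liftClauses LN V I.2.1) (est (I.1 ++ liftClauses LN V I.2.1) G),
      ∀ v : ℕ → M, D.Realize (Sum.elim c v) := by
  let := extStructure LP LN s
  rintro _ ⟨D, hD, σ, rfl, hest, -⟩ v
  rw [Clause.realize_subst]
  refine realize_of_envSat I hX hE hD _ fun x hx => ?_
  obtain ⟨hflat, -, hbelow⟩ := hFL D hD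
  obtain ⟨m, f, ts, hf, i, hi⟩ := hbelow x hx
  -- A clause containing `x` is not ground, so flatness makes the whole argument a variable, which
  -- must be `x`.
  obtain ⟨y, hy⟩ := (hflat m f ts hf i).1 fun h => h x hx
  rw [hy, varList, List.mem_singleton] at hi
  subst hi
  obtain ⟨u, ⟨-, hu⟩, e⟩ := hest _ (Clause.mem_subterms_subst σ hf)
    ⟨m, f, fun i => (ts i).subst σ, rfl⟩
  have hsub : ∃ w ∈ subterms u, σ x = w.relabel Sum.inl := by
    cases u with
    | var a => cases e
    | func g us =>
      rw [extTerm, FirstOrder.Language.Term.subst, FirstOrder.Language.Term.relabel] at e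
      injection e with h₁ h₂ h₃
      subst h₁
      refine ⟨us i, mem_subterms_func.2 (Or.inr ⟨i, mem_subterms_self _⟩), ?_⟩
      have := congrFun (eq_of_heq h₃) i
      rw [hy] at this
      exact this
  obtain ⟨w, hw, e⟩ := hsub
  rw [e, FirstOrder.Language.Term.realize_relabel, Sum.elim_comp_inl]
  rcases hu with ⟨D', hD', hu⟩ | ⟨D', hD', hu, hc⟩
  · exact hG D' hD' w (Clause.subterms_trans hu hw)
  · exact exists_closure_of_closed I hev hD' (Clause.subterms_trans hu hw)
      (varList_eq_nil_of_mem hc hw) c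

/-- Values of the closures that satisfy the constraints and the ground clauses `G` show that the
theory of the system has a model in which `G` holds. -/
theorem exists_isSysModel [Nonempty M] {T₀ : L₀.Theory} (I : CheckInput L₀ LP LN V)
    (hFL : FlatLinearBelow (I.1 ++ liftClauses LN V I.2.1))
    (hLoc : Loc T₀ (I.1 ++ liftClauses LN V I.2.1)) (hT : M ⊨ T₀)
    (hX : ClosureSat L₀ (Coded.code I + 1) X) (hE : EnvSat I (Coded.code I + 1) X s)
    (hev : Evaluates L₀ LP LN (· < bound (Coded.code I + 1)) X s s')
    {G : List (Clause L₀ (ExtL LP LN V) ℕ)} {c : ℕ → M}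
    (hG : letI := extStructure LP LN s
      ∀ D ∈ G, ∀ u ∈ D.subterms, ∃ tag < 4, ∃ t < Coded.code I + 1, u.realize c = X (cl tag 0 t))
    (hGc : letI := extStructure LP LN s
      ∀ D ∈ G, D.Realize c) :
    ∃ (M' : Type) (_ : Nonempty M') (_ : L₀.Structure M') (_ : LP.Structure M')
      (_ : LN.Structure M') (s₁ : V → M') (c' : ℕ → M'),
      IsSysModel T₀ (I.1 ++ liftClauses LN V I.2.1) M' s₁ ∧
      (letI := extStructure LP LN s₁
       ∀ D ∈ G, D.Realize c') := by
  -- Both sides of `Loc` are unsatisfiability statements: without the required model `T₀ ∪ K ∪ G`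
  -- would be unsatisfiable, hence also its local form, which `M` satisfies.
  by_contra hno
  refine (hLoc G).1 ?_ ⟨M, inferInstance, inferInstance, extStructure LP LN s, c, hT,
    realize_instance I hFL hX hE hev hG, hGc⟩
  rintro ⟨M', hM', h₀, h₁, c', hmod, hGc'⟩
  obtain ⟨hP, hN, s₁, rfl⟩ := exists_eq_extStructure h₁
  exact hno ⟨M', hM', h₀, hP, hN, s₁, c', hmod, hGc'⟩

/-- The assignment of the values of the primed system variables to the fresh constants. -/
theorem exists_constants [Nonempty M] (s' : V → M) :
    ∃ c : ℕ → M, ∀ w, c (Encodable.encode w) = s' w :=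
  ⟨fun k => ((Encodable.decode (α := V) k).map s').getD (Classical.arbitrary M), fun w => by simp⟩

/-- This discharges the assumption on `G` in `realize_instance` for the clauses produced by
`exists_clausesFor`. -/
theorem NamedClauses.realize_eq {tag : ℕ} {L : FirstOrder.Language.{0, 0}} [SymbolCode L]
    [L.Structure M] {N : ℕ} {G : List (Clause L₀ (ExtL LP LN V) ℕ)} (h : NamedClauses tag L N G)
    (hL : TagCompatible (L₀ := L₀) (LP := LP) (LN := LN) tag L s s') (htag : tag < 4)
    (hev : Evaluates L₀ LP LN (· < bound N) X s s') {c : ℕ → M}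
    (hc : ∀ w, c (Encodable.encode w) = s' w) :
    letI := extStructure LP LN s
    ∀ D ∈ G, ∀ u ∈ D.subterms, ∃ tag < 4, ∃ t < N, u.realize c = X (cl tag 0 t) := by
  intro D hD u hu
  obtain ⟨t, ht, h⟩ := h D hD u hu
  have : Nonempty M := ⟨X 0⟩
  refine ⟨tag, htag, _, ht, ?_⟩
  rw [h M s s' c (fun _ => Classical.arbitrary M) hL hc]
  exact hL.realize_eq hev htag ht _

end Locality

end ParamSys


namespace ParamSys

/-! ### Components of the ground problems. -/

section Split

variable {T : FirstOrder.Language.{0, 0}} [SymbolCode T] {α : Type} [Encodable α] {n : ℕ}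
  {nm : ℕ → α ⊕ Fin n} {M : Type} [T.Structure M] {v : α → M} {xs : Fin n → M} {w : ℕ}

theorem realize_initF : (initF nm w : T.BoundedFormula α n).Realize v xs ↔
    (systemF nm w : T.BoundedFormula α n).Realize v xs ∧
      (initGroundF nm w : T.BoundedFormula α n).Realize v xs := by
  rw [initF, FirstOrder.Language.BoundedFormula.realize_inf]

theorem realize_stepF : (stepF nm w : T.BoundedFormula α n).Realize v xs ↔
    (systemF nm w : T.BoundedFormula α n).Realize v xs ∧
      (stepGroundF nm w : T.BoundedFormula α n).Realize v xs := by
  rw [stepF, FirstOrder.Language.BoundedFormula.realize_inf]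

theorem closureSat_of_systemF (h : (systemF nm w : T.BoundedFormula α n).Realize v xs) :
    ClosureSat T (w + 1) fun c => Sum.elim v xs (nm c) := by
  rw [systemF, FirstOrder.Language.BoundedFormula.realize_inf] at h
  exact realize_closureF.1 h.1

end Split

/-! ## Correctness of the reduction to ground satisfiability -/

section Reduction

variable {L₀ LP LN : FirstOrder.Language.{0, 0}} {V : Type} [SymbolCode L₀] [SymbolCode LP]
  [SymbolCode LN] [Encodable V] [LP.IsAlgebraic] [LN.IsAlgebraic]

/-- From values to a model: interpret the extension symbols by the values, turn `Γ₀`, `Init` and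
`¬Φ` into ground clauses, apply locality and translate back. From a model to values: evaluate all
closures. -/
theorem baseSat_initF {T₀ : L₀.Theory} (I : CheckInput L₀ LP LN V) (hI : I.Admissible T₀) :
    BaseSat T₀ (initF Sum.inl (Coded.code I)) ↔
      ∃ (M : Type) (_ : Nonempty M) (_ : L₀.Structure M) (_ : LP.Structure M)
        (_ : LN.Structure M) (s : V → M),
        IsSysModel T₀ (I.1 ++ liftClauses LN V I.2.1) M s ∧ M ⊨ I.2.2.1 ∧
        HoldsAt M s I.2.2.2.1 ∧ ¬ HoldsAt M s I.2.2.2.2.2 := by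
  obtain ⟨hg, h₀, hFL, hLoc⟩ := hI
  constructor
  · rintro ⟨M, hM, inst, X, hT, hreal⟩
    have hnm : ∀ c, Sum.elim X default ((Sum.inl : ℕ → ℕ ⊕ Fin 0) c) = X c := fun c => rfl
    obtain ⟨hsys, hgr⟩ := realize_initF.1 hreal
    have hX : ClosureSat L₀ (Coded.code I + 1) X :=
      closureSat_of_systemF hsys
    let := interpParam LP X (bound (Coded.code I + 1))
    let := interpFun LN X (bound (Coded.code I + 1))
    have hev := evaluates_interp (LN := LN) (V := V) hX (interpParam_eq (LP := LP) hX)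
    generalize (fun v : V => interpVar X (bound (Coded.code I + 1)) (Sum.inl v)) = s at hev
    generalize (fun v : V => interpVar X (bound (Coded.code I + 1)) (Sum.inr v)) = s' at hev
    obtain ⟨-, hE⟩ := (realize_systemF hnm I hev).1 hsys
    obtain ⟨r₀, r₁, r₂⟩ := (realize_initGroundF hnm I hev
      (fun tag h t ht => cl_lt_bound h (Nat.zero_le _) ht) hg h₀).1 hgr
    obtain ⟨c, hc⟩ := exists_constants s'
    have t1 := tagCompatible_one L₀ LP LN s s'
    have t3 := tagCompatible_three L₀ LP LN s s'
    obtain ⟨G₀, -, a₀, -, n₀, -⟩ := exists_clausesFor t3.translation h₀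
    let := sysStructure L₀ LP LN s
    obtain ⟨G₁, -, a₁, -, n₁, -⟩ := exists_clausesFor t1.translation hg.1
    obtain ⟨-, G₂, -, a₂, -, n₂⟩ := exists_clausesFor t1.translation hg.2.2
    have b0 := inGammaZero_le (Coded.code I)
    have b1 := inInit_le (Coded.code I)
    have b2 := inPhi_le (Coded.code I)
    rw [inGammaZero_code] at b0
    rw [inInit_code] at b1
    rw [inPhi_code] at b2
    obtain ⟨M', hM', _, _, _, s₁, c', hmod, hG⟩ := exists_isSysModel (G := G₀ ++ (G₁ ++ G₂)) (c := c)
      I hFL hLoc hT hX hE hev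
      (fun D hD => by
        rcases List.mem_append.1 hD with hD | hD
        · exact (n₀.mono (by omega)).realize_eq t3 (by omega) hev hc D hD
        rcases List.mem_append.1 hD with hD | hD
        · exact (n₁.mono (by omega)).realize_eq t1 (by omega) hev hc D hD
        · exact (n₂.mono (by omega)).realize_eq t1 (by omega) hev hc D hD)
      (fun D hD => by
        rcases List.mem_append.1 hD with hD | hD
        · exact (a₀ M s s' c t3 hc).2 r₀ D hD
        rcases List.mem_append.1 hD with hD | hD
        · exact (a₁ M s s' c t1 hc).2 r₁ D hD
        · exact (a₂ M s s' c t1 hc).2 r₂ D hD)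
    -- In the new model the primed variables are defined to be the values of their fresh constants.
    have hc' : ∀ w : V, c' (Encodable.encode w) = (fun w => c' (Encodable.encode w)) w :=
      fun _ => rfl
    have t1' := tagCompatible_one L₀ LP LN s₁ fun w => c' (Encodable.encode w)
    have t3' := tagCompatible_three L₀ LP LN s₁ fun w => c' (Encodable.encode w)
    let := sysStructure L₀ LP LN s₁
    refine ⟨M', hM', _, _, _, s₁, hmod, ?_, ?_, ?_⟩
    · exact (a₀ M' s₁ _ c' t3' hc').1 fun D hD => hG D (by simp [hD])
    · exact (a₁ M' s₁ _ c' t1' hc').1 fun D hD => hG D (by simp [hD])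
    · exact (a₂ M' s₁ _ c' t1' hc').1 fun D hD => hG D (by simp [hD])
  · rintro ⟨M, hM, _, _, _, s, hmod, hP⟩
    -- The initial condition does not involve primed variables; `s` is used for them as well.
    obtain ⟨X, hev, -, hsys⟩ := realize_systemF_of_isSysModel I hmod s
    exact ⟨M, hM, inferInstance, X, hmod.1, realize_initF.2
      ⟨hsys fun c => rfl, (realize_initGroundF (fun c => rfl) I hev (fun _ _ _ _ => trivial) hg h₀).2
        hP⟩⟩

/-- The same argument with four ground formulas read under four tags. The clauses of the system
mention only unprimed variables, so primed ones enter the locality argument merely as fresh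
constants in `G`. -/
theorem baseSat_stepF {T₀ : L₀.Theory} (I : CheckInput L₀ LP LN V) (hI : I.Admissible T₀) :
    BaseSat T₀ (stepF Sum.inl (Coded.code I)) ↔
      ∃ (M : Type) (_ : Nonempty M) (_ : L₀.Structure M) (_ : LP.Structure M)
        (_ : LN.Structure M) (s s' : V → M),
        IsSysModel T₀ (I.1 ++ liftClauses LN V I.2.1) M s ∧ M ⊨ I.2.2.1 ∧
        HoldsAt M s I.2.2.2.2.2 ∧ HoldsAt M (Sum.elim s s') I.2.2.2.2.1 ∧
        ¬ HoldsAt M s' I.2.2.2.2.2 := by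
  obtain ⟨hg, h₀, hFL, hLoc⟩ := hI
  constructor
  · rintro ⟨M, hM, inst, X, hT, hreal⟩
    have hnm : ∀ c, Sum.elim X default ((Sum.inl : ℕ → ℕ ⊕ Fin 0) c) = X c := fun c => rfl
    obtain ⟨hsys, hgr⟩ := realize_stepF.1 hreal
    have hX : ClosureSat L₀ (Coded.code I + 1) X :=
      closureSat_of_systemF hsys
    let := interpParam LP X (bound (Coded.code I + 1))
    let := interpFun LN X (bound (Coded.code I + 1))
    have hev := evaluates_interp (LN := LN) (V := V) hX (interpParam_eq (LP := LP) hX)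
    generalize (fun v : V => interpVar X (bound (Coded.code I + 1)) (Sum.inl v)) = s at hev
    generalize (fun v : V => interpVar X (bound (Coded.code I + 1)) (Sum.inr v)) = s' at hev
    obtain ⟨-, hE⟩ := (realize_systemF hnm I hev).1 hsys
    obtain ⟨r₀, r₁, r₂, r₃⟩ := (realize_stepGroundF hnm I hev
      (fun tag h t ht => cl_lt_bound h (Nat.zero_le _) ht) hg h₀).1 hgr
    obtain ⟨c, hc⟩ := exists_constants s'
    have t0 := tagCompatible_zero L₀ LP LN s s'
    have t1 := tagCompatible_one L₀ LP LN s s'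
    have t2 := tagCompatible_two L₀ LP LN s s'
    have t3 := tagCompatible_three L₀ LP LN s s'
    -- Tags 1 and 2 use the same signature with different structures on `M`, so each structure is
    -- made available only locally.
    have T0 : TagTranslation L₀ LP LN V 0 (FullL L₀ LP LN V) :=
      let := sysStructure L₀ LP LN (Sum.elim s s'); t0.translation
    have T1 : TagTranslation L₀ LP LN V 1 (L₀.sum (ExtL LP LN V)) :=
      let := sysStructure L₀ LP LN s; t1.translation
    have T2 : TagTranslation L₀ LP LN V 2 (L₀.sum (ExtL LP LN V)) :=
      let := sysStructure L₀ LP LN s'; t2.translation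
    obtain ⟨G₀, -, a₀, -, n₀, -⟩ := exists_clausesFor t3.translation h₀
    obtain ⟨G₁, -, a₁, -, n₁, -⟩ := exists_clausesFor T1 hg.2.2
    obtain ⟨G₂, -, a₂, -, n₂, -⟩ := exists_clausesFor T0 hg.2.1
    obtain ⟨-, G₃, -, a₃, -, n₃⟩ := exists_clausesFor T2 hg.2.2
    have b0 := inGammaZero_le (Coded.code I)
    have b1 := inUpdate_le (Coded.code I)
    have b2 := inPhi_le (Coded.code I)
    rw [inGammaZero_code] at b0
    rw [inUpdate_code] at b1
    rw [inPhi_code] at b2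
    obtain ⟨M', hM', _, _, _, s₁, c', hmod, hG⟩ := exists_isSysModel
      (G := G₀ ++ (G₁ ++ (G₂ ++ G₃))) (c := c) I hFL hLoc hT hX hE hev
      (fun D hD => by
        rcases List.mem_append.1 hD with hD | hD
        · exact (n₀.mono (by omega)).realize_eq t3 (by omega) hev hc D hD
        rcases List.mem_append.1 hD with hD | hD
        · let := sysStructure L₀ LP LN s
          exact NamedClauses.realize_eq (n₁.mono (by omega)) t1 (by omega) hev hc D hD
        rcases List.mem_append.1 hD with hD | hD
        · let := sysStructure L₀ LP LN (Sum.elim s s')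
          exact NamedClauses.realize_eq (n₂.mono (by omega)) t0 (by omega) hev hc D hD
        · let := sysStructure L₀ LP LN s'
          exact NamedClauses.realize_eq (n₃.mono (by omega)) t2 (by omega) hev hc D hD)
      (fun D hD => by
        rcases List.mem_append.1 hD with hD | hD
        · exact (a₀ M s s' c t3 hc).2 r₀ D hD
        rcases List.mem_append.1 hD with hD | hD
        · exact (@a₁ M _ _ _ (sysStructure L₀ LP LN s) s s' c t1 hc).2 r₁ D hD
        rcases List.mem_append.1 hD with hD | hD
        · exact (@a₂ M _ _ _ (sysStructure L₀ LP LN (Sum.elim s s')) s s' c t0 hc).2 r₂ D hD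
        · exact (@a₃ M _ _ _ (sysStructure L₀ LP LN s') s s' c t2 hc).2 r₃ D hD)
    have hc' : ∀ w : V, c' (Encodable.encode w) = (fun w => c' (Encodable.encode w)) w :=
      fun _ => rfl
    generalize (fun w : V => c' (Encodable.encode w)) = s₁' at hc'
    have t0' := tagCompatible_zero L₀ LP LN s₁ s₁'
    have t1' := tagCompatible_one L₀ LP LN s₁ s₁'
    have t2' := tagCompatible_two L₀ LP LN s₁ s₁'
    have t3' := tagCompatible_three L₀ LP LN s₁ s₁'
    refine ⟨M', hM', _, _, _, s₁, s₁', hmod, ?_, ?_, ?_, ?_⟩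
    · exact (a₀ M' s₁ _ c' t3' hc').1 fun D hD => hG D (by simp [hD])
    · exact (@a₁ M' _ _ _ (sysStructure L₀ LP LN s₁) s₁ _ c' t1' hc').1
        fun D hD => hG D (by simp [hD])
    · exact (@a₂ M' _ _ _ (sysStructure L₀ LP LN (Sum.elim s₁ s₁')) s₁ _ c' t0' hc').1
        fun D hD => hG D (by simp [hD])
    · exact (@a₃ M' _ _ _ (sysStructure L₀ LP LN s₁') s₁ _ c' t2' hc').1
        fun D hD => hG D (by simp [hD])
  · rintro ⟨M, hM, _, _, _, s, s', hmod, hP⟩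
    obtain ⟨X, hev, -, hsys⟩ := realize_systemF_of_isSysModel I hmod s'
    exact ⟨M, hM, inferInstance, X, hmod.1, realize_stepF.2
      ⟨hsys fun c => rfl, (realize_stepGroundF (fun c => rfl) I hev (fun _ _ _ _ => trivial) hg h₀).2
        hP⟩⟩

theorem invariant_iff {T₀ : L₀.Theory} (I : CheckInput L₀ LP LN V) (hI : I.Admissible T₀) :
    I.Invariant T₀ ↔ ¬ BaseSat T₀ (initF Sum.inl (Coded.code I)) ∧
      ¬ BaseSat T₀ (stepF Sum.inl (Coded.code I)) := by
  rw [baseSat_initF I hI, baseSat_stepF I hI]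
  exact Iff.rfl

end Reduction

end ParamSys


namespace ParamSys

/-! ## Semantics of the synthesized constraint -/

section ConstraintSemantics

theorem pair_le_pair {a b c d : ℕ} (h : a ≤ c) (h' : b ≤ d) : Nat.pair a b ≤ Nat.pair c d := by
  have h1 : Nat.pair a b ≤ Nat.pair c b := by
    rcases h.lt_or_eq with h | rfl
    · exact (Nat.pair_lt_pair_left _ h).le
    · exact le_rfl
  have h2 : Nat.pair c b ≤ Nat.pair c d := by
    rcases h'.lt_or_eq with h | rfl
    · exact (Nat.pair_lt_pair_right _ h).le
    · exact le_rfl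
  exact h1.trans h2

theorem varCode_mono {a b : ℕ} (h : a ≤ b) : varCode a ≤ varCode b :=
  pair_le_pair le_rfl (by omega)

theorem varCode_le_nameBound {N k₁ k₂ c : ℕ} (hc : c < bound N) :
    varCode c ≤ nameBound N k₁ k₂ := by
  refine (varCode_mono (hc.le.trans ?_)).trans (Nat.le_add_left _ _)
  exact Nat.right_le_pair _ _

/-- Unpairing does not increase numbers, and copying raises the tag by at most 4; this explains the
`bound N + 4` in `nameBound`. -/
theorem varCode_copy_le_nameBound {N k₁ k₂ c : ℕ} (hc : c < bound N) :
    varCode (copy c) ≤ nameBound N k₁ k₂ := by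
  refine (varCode_mono ?_).trans (Nat.le_add_left _ _)
  have h1 := Nat.unpair_left_le c
  have h2 := Nat.unpair_right_le c
  have h3 := Nat.unpair_left_le c.unpair.1
  have h4 := Nat.unpair_right_le c.unpair.1
  have h5 := Nat.mod_le c.unpair.1.unpair.1 4
  exact pair_le_pair (pair_le_pair (by omega) (by omega)) (by omega)

variable {L₀ LP : FirstOrder.Language.{0, 0}} [SymbolCode L₀] [SymbolCode LP] {M : Type}
  [L₀.Structure M] [LP.Structure M]

/-- The values `Y` of the term codes below `B` are consistent with the base functions. -/
def TermValues (L₀ : FirstOrder.Language.{0, 0}) [SymbolCode L₀] {M : Type} [L₀.Structure M]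
    (B : ℕ) (Y : ℕ → M) : Prop :=
  ∀ t < B, t.unpair.1 ≠ 0 → ∀ (m : ℕ) (f : L₀.Functions m) (a : Fin m → ℕ),
    seq t.unpair.2.unpair.2 = List.ofFn a →
    SymbolCode.fcode (⟨m, f⟩ : Σ n, L₀.Functions n) = t.unpair.2.unpair.1 →
    Y t = FirstOrder.Language.Structure.funMap f fun i => Y (a i)

/-- The names of the parameter terms have the values given by the copies of the arguments. -/
def ParamValues (LP : FirstOrder.Language.{0, 0}) [SymbolCode LP] {M : Type} [LP.Structure M]
    (B : ℕ) (y : ℕ → M) : Prop :=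
  ∀ c < B, ∀ (m : ℕ) (f : LP.Functions m) (a : Fin m → ℕ), args c = List.ofFn a →
    key c = 4 * SymbolCode.fcode (⟨m, f⟩ : Σ n, LP.Functions n) + 2 →
    y c = FirstOrder.Language.Structure.funMap f fun i => y (copy (a i))

/-- Consistency forces the name of each term to have the value computed from the names of its
variables. Hence the result of quantifier elimination can be evaluated by replacing its terms with
names. -/
theorem TermValues.term {B : ℕ} {Y : ℕ → M} (hY : TermValues L₀ B Y)
    (t : L₀.Term (ℕ ⊕ Fin 0)) (ht : codeTerm t < B) (xs : Fin 0 → M) :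
    Y (codeTerm t) = t.realize (Sum.elim (fun k => Y (varCode k)) xs) := by
  induction t with
  | var b =>
    rcases b with b | b
    · rfl
    · exact b.elim0
  | @func m f ts ih =>
    rw [FirstOrder.Language.Term.realize_func,
      hY _ ht (by simp [codeTerm]) m f (fun i => codeTerm (ts i)) (by simp [codeTerm])
        (by simp [codeTerm])]
    exact congrArg _ (funext fun i => ih i ((codeTerm_lt_func f ts i).trans ht))

/-- Base terms are evaluated as closures with tag 0, where symbol codes are unchanged. A variable
`k` is coded by `2 * k`, which explains the division at the leaves. -/
theorem exists_termValues [Nonempty M] (y : ℕ → M) (B : ℕ) :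
    ∃ Y : ℕ → M, TermValues L₀ B Y ∧ ∀ k, Y (varCode k) = y k := by
  refine ⟨fun t => closureValue L₀ (fun c => y (c.unpair.2.unpair.2 / 2)) (cl 0 0 t), ?_, ?_⟩
  · intro t _ h0 m f a ha hf
    have hk : key (cl 0 0 t) = t.unpair.2.unpair.1 + 1 := by simp [key, cl, h0, norm]
    have ha' : args (cl 0 0 t) = (seq t.unpair.2.unpair.2).map (cl 0 0) := by simp [args, cl]
    beta_reduce
    rw [closureValue_of_key_ne_zero (by omega), ha', ha, hk, ← hf, List.map_ofFn, List.map_ofFn,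
      symbolMap_ofFn]
    rfl
  · intro k
    beta_reduce
    rw [closureValue_of_key_eq_zero (by simp [key, cl, varCode])]
    simp [cl, varCode]

variable {m N k₁ k₂ : ℕ} {xs : Fin (m + 1) → M} {Y : ℕ → M}

/-- In `L₀.sum LP` the base symbol with code `k` has code `2 * k`, and the parameter with code `k`
has code `2 * k + 1`, which is half of its key `4 * k + 2`. -/
theorem realize_constraintBody (hY : ∀ t, Sum.elim default xs (allNames m t) = Y t) :
    (constraintBody L₀ LP m N k₁ k₂).Realize default xs ↔
      (TermValues L₀ (m + 1) Y → ParamValues LP (bound N) (fun k => Y (varCode k)) →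
        ¬ (trF (allNames m) id (2 * ·) k₁ : (L₀.sum LP).BoundedFormula Empty (m + 1)).Realize
          default xs ∧
        ¬ (trF (allNames m) id (2 * ·) k₂ : (L₀.sum LP).BoundedFormula Empty (m + 1)).Realize
          default xs) := by
  unfold constraintBody
  rw [FirstOrder.Language.BoundedFormula.realize_imp,
    FirstOrder.Language.BoundedFormula.realize_inf, FirstOrder.Language.BoundedFormula.realize_inf,
    FirstOrder.Language.BoundedFormula.realize_not, FirstOrder.Language.BoundedFormula.realize_not,
    realize_bigAnd, realize_bigAnd, and_imp]
  refine imp_congr (forall₂_congr fun t _ => ?_) (imp_congr (forall₂_congr fun c _ => ?_) Iff.rfl)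
  · split_ifs with h
    · simp [h]
    · rw [realize_appF]
      simp only [hY]
      constructor
      · intro H _ n f a ha hf
        exact H n (Sum.inl f) a ha (by rw [fcode_sum_inl, hf])
      · intro H n f a ha hf
        rcases f with f | f
        · rw [fcode_sum_inl] at hf
          exact H h n f a ha (by omega)
        · rw [fcode_sum_inr] at hf
          omega
  · split_ifs with h
    · rw [realize_appF]
      simp only [hY]
      constructor
      · intro H n f a ha hf
        exact H n (Sum.inr f) (fun i => varCode (copy (a i))) (by rw [ha, List.map_ofFn]; rfl)
          (by rw [fcode_sum_inr]; omega)
      · intro H n f a ha hf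
        rcases f with f | f
        · rw [fcode_sum_inl] at hf
          omega
        · rw [fcode_sum_inr] at hf
          have hlen : (args c).length = n := by simpa using congrArg List.length ha
          subst hlen
          have hab : a = fun i => varCode (copy ((args c).get i)) := by
            refine List.ofFn_injective (ha.symm.trans ?_)
            refine List.ext_getElem (by simp) fun i h1 h2 => by simp
          rw [hab]
          exact H _ f (args c).get (List.ofFn_get _).symm (by omega)
    · exact ⟨fun _ n f a _ hf => by omega, fun _ => by simp⟩

/-- The constraint says that no values of the names that are not eliminated satisfy `ψ₁` or `ψ₂`. -/
theorem realize_constraint [Nonempty M] {ψ₁ ψ₂ : L₀.Formula ℕ} (h₁ : ψ₁.IsQF) (h₂ : ψ₂.IsQF) :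
    M ⊨ constraint L₀ LP N (codeFormula ψ₁) (codeFormula ψ₂) ↔
      ∀ y : ℕ → M, ParamValues LP (bound N) y → ¬ ψ₁.Realize y ∧ ¬ ψ₂.Realize y := by
  have htr : ∀ {m : ℕ} {xs : Fin (m + 1) → M} {Y y : ℕ → M} {ψ : L₀.Formula ℕ}, ψ.IsQF →
      codeFormula ψ ≤ m → (∀ t, Sum.elim default xs (allNames m t) = Y t) →
      (∀ t : L₀.Term (ℕ ⊕ Fin 0), codeTerm t < m + 1 →
        Y (codeTerm t) = t.realize (Sum.elim y default)) →
      ((trF (allNames m) id (2 * ·) (codeFormula ψ) :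
        (L₀.sum LP).BoundedFormula Empty (m + 1)).Realize default xs ↔
        ψ.Realize y) := by
    intro m xs Y y ψ hψ hm hY hT
    refine realize_trF (N := m) (fun t ht => ?_) (fun n R => ⟨Sum.inl R, rcode_sum_inl R,
      fun a => Iff.rfl⟩) hψ hm
    rw [hY]
    exact hT t (by omega)
  have hb₁ : codeFormula ψ₁ ≤ nameBound N (codeFormula ψ₁) (codeFormula ψ₂) := by
    unfold nameBound; omega
  have hb₂ : codeFormula ψ₂ ≤ nameBound N (codeFormula ψ₁) (codeFormula ψ₂) := by
    unfold nameBound; omega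
  have hsent : M ⊨ constraint L₀ LP N (codeFormula ψ₁) (codeFormula ψ₂) ↔
      ∀ xs : Fin (nameBound N (codeFormula ψ₁) (codeFormula ψ₂) + 1) → M,
        (constraintBody L₀ LP (nameBound N (codeFormula ψ₁) (codeFormula ψ₂)) N (codeFormula ψ₁)
          (codeFormula ψ₂)).Realize default xs := by
    unfold constraint
    exact FirstOrder.Language.BoundedFormula.realize_alls
  rw [hsent]
  have hc₁ : ∀ c < bound N, varCode c ≤ nameBound N (codeFormula ψ₁) (codeFormula ψ₂) :=
    fun c hc => varCode_le_nameBound hc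
  have hc₂ : ∀ c < bound N, varCode (copy c) ≤ nameBound N (codeFormula ψ₁) (codeFormula ψ₂) :=
    fun c hc => varCode_copy_le_nameBound hc
  generalize nameBound N (codeFormula ψ₁) (codeFormula ψ₂) = m at hb₁ hb₂ hc₁ hc₂
  constructor
  · intro H y hy
    obtain ⟨Y, hT, hYy⟩ := exists_termValues (L₀ := L₀) y (m + 1)
    -- `allNames` sends indices out of range to the variable 0; `Y'` follows this convention and
    -- agrees with `Y` in the range that matters.
    let Y' : ℕ → M := fun t => if t < m + 1 then Y t else Y 0
    have hY' : ∀ t, Sum.elim default (fun i : Fin (m + 1) => Y i) (allNames m t) = Y' t := by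
      intro t
      unfold allNames Y'
      split_ifs <;> rfl
    have e : ∀ t < m + 1, Y' t = Y t := fun t ht => if_pos ht
    have hT' : TermValues L₀ (m + 1) Y' := by
      intro t ht h0 n f a ha hf
      rw [e t ht, hT t ht h0 n f a ha hf]
      refine congrArg _ (funext fun i => (e _ ?_).symm)
      have h1 : a i ∈ seq t.unpair.2.unpair.2 := by
        rw [ha]; exact (List.mem_ofFn' _ _).2 ⟨i, rfl⟩
      exact ((lt_of_mem_seq h1).trans_le ((Nat.unpair_right_le _).trans
        (Nat.unpair_right_le _))).trans ht
    have hP : ParamValues LP (bound N) fun k => Y' (varCode k) := by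
      intro c hc n f a ha hf
      beta_reduce
      rw [e _ (Nat.lt_succ_of_le (hc₁ c hc)), hYy, hy c hc n f a ha hf]
      refine congrArg _ (funext fun i => ?_)
      have h1 : a i ∈ args c := by rw [ha]; exact (List.mem_ofFn' _ _).2 ⟨i, rfl⟩
      rw [e _ (Nat.lt_succ_of_le (hc₂ _ ((lt_of_mem_args h1).trans hc))), hYy]
    obtain ⟨n₁, n₂⟩ := (realize_constraintBody hY').1 (H _) hT' hP
    have hval : ∀ t : L₀.Term (ℕ ⊕ Fin 0), codeTerm t < m + 1 →
        Y' (codeTerm t) = t.realize (Sum.elim y default) := by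
      intro t ht
      rw [e _ ht, hT.term t ht default, funext hYy]
    rw [htr h₁ hb₁ hY' hval] at n₁
    rw [htr h₂ hb₂ hY' hval] at n₂
    exact ⟨n₁, n₂⟩
  · intro H xs
    refine (realize_constraintBody fun t => rfl).2 fun hT hP => ?_
    rw [htr h₁ hb₁ (fun t => rfl) fun t ht => hT.term t ht default,
      htr h₂ hb₂ (fun t => rfl) fun t ht => hT.term t ht default]
    exact H _ hP

end ConstraintSemantics

end ParamSys


namespace ParamSys

/-! ## Restrictions of total structures -/

section Partial

variable {L₀ L₁ : FirstOrder.Language.{0, 0}} {M : Type} [L₀.Structure M] {α : Type}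

theorem PartialInterp.isSome_args {P : PartialInterp L₁ M} {v : α → M} {m : ℕ}
    {f : (L₀.sum L₁).Functions m} {ts : Fin m → (L₀.sum L₁).Term α}
    (h : (P.eval v (.func f ts)).isSome) (i : Fin m) : (P.eval v (ts i)).isSome := by
  by_contra hi
  rw [PartialInterp.eval, dif_neg fun h => hi (h i)] at h
  simp at h

theorem PartialInterp.isSome_of_mem {P : PartialInterp L₁ M} {v : α → M}
    {t u : (L₀.sum L₁).Term α} (h : (P.eval v t).isSome) (hu : u ∈ subterms t) :
    (P.eval v u).isSome := by
  induction t with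
  | var a => cases (Set.mem_singleton_iff.1 hu); exact h
  | func f ts ih =>
    rcases mem_subterms_func.1 hu with rfl | ⟨i, hi⟩
    · exact h
    · exact ih i (isSome_args h i) hi

variable [L₁.Structure M]

/-- The partial functions are restrictions of the functions of the total structure. -/
def PartialInterp.Restricts (P : PartialInterp L₁ M) : Prop :=
  ∀ (m : ℕ) (f : L₁.Functions m) (a : Fin m → M) (b : M), P.fn f a = some b →
    FirstOrder.Language.Structure.funMap f a = b

variable {P : PartialInterp L₁ M}

/-- Wherever a term is defined in the restriction it has its total value, so weak validity can be
verified in the total structure. -/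
theorem PartialInterp.Restricts.eval (hP : P.Restricts) {v : α → M} {t : (L₀.sum L₁).Term α} {b : M}
    (h : P.eval v t = some b) : t.realize v = b := by
  induction t generalizing b with
  | var a => exact Option.some_injective _ h
  | @func m f ts ih =>
    have hs : (P.eval v (.func f ts)).isSome := by rw [h]; rfl
    have hts : ∀ i, (P.eval v (ts i)).isSome := PartialInterp.isSome_args hs
    have e : (fun i => (ts i).realize v) = fun i => (P.eval v (ts i)).get (hts i) :=
      funext fun i => ih i (Option.some_get (hts i)).symm
    rw [PartialInterp.eval, dif_pos hts] at h
    rw [FirstOrder.Language.Term.realize_func, e]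
    rcases f with f | f
    · exact Option.some_injective _ h
    · exact hP m f _ b h

theorem PartialInterp.Restricts.atomTrue_iff (hP : P.Restricts) {v : α → M} {A : Atom L₀ L₁ α}
    (h : P.AtomDefined v A) : P.AtomTrue v A ↔ A.Realize v := by
  cases A with
  | eq t u =>
    obtain ⟨a, ha⟩ := Option.isSome_iff_exists.1 h.1
    obtain ⟨b, hb⟩ := Option.isSome_iff_exists.1 h.2
    simp only [PartialInterp.AtomTrue, Atom.Realize, hP.eval ha, hP.eval hb, ha, hb,
      Option.some.injEq, exists_eq_left', eq_comm]
  | rel R ts =>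
    choose a ha using fun i => Option.isSome_iff_exists.1 (h i)
    simp only [PartialInterp.AtomTrue, Atom.Realize, fun i => hP.eval (ha i), ha, Option.some.injEq]
    constructor
    · rintro ⟨a', e, h⟩
      rwa [funext e]
    · exact fun h => ⟨a, fun _ => rfl, h⟩

/-- A clause is weakly satisfied if it holds whenever all its terms are defined. -/
theorem PartialInterp.Restricts.weaklySat (hP : P.Restricts) {v : α → M} {D : Clause L₀ L₁ α}
    (h : (∀ t ∈ D.subterms, (P.eval v t).isSome) → D.Realize v) : P.WeaklySat D v := by
  by_cases hd : ∀ l ∈ D, P.AtomDefined v l.atom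
  · obtain ⟨l, hl, hr⟩ := h fun t ht => by
      obtain ⟨l, hl, ht⟩ := Clause.mem_subterms.1 ht
      have hdl := hd l hl
      generalize l.atom = A at ht hdl
      cases A with
      | eq a b =>
        rcases ht with ht | ht
        · exact PartialInterp.isSome_of_mem hdl.1 ht
        · exact PartialInterp.isSome_of_mem hdl.2 ht
      | rel R ts =>
        obtain ⟨i, hi⟩ := Set.mem_iUnion.1 ht
        exact PartialInterp.isSome_of_mem (hdl i) hi
    refine Or.inr ⟨hd, l, hl, ?_⟩
    rw [hP.atomTrue_iff (hd l hl)]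
    exact hr
  · push Not at hd
    exact Or.inl hd

end Partial

/-! ### Dependence of terms and clauses on the symbols that occur in them. -/

section SymbolCongruence

variable {L₀ L₁ : FirstOrder.Language.{0, 0}} {M : Type} [L₀.Structure M] {α : Type}

theorem realize_congr_symbols {h₁ h₂ : L₁.Structure M} {t : (L₀.sum L₁).Term α} {v : α → M}
    (h : ∀ (m : ℕ) (f : L₁.Functions m) (ts : Fin m → (L₀.sum L₁).Term α),
      extTerm f ts ∈ subterms t → ∀ a : Fin m → M, h₁.funMap f a = h₂.funMap f a) :
    @FirstOrder.Language.Term.realize _ M (@FirstOrder.Language.sumStructure _ _ M _ h₁) _ v t =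
      @FirstOrder.Language.Term.realize _ M (@FirstOrder.Language.sumStructure _ _ M _ h₂) _ v
        t := by
  induction t with
  | var a => rfl
  | @func m f ts ih =>
    have e := funext fun i =>
      ih i fun m f us hm => h m f us (mem_subterms_func.2 (Or.inr ⟨i, hm⟩))
    rcases f with f | f
    · exact congrArg (FirstOrder.Language.Structure.funMap (L := L₀) f) e
    · exact (h m f ts (mem_subterms_self _) _).trans (congrArg (h₂.funMap f) e)

/-- The truth of a clause depends only on the interpretation of the symbols that occur in it. -/
theorem Clause.realize_congr_symbols {h₁ h₂ : L₁.Structure M} {D : Clause L₀ L₁ α} {v : α → M}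
    (h : ∀ (m : ℕ) (f : L₁.Functions m), D.HasSymbol f →
      ∀ a : Fin m → M, h₁.funMap f a = h₂.funMap f a) :
    @Clause.Realize _ _ _ M _ h₁ D v ↔ @Clause.Realize _ _ _ M _ h₂ D v := by
  unfold Clause.Realize
  refine exists_congr fun l => and_congr_right fun hl => ?_
  have hA : @Atom.Realize _ _ _ M _ h₁ v l.atom ↔ @Atom.Realize _ _ _ M _ h₂ v l.atom := by
    have h' : ∀ (m : ℕ) (f : L₁.Functions m) (ts : Fin m → (L₀.sum L₁).Term α),
        extTerm f ts ∈ l.atom.subterms → ∀ a : Fin m → M, h₁.funMap f a = h₂.funMap f a :=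
      fun m f ts hts => h m f ⟨ts, Clause.mem_subterms.2 ⟨l, hl, hts⟩⟩
    generalize l.atom = A at h'
    cases A with
    | eq t u =>
      have e₁ := ParamSys.realize_congr_symbols (v := v) fun m f ts hts => h' m f ts (Or.inl hts)
      have e₂ := ParamSys.realize_congr_symbols (v := v) fun m f ts hts => h' m f ts (Or.inr hts)
      exact ⟨fun H => e₁.symm.trans (H.trans e₂), fun H => e₁.trans (H.trans e₂.symm)⟩
    | rel R ts =>
      exact iff_of_eq (congrArg (FirstOrder.Language.Structure.RelMap R) (funext fun i =>
        ParamSys.realize_congr_symbols (t := ts i) (v := v) fun m f us hus =>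
          h' m f us (Set.mem_iUnion.2 ⟨i, hus⟩)))
  unfold Literal.Realize
  rw [hA]

end SymbolCongruence

end ParamSys


namespace ParamSys

/-! ## Completion of the partial structure on the ground closures -/

section GroundInterp

variable {L₀ L₁ : FirstOrder.Language.{0, 0}} {M : Type} [SymbolCode L₁] [L₁.Structure M]
  {N : ℕ} {X : ℕ → M}

/-- The extension term with symbol `f` and arguments `a` is the value of a ground closure. -/
def IsGroundValue (N : ℕ) (X : ℕ → M) {m : ℕ} (f : L₁.Functions m) (a : Fin m → M) : Prop :=
  ∃ tag < 4, ∃ t < N, (args (cl tag 0 t)).map X = List.ofFn a ∧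
    key (cl tag 0 t) = 2 * SymbolCode.fcode (⟨m, f⟩ : Σ n, L₁.Functions n) + 2

open Classical in
/-- The restriction of the extension functions to the values of the ground closures. -/
noncomputable def groundInterp (L₁ : FirstOrder.Language.{0, 0}) {M : Type} [SymbolCode L₁]
    [L₁.Structure M] (N : ℕ) (X : ℕ → M) : PartialInterp L₁ M where
  fn {m} f a := if m = 0 ∨ IsGroundValue N X f a then
    some (FirstOrder.Language.Structure.funMap f a) else none
  const_defined c a := by simp

theorem groundInterp_fn {m : ℕ} {f : L₁.Functions m} {a : Fin m → M}
    (h : m = 0 ∨ IsGroundValue N X f a) :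
    (groundInterp L₁ N X).fn f a = some (FirstOrder.Language.Structure.funMap f a) := if_pos h

theorem of_isSome_groundInterp {m : ℕ} {f : L₁.Functions m} {a : Fin m → M}
    (h : ((groundInterp L₁ N X).fn f a).isSome) : m = 0 ∨ IsGroundValue N X f a := by
  by_contra hc
  rw [show (groundInterp L₁ N X).fn f a = none from if_neg hc] at h
  simp at h

theorem restricts_groundInterp : (groundInterp L₁ N X).Restricts := by
  intro m f a b h
  have h' := groundInterp_fn (of_isSome_groundInterp (N := N) (X := X) (f := f) (a := a)
    (by rw [h]; rfl))
  exact Option.some_injective _ (h'.symm.trans h)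

/-- A ground closure determines its symbol by the key and the arguments by their values, so it
accounts for at most one point of definition, and the closures in question are finitely many. -/
theorem finite_groundInterp :
    {x : Σ n, L₁.Functions (n + 1) × (Fin (n + 1) → M) |
      ((groundInterp L₁ N X).fn x.2.1 x.2.2).isSome}.Finite := by
  have hsub : ∀ c : ℕ, {x : Σ n, L₁.Functions (n + 1) × (Fin (n + 1) → M) |
      (args c).map X = List.ofFn x.2.2 ∧
        key c = 2 * SymbolCode.fcode (⟨x.1 + 1, x.2.1⟩ : Σ n, L₁.Functions n) + 2}.Subsingleton := by
    rintro c ⟨m, f, a⟩ ⟨h1, h2⟩ ⟨m', f', a'⟩ ⟨h3, h4⟩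
    simp only at h1 h2 h3 h4
    have h5 : (⟨m + 1, f⟩ : Σ n, L₁.Functions n) = ⟨m' + 1, f'⟩ := SymbolCode.fcode_inj (by omega)
    cases h5
    rw [List.ofFn_injective (h1.symm.trans h3)]
  refine ((Set.finite_lt_nat 4).biUnion fun tag _ => (Set.finite_lt_nat N).biUnion fun t _ =>
    (hsub (cl tag 0 t)).finite).subset ?_
  rintro ⟨m, f, a⟩ h
  obtain ⟨tag, htag, t, ht, h⟩ := (of_isSome_groundInterp h).resolve_left (Nat.succ_ne_zero m)
  exact Set.mem_biUnion (show tag < 4 from htag) (Set.mem_biUnion (show t < N from ht) h)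

theorem exists_of_mem_args_cl {tag e t d : ℕ} (h : d ∈ args (cl tag e t)) :
    ∃ t' < t, d = cl tag e t' := by
  obtain ⟨t', ht', rfl⟩ := List.mem_map.1 h
  refine ⟨t', (lt_of_mem_seq ht').trans_le ?_, by simp [cl]⟩
  simp only [cl, Nat.unpair_pair]
  exact (Nat.unpair_right_le _).trans (Nat.unpair_right_le _)

/-- A variable below an extension function of a defined term has the value of a ground closure. -/
theorem exists_closure_of_isSome [L₀.Structure M] {m : ℕ} {f : L₁.Functions m}
    {ts : Fin m → (L₀.sum L₁).Term ℕ} {v : ℕ → M}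
    (h : ((groundInterp L₁ N X).eval v (extTerm f ts)).isSome) {i : Fin m} {x : ℕ}
    (hx : ts i = .var x) : ∃ tag < 4, ∃ t < N, v x = X (cl tag 0 t) := by
  have hts := PartialInterp.isSome_args h
  rw [extTerm, PartialInterp.eval, dif_pos hts] at h
  obtain ⟨tag, htag, t, ht, ha, -⟩ :=
    (of_isSome_groundInterp h).resolve_left fun h0 => (h0 ▸ i).elim0
  have h1 : v x ∈ (args (cl tag 0 t)).map X := by
    rw [ha]
    refine (List.mem_ofFn' _ _).2 ⟨i, ?_⟩
    have e : (groundInterp L₁ N X).eval v (ts i) = some (v x) := by rw [hx]; rfl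
    simp [e]
  obtain ⟨d, hd, e⟩ := List.mem_map.1 h1
  obtain ⟨t', ht', rfl⟩ := exists_of_mem_args_cl hd
  exact ⟨tag, htag, t', ht'.trans ht, e.symm⟩

end GroundInterp

/-! ### Completion to a model with unchanged parameters. -/

section Completion

variable {L₀ LP LN : FirstOrder.Language.{0, 0}} {V : Type} [SymbolCode L₀] [SymbolCode LP]
  [SymbolCode LN] [Encodable V] [LP.IsAlgebraic] [LN.IsAlgebraic] {M : Type} [L₀.Structure M]
  [jP : LP.Structure M] {X : ℕ → M}

theorem codeTerm_func {L : FirstOrder.Language.{0, 0}} [SymbolCode L] {β : Type} [Encodable β]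
    {m : ℕ} (f : L.Functions m) (ts : Fin m → L.Term β) :
    codeTerm (.func f ts) = Nat.pair 1 (Nat.pair (SymbolCode.fcode (⟨m, f⟩ : Σ n, L.Functions n))
      (Encodable.encode (List.ofFn fun i => codeTerm (ts i)))) := by rw [codeTerm]

/-- Only codes of system variables are changed by `norm 1`, and these are constants. -/
theorem norm_one_of_pos {m : ℕ} (f : (ExtL LP LN V).Functions (m + 1)) :
    norm 1 (2 * SymbolCode.fcode (⟨m + 1, f⟩ : Σ n, (ExtL LP LN V).Functions n) + 1) =
      2 * SymbolCode.fcode (⟨m + 1, f⟩ : Σ n, (ExtL LP LN V).Functions n) + 1 := by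
  rcases f with f | f | f
  · rw [fcode_sum_inl]
    unfold norm; split_ifs <;> omega
  · change norm 1 (2 * (2 * (2 * SymbolCode.fcode (⟨m + 1, f⟩ : Σ n, LN.Functions n)) + 1) + 1) =
      2 * (2 * (2 * SymbolCode.fcode (⟨m + 1, f⟩ : Σ n, LN.Functions n)) + 1) + 1
    unfold norm; split_ifs <;> omega
  · exact isEmptyElim f

/-- A closed term with code below `N` is represented by a ground closure with tag 1, and this
closure witnesses that its outermost extension function is defined at the argument values. Constants
are defined anyway. -/
theorem isSome_eval_closed [LN.Structure M] {s s' : V → M} {N : ℕ}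
    (hev : Evaluates L₀ LP LN (· < bound N) X s s') {u : (L₀.sum (ExtL LP LN V)).Term ℕ}
    (hu : codeTerm u < N) (hc : varList u = []) (v : ℕ → M) :
    letI := extStructure LP LN s
    ((groundInterp (ExtL LP LN V) N X).eval v u).isSome := by
  let := extStructure LP LN s
  induction u with
  | var a => simp [varList] at hc
  | @func m f ts ih =>
    have hci : ∀ i, varList (ts i) = [] := fun i =>
      varList_eq_nil_of_mem hc (mem_subterms_func.2 (Or.inr ⟨i, mem_subterms_self _⟩))
    have hui : ∀ i, codeTerm (ts i) < N := fun i => (codeTerm_lt_func f ts i).trans hu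
    have hts := fun i => ih i (hui i) (hci i)
    have ha : args (cl 1 0 (codeTerm (.func f ts))) =
        List.ofFn fun i => cl 1 0 (codeTerm (ts i)) := by
      rw [codeTerm_func, args_cl_app, seq_encode, List.map_ofFn]; rfl
    have hk : key (cl 1 0 (codeTerm (.func f ts))) = norm 1 (SymbolCode.fcode
        (⟨m, f⟩ : Σ n, (L₀.sum (ExtL LP LN V)).Functions n)) + 1 := by
      rw [codeTerm_func, key_cl_app]
    have hval : ∀ i, X (cl 1 0 (codeTerm (ts i))) =
        ((groundInterp (ExtL LP LN V) N X).eval v (ts i)).get (hts i) := fun i => by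
      have h1 := restricts_groundInterp.eval (Option.some_get (hts i)).symm
      rw [← h1, realize_congr_closed (hci i) v fun b => X (cl 1 0 (Nat.pair 0 b))]
      exact hev.term (tagCompatible_one L₀ LP LN s s')
        (fun t ht => cl_lt_bound (by omega) (Nat.zero_le _) ht) (ts i) (hui i)
    rw [PartialInterp.eval, dif_pos hts]
    rcases f with f | f
    · rfl
    rcases m with _ | m
    · rw [Sum.elim_inr, groundInterp_fn (Or.inl rfl)]; rfl
    rw [Sum.elim_inr, groundInterp_fn (Or.inr ⟨1, by omega, _, hu, ?_, ?_⟩)]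
    · rfl
    · refine (congrArg (List.map X) ha).trans ?_
      rw [List.map_ofFn]
      exact congrArg List.ofFn (funext hval)
    · exact hk.trans <| congrArg (· + 1) ((congrArg (norm 1) (fcode_sum_inr f)).trans
        (norm_one_of_pos f))

theorem code_lt_of_mem_subterms (I : CheckInput L₀ LP LN V) {D : Clause L₀ (ExtL LP LN V) ℕ}
    (hD : D ∈ I.1) {u : (L₀.sum (ExtL LP LN V)).Term ℕ} (hu : u ∈ D.subterms) :
    codeTerm u < Coded.code I + 1 := by
  have b1 := inK_le (Coded.code I)
  rw [inK_code] at b1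
  have b3 := code_lt_of_mem hD
  have b4 := codeTerm_lt_code hu
  omega

/-- If all terms of a clause are defined, each variable stands below a defined extension term, so
its value is that of a ground closure and the clause holds in a suitable environment. Otherwise the
clause is weakly valid for free. -/
theorem isFiniteWeakPartialModel_groundInterp [LN.Structure M] {s s' : V → M} {T₀ : L₀.Theory}
    (I : CheckInput L₀ LP LN V) (hFL : FlatLinearBelow I.1) (hT : M ⊨ T₀)
    (hX : ClosureSat L₀ (Coded.code I + 1) X) (hE : EnvSat I (Coded.code I + 1) X s)
    (hev : Evaluates L₀ LP LN (· < bound (Coded.code I + 1)) X s s') :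
    letI := extStructure LP LN s
    IsFiniteWeakPartialModel T₀ I.1 (groundInterp (ExtL LP LN V) (Coded.code I + 1) X) := by
  let := extStructure LP LN s
  refine ⟨hT, fun D hD v => restricts_groundInterp.weaklySat fun hdef => ?_, finite_groundInterp, ?_⟩
  · refine realize_of_envSat I hX hE (List.mem_append_left _ hD) v fun x hx => ?_
    obtain ⟨hflat, -, hbelow⟩ := hFL D hD
    obtain ⟨m, f, ts, hf, i, hi⟩ := hbelow x hx
    obtain ⟨y, hy⟩ := (hflat m f ts hf i).1 fun h => h x hx
    rw [hy, varList, List.mem_singleton] at hi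
    subst hi
    exact exists_closure_of_isSome (hdef _ hf) hy
  · rintro t ⟨-, ⟨D, hD, -⟩ | ⟨D, hD, ht, hc⟩⟩ v
    · simp at hD
    · exact isSome_eval_closed hev (code_lt_of_mem_subterms I hD ht) hc v

/-- The structure given by the values of the closures can be changed to a model of the theory of
the system, with the same parameters. -/
theorem exists_completion [Nonempty M] [i₁ : LN.Structure M] {s s' : V → M} {T₀ : L₀.Theory}
    (I : CheckInput L₀ LP LN V) (hFL : FlatLinearBelow I.1) (hcomp : CompF T₀ I.1)
    (hsep : ParametersSeparated I.1)
    (hX : ClosureSat L₀ (Coded.code I + 1) X) (hE : EnvSat I (Coded.code I + 1) X s)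
    (hev : Evaluates L₀ LP LN (· < bound (Coded.code I + 1)) X s s')
    (hmod : ∃ (_ : LN.Structure M) (s₀ : V → M), IsSysModel T₀ I.1 M s₀) :
    ∃ i₂ : LN.Structure M, @IsSysModel L₀ LP LN V T₀ I.1 M _ _ i₂ s ∧
      @Evaluates L₀ LP LN V M _ _ i₂ _ _ _ _
        (fun c => ∃ tag < 4, ∃ t < Coded.code I + 1, c = cl tag 0 t) X s s' := by
  have hT : M ⊨ T₀ := let ⟨_, _, h⟩ := hmod; h.1
  have hweak := isFiniteWeakPartialModel_groundInterp I hFL hT hX hE hev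
  obtain ⟨h₂, hext, hmod₂⟩ := hcomp M inferInstance inferInstance _ hweak
  obtain ⟨p₂, i₂, s₂, rfl⟩ := exists_eq_extStructure h₂
  -- The completion extends the restriction, hence agrees with the structure built from `X` on
  -- constants and at values of ground closures.
  have hagree : ∀ (m : ℕ) (f : (ExtL LP LN V).Functions m) (a : Fin m → M),
      m = 0 ∨ @IsGroundValue _ _ _ (Coded.code I + 1) X m f a →
      (@extStructure LP LN V M p₂ i₂ s₂).funMap f a =
        (@extStructure LP LN V M jP i₁ s).funMap f a := by
    intro m f a h
    exact hext m f a _ (@groundInterp_fn _ _ _ (@extStructure LP LN V M jP i₁ s) _ _ _ _ _ h)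
  have hs : s₂ = s := funext fun w => hagree 0
    (Sum.inr (Sum.inr (show (FirstOrder.Language.constantsOn V).Functions 0 from w))) default
    (Or.inl rfl)
  subst hs
  refine ⟨i₂, ⟨hT, fun D hD v => ?_⟩, ?_⟩
  -- Separation decides where the truth of the clause comes from. Without functional parameters it
  -- is inherited from the completion, whose parameter constants are unchanged; with parameters
  -- only, it is inherited from the given model.
  · rcases hsep D hD with hD' | hD'
    · refine (Clause.realize_congr_symbols (fun m f hf a => ?_)).1 (hmod₂.2 D hD v)
      rcases f with f | f | f
      · cases m with
        | zero => exact hagree 0 (Sum.inl f) a (Or.inl rfl)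
        | succ m => exact (hD' m f hf).elim
      · rfl
      · rfl
    · obtain ⟨i₀, s₀, hmod⟩ := hmod
      refine (Clause.realize_congr_symbols (fun m f hf a => ?_)).1 (hmod.2 D hD v)
      rcases f with f | f
      · rfl
      · exact (hD' m f hf).elim
  -- Only functions from `LN` can have changed, and never at arguments that are values of ground
  -- closures.
  · rintro _ ⟨tag, htag, t, ht, rfl⟩ m g a ha hk
    rw [hev _ (cl_lt_bound htag (Nat.zero_le _) ht) m g a ha hk]
    rcases g with g | g | g | g
    · rfl
    · rfl
    · refine (hagree m (Sum.inr (Sum.inl g)) (fun i => X (a i)) (Or.inr ⟨tag, htag, t, ht, ?_, ?_⟩)).symm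
      · rw [ha, List.map_ofFn]; rfl
      · rw [hk]
        exact congrArg (· + 1) ((fcode_fun (L₀ := L₀) (LP := LP) (X := V ⊕ V) g).trans
          ((fcode_fun (L₀ := L₀) (LP := LP) (X := V) g).symm.trans (fcode_sum_inr (T := L₀) _)))
    · rfl

end Completion

end ParamSys


namespace ParamSys

/-! ## Correctness of the synthesized constraint -/

section Queries

variable {L₀ : FirstOrder.Language.{0, 0}} [SymbolCode L₀] {M : Type} [L₀.Structure M] {w : ℕ}
  {y : ℕ → M}

/-- The copies of the arguments of the parameters have the values of the arguments. -/
def Linked (B : ℕ) (X : ℕ → M) : Prop :=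
  ∀ c < B, key c % 4 = 2 → ∀ d ∈ args c, X d = X (copy d)

theorem realize_initQuery : (initQuery L₀ w).Realize y ↔ ∃ z : Fin (bound (w + 1)) → M,
    (initF (elimNames (bound (w + 1))) w : L₀.BoundedFormula ℕ _).Realize y z ∧
      Linked (bound (w + 1)) fun c => Sum.elim y z (elimNames (bound (w + 1)) c) := by
  unfold initQuery
  rw [FirstOrder.Language.BoundedFormula.realize_exs]
  refine exists_congr fun z => ?_
  rw [FirstOrder.Language.BoundedFormula.realize_inf, realize_linkF]
  exact Iff.rfl

theorem realize_stepQuery : (stepQuery L₀ w).Realize y ↔ ∃ z : Fin (bound (w + 1)) → M,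
    (stepF (elimNames (bound (w + 1))) w : L₀.BoundedFormula ℕ _).Realize y z ∧
      Linked (bound (w + 1)) fun c => Sum.elim y z (elimNames (bound (w + 1)) c) := by
  unfold stepQuery
  rw [FirstOrder.Language.BoundedFormula.realize_exs]
  refine exists_congr fun z => ?_
  rw [FirstOrder.Language.BoundedFormula.realize_inf, realize_linkF]
  exact Iff.rfl

theorem elim_elimNames (X : ℕ → M) (C c : ℕ) :
    Sum.elim X (fun i : Fin C => X i) (elimNames C c) = X c := by
  unfold elimNames
  split_ifs <;> rfl

theorem linked_of_copy {X : ℕ → M} (h : ∀ c, X (copy c) = X c) (B : ℕ) : Linked B X :=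
  fun _ _ _ d _ => (h d).symm

theorem elimNames_copy (C d : ℕ) : elimNames C (copy d) = Sum.inl (copy d) := by
  unfold elimNames
  rw [if_pos (show 3 < (copy d).unpair.1.unpair.1 by simp [copy, cl]; omega)]
  split_ifs <;> rfl

end Queries

/-! ### Sufficiency and weakness of the synthesized constraint. -/

section Synthesis

variable {L₀ LP LN : FirstOrder.Language.{0, 0}} {V : Type} [SymbolCode L₀] [SymbolCode LP]
  [SymbolCode LN] [Encodable V] [LP.IsAlgebraic] [LN.IsAlgebraic]

/-- A synthesis problem as an invariant checking problem without constraints. -/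
def SynthInput.toCheckInput (x : SynthInput L₀ LP LN V) : CheckInput L₀ LP LN V :=
  (x.1, [], ⊤, x.2)

theorem isSysModel_toCheckInput {T₀ : L₀.Theory} (x : SynthInput L₀ LP LN V) {M : Type}
    [L₀.Structure M] [LP.Structure M] [LN.Structure M] {s : V → M} :
    IsSysModel T₀ (x.toCheckInput.1 ++ liftClauses LN V x.toCheckInput.2.1) M s ↔
      IsSysModel T₀ x.1 M s := by
  have : x.toCheckInput.1 ++ liftClauses LN V x.toCheckInput.2.1 = x.1 := List.append_nil _
  rw [this]

variable {M : Type} [L₀.Structure M] [LP.Structure M] [LN.Structure M] {s s' : V → M}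
  {X : ℕ → M}

/-- In actual structures copies have the values of their originals, so genuine values of closures
satisfy the premise of the constraint. -/
theorem paramValues_of_evaluates (hev : Evaluates L₀ LP LN (fun _ => True) X s s')
    (hcopy : ∀ c, X (copy c) = X c) (B : ℕ) : ParamValues LP B X := by
  intro c _ m f a ha hk
  simp only [hcopy]
  exact hev c trivial m (Sum.inr (Sum.inl f)) a ha
    (hk.trans (congrArg (· + 1) (fcode_param (L₀ := L₀) (LN := LN) (X := V ⊕ V) f)).symm)

theorem isQF_top_sentence {L : FirstOrder.Language.{0, 0}} : (⊤ : L.Sentence).IsQF :=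
  FirstOrder.Language.BoundedFormula.IsQF.top

variable {T₀ : L₀.Theory} {qe : L₀.Formula ℕ → L₀.Formula ℕ}

/-- The synthesized constraint, for a given quantifier elimination function. -/
noncomputable def synthConstraint (LP : FirstOrder.Language.{0, 0}) [SymbolCode LP]
    (qe : L₀.Formula ℕ → L₀.Formula ℕ) (w : ℕ) : (L₀.sum LP).Sentence :=
  constraint L₀ LP (w + 1) (codeFormula (qe (initQuery L₀ w))) (codeFormula (qe (stepQuery L₀ w)))

theorem realize_synthConstraint {M : Type} [Nonempty M] [L₀.Structure M] [LP.Structure M]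
    (hqe : EliminatesQuantifiers T₀ qe) (hT : M ⊨ T₀) {w : ℕ} :
    M ⊨ synthConstraint LP qe w ↔ ∀ y : ℕ → M, ParamValues LP (bound (w + 1)) y →
      ¬ (initQuery L₀ w).Realize y ∧ ¬ (stepQuery L₀ w).Realize y := by
  unfold synthConstraint
  rw [realize_constraint (hqe _).1 (hqe _).1]
  refine forall₂_congr fun y _ => ?_
  rw [(hqe _).2 M inferInstance inferInstance hT, (hqe _).2 M inferInstance inferInstance hT]

attribute [irreducible] synthConstraint

/-- A counterexample to either condition provides values of all closures that satisfy the
corresponding query, while the constraint forbids exactly such values. Neither locality nor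
completability enters. -/
theorem isInvariantUnder_synthConstraint (hqe : EliminatesQuantifiers T₀ qe)
    (x : SynthInput L₀ LP LN V) (hg : x.2.Ground) :
    IsInvariantUnder T₀ x.1 (synthConstraint LP qe (Coded.code x.toCheckInput)) x.2.1 x.2.2.1
      x.2.2.2 := by
  constructor
  · rintro ⟨M, hM, _, _, _, s, hmod, hΓ, hP⟩
    obtain ⟨X, hev, hcopy, hsys⟩ :=
      realize_systemF_of_isSysModel x.toCheckInput ((isSysModel_toCheckInput x).2 hmod) s
    have hT : M ⊨ T₀ := hmod.1
    have hc := (realize_synthConstraint hqe hT).1 hΓ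
    refine (hc X (paramValues_of_evaluates hev hcopy _)).1
      (realize_initQuery.2 ⟨fun i => X i, realize_initF.2 ⟨hsys (elim_elimNames X _), ?_⟩, ?_⟩)
    · exact (realize_initGroundF (elim_elimNames X _) x.toCheckInput hev (fun _ _ _ _ => trivial) hg
        isQF_top_sentence).2 ⟨fun h => h, hP⟩
    · simp only [elim_elimNames]
      exact linked_of_copy hcopy _
  · rintro ⟨M, hM, _, _, _, s, s', hmod, hΓ, hP⟩
    obtain ⟨X, hev, hcopy, hsys⟩ :=
      realize_systemF_of_isSysModel x.toCheckInput ((isSysModel_toCheckInput x).2 hmod) s'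
    have hT : M ⊨ T₀ := hmod.1
    have hc := (realize_synthConstraint hqe hT).1 hΓ
    refine (hc X (paramValues_of_evaluates hev hcopy _)).2
      (realize_stepQuery.2 ⟨fun i => X i, realize_stepF.2 ⟨hsys (elim_elimNames X _), ?_⟩, ?_⟩)
    · exact (realize_stepGroundF (elim_elimNames X _) x.toCheckInput hev (fun _ _ _ _ => trivial) hg
        isQF_top_sentence).2 ⟨fun h => h, hP⟩
    · simp only [elim_elimNames]
      exact linked_of_copy hcopy _

/-- Values of the names that satisfy the system give a model of the theory of the system with the
given parameters. -/
theorem exists_model_of_values [Nonempty M] (x : SynthInput L₀ LP LN V)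
    (hFL : FlatLinearBelow x.1) (hcomp : CompF T₀ x.1) (hsep : ParametersSeparated x.1)
    {s₀ : V → M} (hmod : IsSysModel T₀ x.1 M s₀) {y : ℕ → M}
    (hy : ParamValues LP (bound (Coded.code x.toCheckInput + 1)) y)
    {z : Fin (bound (Coded.code x.toCheckInput + 1)) → M}
    (hsys : (systemF (elimNames (bound (Coded.code x.toCheckInput + 1)))
      (Coded.code x.toCheckInput) : L₀.BoundedFormula ℕ _).Realize y z)
    (hlink : Linked (bound (Coded.code x.toCheckInput + 1))
      fun c => Sum.elim y z (elimNames (bound (Coded.code x.toCheckInput + 1)) c)) :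
    ∃ (i₂ : LN.Structure M) (s s' : V → M), @IsSysModel L₀ LP LN V T₀ x.1 M _ _ i₂ s ∧
      @Evaluates L₀ LP LN V M _ _ i₂ _ _ _ _
        (fun c => ∃ tag < 4, ∃ t < Coded.code x.toCheckInput + 1, c = cl tag 0 t)
        (fun c => Sum.elim y z (elimNames (bound (Coded.code x.toCheckInput + 1)) c)) s s' := by
  have hX := closureSat_of_systemF hsys
  -- `ParamValues` computes a parameter term from copies of its arguments and `hlink` identifies the
  -- copies with the arguments; so the names obey the parameters of the given model.
  have hP : ∀ c < bound (Coded.code x.toCheckInput + 1), ∀ (m : ℕ) (f : LP.Functions m)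
      (a : Fin m → ℕ), args c = List.ofFn a →
      key c = 4 * SymbolCode.fcode (⟨m, f⟩ : Σ n, LP.Functions n) + 2 →
      Sum.elim y z (elimNames (bound (Coded.code x.toCheckInput + 1)) c) =
        FirstOrder.Language.Structure.funMap f fun i =>
          Sum.elim y z (elimNames (bound (Coded.code x.toCheckInput + 1)) (a i)) := by
    intro c hc m f a ha hk
    have h1 : elimNames (bound (Coded.code x.toCheckInput + 1)) c = Sum.inl c :=
      if_pos (by omega)
    rw [h1, Sum.elim_inl, hy c hc m f a ha hk]
    refine congrArg _ (funext fun i => ?_)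
    have h2 := hlink c hc (by omega) (a i) (by rw [ha]; exact (List.mem_ofFn' _ _).2 ⟨i, rfl⟩)
    beta_reduce at h2
    rw [h2, elimNames_copy, Sum.elim_inl]
  have hmod' : ∃ (_ : LN.Structure M) (s₀ : V → M), IsSysModel T₀ x.1 M s₀ := ⟨_, s₀, hmod⟩
  let i₁ : LN.Structure M := interpFun LN
    (fun c => Sum.elim y z (elimNames (bound (Coded.code x.toCheckInput + 1)) c))
    (bound (Coded.code x.toCheckInput + 1))
  have hev := evaluates_interp (LN := LN) (V := V) hX hP
  generalize (fun v : V => interpVar _ _ (Sum.inl v)) = s at hev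
  generalize (fun v : V => interpVar _ _ (Sum.inr v)) = s' at hev
  obtain ⟨-, hE⟩ := (realize_systemF (fun c => rfl) x.toCheckInput hev).1 hsys
  obtain ⟨i₂, h₁, h₂⟩ := exists_completion x.toCheckInput hFL hcomp hsep hX hE hev hmod'
  exact ⟨i₂, s, s', h₁, h₂⟩

/-- Values that violate the constraint in a model of `Γ` give another interpretation of the
non-parametric symbols on the same support with the same parameters. It still satisfies `Γ` and is a
counterexample to invariance. The converse follows from sufficiency, since models of `Γ` are models
of the constraint. -/
theorem isWeakestCondition_synthConstraint (hqe : EliminatesQuantifiers T₀ qe)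
    (x : SynthInput L₀ LP LN V) (hg : x.2.Ground) (hFL : FlatLinearBelow x.1)
    (hcomp : CompF T₀ x.1) (hsep : ParametersSeparated x.1) :
    IsWeakestCondition T₀ x.1 (synthConstraint LP qe (Coded.code x.toCheckInput)) x.2.1 x.2.2.1
      x.2.2.2 := by
  intro Γ
  constructor
  · rintro ⟨hinit, hstep⟩ M hM _ _ _ s₀ hmod hΓ
    have hT : M ⊨ T₀ := hmod.1
    refine (realize_synthConstraint hqe hT).2 fun y hy => ⟨fun h => ?_, fun h => ?_⟩
    · obtain ⟨z, hz, hlink⟩ := realize_initQuery.1 h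
      obtain ⟨hsys, hgr⟩ := realize_initF.1 hz
      obtain ⟨i₂, s, s', h₁, h₂⟩ := exists_model_of_values x hFL hcomp hsep hmod hy hsys hlink
      obtain ⟨-, hP⟩ := (@realize_initGroundF L₀ LP LN V _ _ _ _ _ _ M _ _ i₂ s s' _ _ _ _ _ _ _ _
        (fun c => rfl) x.toCheckInput h₂ (fun tag htag t ht => ⟨tag, htag, t, ht, rfl⟩) hg
        isQF_top_sentence).1 hgr
      exact hinit ⟨M, hM, _, _, i₂, s, h₁, hΓ, hP⟩
    · obtain ⟨z, hz, hlink⟩ := realize_stepQuery.1 h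
      obtain ⟨hsys, hgr⟩ := realize_stepF.1 hz
      obtain ⟨i₂, s, s', h₁, h₂⟩ := exists_model_of_values x hFL hcomp hsep hmod hy hsys hlink
      obtain ⟨-, hP⟩ := (@realize_stepGroundF L₀ LP LN V _ _ _ _ _ _ M _ _ i₂ s s' _ _ _ _ _ _ _ _
        (fun c => rfl) x.toCheckInput h₂ (fun tag htag t ht => ⟨tag, htag, t, ht, rfl⟩) hg
        isQF_top_sentence).1 hgr
      exact hstep ⟨M, hM, _, _, i₂, s, s', h₁, hΓ, hP⟩
  · intro h
    obtain ⟨hinit, hstep⟩ := isInvariantUnder_synthConstraint hqe x hg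
    constructor
    · rintro ⟨M, hM, _, _, _, s, hmod, hΓ, hP⟩
      exact hinit ⟨M, hM, _, _, _, s, hmod, h M hM _ _ _ s hmod hΓ, hP⟩
    · rintro ⟨M, hM, _, _, _, s, s', hmod, hΓ, hP⟩
      exact hstep ⟨M, hM, _, _, _, s, s', hmod, h M hM _ _ _ s hmod hΓ, hP⟩

end Synthesis

end ParamSys


namespace ParamSys

/-! ## Computability of the constructions -/

section Computability

variable {L₀ LP LN : FirstOrder.Language.{0, 0}} {V : Type} [SymbolCode L₀] [SymbolCode LP]
  [SymbolCode LN] [Encodable V] [DecidableArity L₀] [DecidableArity LP]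

/-- The reduction of an invariant checking problem to two ground satisfiability problems. -/
noncomputable def reduction (I : CheckInput L₀ LP LN V) : L₀.Formula ℕ × L₀.Formula ℕ :=
  (initF Sum.inl (Coded.code I), stepF Sum.inl (Coded.code I))

theorem computable_codeFormula_initF :
    Computable fun w => codeFormula (initF Sum.inl w : L₀.Formula ℕ) :=
  CF.initF primrecNames_inl Primrec.id

theorem computable_codeFormula_stepF :
    Computable fun w => codeFormula (stepF Sum.inl w : L₀.Formula ℕ) :=
  CF.stepF primrecNames_inl Primrec.id

theorem computableOnCodes_reduction :
    ComputableOnCodes (reduction : CheckInput L₀ LP LN V → L₀.Formula ℕ × L₀.Formula ℕ) :=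
  ⟨fun w => Nat.pair (codeFormula (initF Sum.inl w : L₀.Formula ℕ))
      (codeFormula (stepF Sum.inl w : L₀.Formula ℕ)),
    computable_natPair computable_codeFormula_initF computable_codeFormula_stepF, fun _ => rfl⟩

/-- Both formulas are quantifier-free functions of the code `w`, so the assumed decision procedure
can be applied to each, and its two answers are negated and combined. -/
theorem decidableOn_invariant [LP.IsAlgebraic] [LN.IsAlgebraic] {T₀ : L₀.Theory}
    (h : DecidableOn (fun G : L₀.Formula ℕ => G.IsQF) (BaseSat T₀)) :
    DecidableOn (fun I : CheckInput L₀ LP LN V => I.Admissible T₀) (fun I => I.Invariant T₀) := by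
  obtain ⟨d, hd, h⟩ := h
  refine ⟨fun w => !d (codeFormula (initF Sum.inl w : L₀.Formula ℕ)) &&
    !d (codeFormula (stepF Sum.inl w : L₀.Formula ℕ)), ?_, fun I hI => ?_⟩
  · exact Primrec.and.to_comp.comp
      (Primrec.not.to_comp.comp (hd.comp computable_codeFormula_initF))
      (Primrec.not.to_comp.comp (hd.comp computable_codeFormula_stepF))
  · have h₁ := h (initF Sum.inl (Coded.code I)) (isQF_initF _ _)
    have h₂ := h (stepF Sum.inl (Coded.code I)) (isQF_stepF _ _)
    refine Iff.trans ?_ (invariant_iff I hI).symm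
    rw [← h₁, ← h₂, Bool.and_eq_true, Bool.not_eq_true', Bool.not_eq_true', Bool.not_eq_true,
      Bool.not_eq_true]
    exact Iff.rfl

/-- The code of a synthesis problem as an invariant checking problem. -/
def toCheckCode (L₀ LP : FirstOrder.Language.{0, 0}) [SymbolCode L₀] [SymbolCode LP] (u : ℕ) : ℕ :=
  Nat.pair u.unpair.1 (Nat.pair (Coded.code ([] : List (Clause L₀ LP ℕ)))
    (Nat.pair (codeFormula (⊤ : (L₀.sum LP).Sentence)) u.unpair.2))

theorem toCheckCode_code (x : SynthInput L₀ LP LN V) :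
    toCheckCode L₀ LP (Coded.code x) = Coded.code x.toCheckInput := by
  simp [toCheckCode, Coded.code, SynthInput.toCheckInput]

@[fun_prop] theorem primrec_toCheckCode {A : Type} [Primcodable A] {f : A → ℕ} (hf : Primrec f) :
    Primrec fun a => toCheckCode L₀ LP (f a) := by
  unfold toCheckCode; fun_prop

/-- The formulas whose quantifiers have to be eliminated. -/
noncomputable def synthQuery (x : SynthInput L₀ LP LN V) : List (L₀.Formula ℕ) :=
  [initQuery L₀ (Coded.code x.toCheckInput), stepQuery L₀ (Coded.code x.toCheckInput)]

/-- The constraint obtained from the results of quantifier elimination. -/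
noncomputable def synthAssemble (p : SynthInput L₀ LP LN V × List (L₀.Formula ℕ)) :
    (L₀.sum LP).Sentence :=
  constraint L₀ LP (Coded.code p.1.toCheckInput + 1) ((p.2.map codeFormula).getD 0 0)
    ((p.2.map codeFormula).getD 1 0)

theorem computableOnCodes_synthQuery :
    ComputableOnCodes (synthQuery : SynthInput L₀ LP LN V → List (L₀.Formula ℕ)) := by
  -- A list is coded as the successor of the pair of its head and its coded tail, with 0 for the
  -- empty list; this is the code of a list of length two.
  refine ⟨fun u => Nat.pair (codeFormula (initQuery L₀ (toCheckCode L₀ LP u)))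
    (Nat.pair (codeFormula (stepQuery L₀ (toCheckCode L₀ LP u))) 0 + 1) + 1, ?_, fun x => ?_⟩
  · have h₁ : Computable fun u => codeFormula (initQuery L₀ (toCheckCode L₀ LP u)) :=
      CF.initQuery (by fun_prop)
    have h₂ : Computable fun u => codeFormula (stepQuery L₀ (toCheckCode L₀ LP u)) :=
      CF.stepQuery (by fun_prop)
    fun_prop
  · beta_reduce
    rw [toCheckCode_code]
    rfl

theorem computableOnCodes_synthAssemble :
    ComputableOnCodes (synthAssemble : SynthInput L₀ LP LN V × List (L₀.Formula ℕ) →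
      (L₀.sum LP).Sentence) := by
  refine ⟨fun u => codeFormula (constraint L₀ LP (toCheckCode L₀ LP u.unpair.1 + 1)
    ((seq u.unpair.2).getD 0 0) ((seq u.unpair.2).getD 1 0)), ?_, fun p => ?_⟩
  · exact CF.constraint (by fun_prop) (by fun_prop) (by fun_prop)
  · have e₁ : (Coded.code p).unpair.1 = Coded.code p.1 := by simp [Coded.code]
    have e₂ : seq (Coded.code p).unpair.2 = p.2.map codeFormula := by
      have e : (Coded.code p).unpair.2 = Coded.code p.2 := by simp [Coded.code]
      rw [e]
      exact code_clauses p.2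
    beta_reduce
    rw [e₁, e₂, toCheckCode_code]
    rfl

theorem synthAssemble_synthQuery (x : SynthInput L₀ LP LN V)
    (qe : L₀.Formula ℕ → L₀.Formula ℕ) :
    synthAssemble (x, (synthQuery x).map qe) =
      synthConstraint LP qe (Coded.code x.toCheckInput) := by
  unfold synthConstraint
  rfl

end Computability

end ParamSys

theorem mainTheorem2 (L₀ LP LN : FirstOrder.Language.{0, 0}) [LP.IsAlgebraic] [LN.IsAlgebraic]
    [ParamSys.EffectiveSignature L₀] [ParamSys.EffectiveSignature LP]
    [ParamSys.EffectiveSignature LN] (V : Type) [Primcodable V] :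
    -- (a) computable reduction of invariant checking to ground satisfiability in the base theory
    (∃ red : ParamSys.CheckInput L₀ LP LN V → L₀.Formula ℕ × L₀.Formula ℕ,
      ParamSys.ComputableOnCodes red ∧
      ∀ (T₀ : L₀.Theory) (I : ParamSys.CheckInput L₀ LP LN V), I.Admissible T₀ →
        (red I).1.IsQF ∧ (red I).2.IsQF ∧
        (I.Invariant T₀ ↔ ¬ ParamSys.BaseSat T₀ (red I).1 ∧ ¬ ParamSys.BaseSat T₀ (red I).2)) ∧
    -- (a) decidability of invariant checking
    (∀ T₀ : L₀.Theory,
      ParamSys.DecidableOn (fun G : L₀.Formula ℕ => G.IsQF) (ParamSys.BaseSat T₀) →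
      ParamSys.DecidableOn (fun I : ParamSys.CheckInput L₀ LP LN V => I.Admissible T₀)
        (fun I => I.Invariant T₀)) ∧
    -- (b) construction of constraints on the parameters, with the help of quantifier elimination
    (∃ (query : ParamSys.SynthInput L₀ LP LN V → List (L₀.Formula ℕ))
      (assemble : ParamSys.SynthInput L₀ LP LN V × List (L₀.Formula ℕ) →
        (L₀.sum LP).Sentence),
      ParamSys.ComputableOnCodes query ∧ ParamSys.ComputableOnCodes assemble ∧
      ∀ (T₀ : L₀.Theory) (qe : L₀.Formula ℕ → L₀.Formula ℕ),
        ParamSys.EliminatesQuantifiers T₀ qe →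
        ∀ (K : List (ParamSys.Clause L₀ (ParamSys.ExtL LP LN V) ℕ))
          (S : ParamSys.SysInput L₀ LP LN V), S.Ground →
          ∃ Γ : (L₀.sum LP).Sentence,
            Γ = assemble ((K, S), (query (K, S)).map qe) ∧
            Γ.IsUniversal ∧
            ParamSys.IsInvariantUnder T₀ K Γ S.1 S.2.1 S.2.2 ∧
            (ParamSys.FlatLinearBelow K → ParamSys.CompF T₀ K →
              ParamSys.ParametersSeparated K →
              ParamSys.IsWeakestCondition T₀ K Γ S.1 S.2.1 S.2.2)) := by

  refine ⟨⟨ParamSys.reduction, ParamSys.computableOnCodes_reduction, fun T₀ I hI =>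
    ⟨ParamSys.isQF_initF _ _, ParamSys.isQF_stepF _ _, ParamSys.invariant_iff I hI⟩⟩,
    fun T₀ h => ParamSys.decidableOn_invariant h,
    ParamSys.synthQuery, ParamSys.synthAssemble, ParamSys.computableOnCodes_synthQuery,
    ParamSys.computableOnCodes_synthAssemble, fun T₀ qe hqe K S hS => ?_⟩
  refine ⟨_, (ParamSys.synthAssemble_synthQuery (K, S) qe).symm, ?_,
    ParamSys.isInvariantUnder_synthConstraint hqe (K, S) hS,
    ParamSys.isWeakestCondition_synthConstraint hqe (K, S) hS⟩
  rw [← ParamSys.synthAssemble_synthQuery (K, S) qe]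
  exact ParamSys.isUniversal_constraint _ _ _
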